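/- Let $\sigma\in\{1,-1\}$, and for $u:\mathbb{R}\to\mathbb{C}$ put $v(x)=i\sigma\overline{u(-x)}$. Let $\langle x\rangle=\sqrt{1+x^2}$, and let $H^{m,s}(\mathbb{R})$ be the space of functions $f$ whose weak derivatives satisfy $\langle x\rangle^s\partial_x^jf\in L^2(\mathbb{R})$ for $0\le j\le m$, with norm $\|f\|_{H^{m,s}}=\sum_{j=0}^m\|\langle x\rangle^s\partial_x^jf\|_{L^2}$; $H^m=H^{m,0}$, and $\|f\|_{H^2\cap H^{1,1}}=\|f\|_{H^2}+\|f\|_{H^{1,1}}$. Let $$Q_1(u)=\frac1{2i}\begin{bmatrix}-uv&u\\2iv_x-uv^2&uv\end{bmatrix},\qquad Q_2(u)=\frac1{2i}\begin{bmatrix}-uv&-2iu_x-u^2v\\v&uv\end{bmatrix}.$$ For $u\in H^{1,1}(\mathbb{R})$ and $z\in\mathbb{R}$, the normalized Jost functions $\mu_\pm(\cdot,z),\nu_\pm(\cdot,z)\in L^\infty_x(\mathbb{R};\mathbb{C}^2)$ are the unique bounded solutions of $$\mu_\pm(x,z)=e_1+\int_{\pm\infty}^x\begin{bmatrix}1&0\\0&e^{2iz(x-y)}\end{bmatrix}Q_1(u(y))\mu_\pm(y,z)\,dy,$$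 $$\nu_\pm(x,z)=e_2+\int_{\pm\infty}^x\begin{bmatrix}e^{-2iz(x-y)}&0\\0&1\end{bmatrix}Q_2(u(y))\nu_\pm(y,z)\,dy,$$ where $e_1=(1,0)^T$, $e_2=(0,1)^T$. Put $$\mu_\pm^\infty(x)=e^{-\frac1{2i}\int_{\pm\infty}^xuv\,dy},\qquad \nu_\pm^\infty(x)=e^{\frac1{2i}\int_{\pm\infty}^xuv\,dy},$$ and, for $u\in H^2\cap H^{1,1}$, let $\alpha_\pm=(\alpha_\pm^{(1)},\alpha_\pm^{(2)})^T$ and $\beta_\pm=(\beta_\pm^{(1)},\beta_\pm^{(2)})^T$ with $$\alpha_\pm^{(1)}=\tfrac14\mu_\pm^\infty\int_{\pm\infty}^x\Big[uv_y-\tfrac1{2i}u^2v^2\Big]dy,\qquad \alpha_\pm^{(2)}=-\tfrac1{2i}\partial_x\big[v\mu_\pm^\infty\big],$$ $$\beta_\pm^{(1)}=-\tfrac1{2i}\partial_x\big[u\nu_\pm^\infty\big],\qquad \beta_\pm^{(2)}=\tfrac14\nu_\pm^\infty\int_{\pm\infty}^x\Big[u_yv+\tfrac1{2i}u^2v^2\Big]dy.$$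 (1) If $u\in H^{1,1}(\mathbb{R})$, then for each choice of the sign $$\mu_\pm(x,z)-\mu_\pm^\infty(x)e_1,\quad \nu_\pm(x,z)-\nu_\pm^\infty(x)e_2\ \in\ L^\infty_x(\mathbb{R}^\pm,H^1_z(\mathbb{R})),$$ and the map $u\mapsto[\mu_\pm-\mu_\pm^\infty e_1,\ \nu_\pm-\nu_\pm^\infty e_2]$ is Lipschitz continuous on bounded sets from $H^{1,1}(\mathbb{R})$ to $L^\infty_x(\mathbb{R}^\pm,H^1_z(\mathbb{R}))$: for every $\gamma\ge0$ there is $C(\gamma)$ such that, for all $u,\tilde u$ of $H^{1,1}$ norm at most $\gamma$, the distance of the images is at most $C(\gamma)\|u-\tilde u\|_{H^{1,1}}$. (2) If $u\in H^2(\mathbb{R})\cap H^{1,1}(\mathbb{R})$, then for each choice of the sign $$z(\mu_\pm(x,z)-\mu_\pm^\infty(x)e_1)-\alpha_\pm(x),\quad z(\nu_\pm(x,z)-\nu_\pm^\infty(x)e_2)-\beta_\pm(x)\ \in\ L^\infty_x(\mathbb{R},L^2_z(\mathbb{R})),$$ and the map from $u$ to these functions is Lipschitz continuous on bounded sets, in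 the same sense, from $H^2(\mathbb{R})\cap H^{1,1}(\mathbb{R})$ to $L^\infty_x(\mathbb{R},L^2_z(\mathbb{R}))$. -/

import Mathlib

open MeasureTheory Set
open scoped ENNReal NNReal ContDiff

noncomputable section

namespace NDNLS

section Sobolev

variable {E : Type*} [NormedAddCommGroup E] [NormedSpace ℝ E]

/-- `g` is a weak (distributional) derivative of `f` on the real line. -/
def HasWeakDeriv (f g : ℝ → E) : Prop :=
  LocallyIntegrable f ∧ LocallyIntegrable g ∧
    ∀ φ : ℝ → ℝ, ContDiff ℝ ∞ φ → HasCompactSupport φ →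
      ∫ x, deriv φ x • f x = - ∫ x, φ x • g x

open Classical in
/-- The weak derivative of `f` (unique up to a null set if it exists; set to `0` otherwise). -/
def weakDeriv (f : ℝ → E) : ℝ → E :=
  if h : ∃ g, HasWeakDeriv f g then h.choose else 0

/-- The function `⟨x⟩ ^ s • f x`, where `⟨x⟩ = √(1 + x²)`. -/
def weighted (s : ℝ) (f : ℝ → E) : ℝ → E :=
  fun x => (√(1 + x ^ 2) ^ s) • f x

/-- Membership in the weighted Sobolev space `H^{m,s}(ℝ)`: the weak derivatives of `f` of the
orders `0, …, m` exist and, multiplied by `⟨x⟩ ^ s`, are square integrable.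
The space `H^m(ℝ)` is `H^{m,0}(ℝ)`. -/
def MemSobolev (s : ℝ) : ℕ → (ℝ → E) → Prop
  | 0, f => MemLp (weighted s f) 2 volume
  | m + 1, f => MemLp (weighted s f) 2 volume ∧
      ∃ g, HasWeakDeriv f g ∧ MemSobolev s m g

/-- The norm of `H^{m,s}(ℝ)`: the sum over `0 ≤ j ≤ m` of the `L²` norms of `⟨x⟩ ^ s ∂ʲf`. -/
def sobolevNorm (s : ℝ) (m : ℕ) (f : ℝ → E) : ℝ≥0∞ :=
  ∑ j ∈ Finset.range (m + 1), eLpNorm (weighted s (weakDeriv^[j] f)) 2 volume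

/-- The function `x ↦ f x ·` belongs to the Bochner space `L^∞_x(S, L²_z(ℝ))`. -/
def MemLinftyL2 (S : Set ℝ) (f : ℝ → ℝ → E) : Prop :=
  ∃ F : ℝ → Lp E 2 (volume : Measure ℝ),
    MemLp F ∞ (volume.restrict S) ∧ ∀ᵐ x ∂(volume.restrict S), F x =ᵐ[volume] f x

/-- The norm of `L^∞_x(S, L²_z(ℝ))`. -/
def linftyL2Norm (S : Set ℝ) (f : ℝ → ℝ → E) : ℝ≥0∞ :=
  essSup (fun x => eLpNorm (f x) 2 volume) (volume.restrict S)

/-- The function `x ↦ f x ·` belongs to the Bochner space `L^∞_x(S, H¹_z(ℝ))`. Here `H¹` is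
identified with the closed subspace of the pairs `(h, h')` in `L² × L²`. -/
def MemLinftyH1 (S : Set ℝ) (f : ℝ → ℝ → E) : Prop :=
  ∃ F G : ℝ → Lp E 2 (volume : Measure ℝ),
    MemLp F ∞ (volume.restrict S) ∧ MemLp G ∞ (volume.restrict S) ∧
      ∀ᵐ x ∂(volume.restrict S), F x =ᵐ[volume] f x ∧ HasWeakDeriv (f x) (G x)

/-- The norm of `L^∞_x(S, H¹_z(ℝ))`. -/
def linftyH1Norm (S : Set ℝ) (f : ℝ → ℝ → E) : ℝ≥0∞ :=
  essSup (fun x => sobolevNorm 0 1 (f x)) (volume.restrict S)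

end Sobolev

/-- Membership in `H^{1,1}(ℝ)`. -/
def MemH11 (u : ℝ → ℂ) : Prop := MemSobolev 1 1 u

/-- The norm of `H^{1,1}(ℝ)`. -/
def normH11 (u : ℝ → ℂ) : ℝ≥0∞ := sobolevNorm 1 1 u

/-- Membership in `H²(ℝ) ∩ H^{1,1}(ℝ)`. -/
def MemH2H11 (u : ℝ → ℂ) : Prop := MemSobolev 0 2 u ∧ MemSobolev 1 1 u

/-- The norm of `H²(ℝ) ∩ H^{1,1}(ℝ)`. -/
def normH2H11 (u : ℝ → ℂ) : ℝ≥0∞ := sobolevNorm 0 2 u + sobolevNorm 1 1 u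

/-- The two choices of the sign `±`. -/
inductive Side
  | plus
  | minus

/-- The half-line `ℝ^±`. -/
def Side.halfLine : Side → Set ℝ
  | .plus => Ioi 0
  | .minus => Iio 0

/-- The integral `∫_{±∞}^x f(y) dy`. -/
def Side.integral {E : Type*} [NormedAddCommGroup E] [NormedSpace ℝ E] :
    Side → ℝ → (ℝ → E) → E
  | .plus, x, f => - ∫ y in Ioi x, f y
  | .minus, x, f => ∫ y in Iic x, f y

open Complex (I)

/-- The nonlocal reduction `v(x) = i σ conj (u(-x))`. -/
def vOf (σ : ℝ) (u : ℝ → ℂ) : ℝ → ℂ := fun x => I * σ * (starRingEnd ℂ) (u (-x))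

/-- The potential matrix `Q₁(u)`. -/
def Q1 (σ : ℝ) (u : ℝ → ℂ) (x : ℝ) : Matrix (Fin 2) (Fin 2) ℂ :=
  let v := vOf σ u
  (1 / (2 * I)) •
    !![-(u x * v x), u x;
       2 * I * weakDeriv v x - u x * v x ^ 2, u x * v x]

/-- The potential matrix `Q₂(u)`. -/
def Q2 (σ : ℝ) (u : ℝ → ℂ) (x : ℝ) : Matrix (Fin 2) (Fin 2) ℂ :=
  let v := vOf σ u
  (1 / (2 * I)) •
    !![-(u x * v x), -(2 * I * weakDeriv u x) - u x ^ 2 * v x;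
       v x, u x * v x]

/-- The unit vector `e₁`. -/
def e1 : Fin 2 → ℂ := ![1, 0]

/-- The unit vector `e₂`. -/
def e2 : Fin 2 → ℂ := ![0, 1]

/-- `m` is a bounded solution of the Volterra equation
`m(x) = e₁ + ∫_{±∞}^x diag(1, exp(2iz(x-y))) Q₁(y) m(y) dy`. -/
def IsJostMu (σ : ℝ) (u : ℝ → ℂ) (s : Side) (z : ℝ) (m : ℝ → Fin 2 → ℂ) : Prop :=
  MemLp m ∞ volume ∧
    ∀ x : ℝ, m x = e1 + s.integral x fun y =>
      (!![1, 0; 0, Complex.exp (2 * I * z * (x - y))] * Q1 σ u y).mulVec (m y)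

/-- `m` is a bounded solution of the Volterra equation
`m(x) = e₂ + ∫_{±∞}^x diag(exp(-2iz(x-y)), 1) Q₂(y) m(y) dy`. -/
def IsJostNu (σ : ℝ) (u : ℝ → ℂ) (s : Side) (z : ℝ) (m : ℝ → Fin 2 → ℂ) : Prop :=
  MemLp m ∞ volume ∧
    ∀ x : ℝ, m x = e2 + s.integral x fun y =>
      (!![Complex.exp (-(2 * I * z * (x - y))), 0; 0, 1] * Q2 σ u y).mulVec (m y)

open Classical in
/-- The normalized Jost function `μ_±(x, z)`: the bounded solution of its Volterra equation. -/
def jostMu (σ : ℝ) (u : ℝ → ℂ) (s : Side) (x z : ℝ) : Fin 2 → ℂ :=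
  if h : ∃ m, IsJostMu σ u s z m then h.choose x else 0

open Classical in
/-- The normalized Jost function `ν_±(x, z)`: the bounded solution of its Volterra equation. -/
def jostNu (σ : ℝ) (u : ℝ → ℂ) (s : Side) (x z : ℝ) : Fin 2 → ℂ :=
  if h : ∃ m, IsJostNu σ u s z m then h.choose x else 0

/-- `μ_±^∞(x) = exp(-(1/2i) ∫_{±∞}^x u v dy)`. -/
def muInf (σ : ℝ) (u : ℝ → ℂ) (s : Side) (x : ℝ) : ℂ :=
  Complex.exp (-(1 / (2 * I)) * s.integral x fun y => u y * vOf σ u y)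

/-- `ν_±^∞(x) = exp((1/2i) ∫_{±∞}^x u v dy)`. -/
def nuInf (σ : ℝ) (u : ℝ → ℂ) (s : Side) (x : ℝ) : ℂ :=
  Complex.exp ((1 / (2 * I)) * s.integral x fun y => u y * vOf σ u y)

/-- The coefficient `α_±(x)` of `1/z` in the expansion of `μ_±(x, z)` at large `z`. -/
def alpha (σ : ℝ) (u : ℝ → ℂ) (s : Side) (x : ℝ) : Fin 2 → ℂ :=
  let v := vOf σ u
  ![(1 / 4) * muInf σ u s x * s.integral x (fun y =>
      u y * weakDeriv v y - (1 / (2 * I)) * u y ^ 2 * v y ^ 2),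
    -(1 / (2 * I)) * weakDeriv (fun y => v y * muInf σ u s y) x]

/-- The coefficient `β_±(x)` of `1/z` in the expansion of `ν_±(x, z)` at large `z`. -/
def beta (σ : ℝ) (u : ℝ → ℂ) (s : Side) (x : ℝ) : Fin 2 → ℂ :=
  let v := vOf σ u
  ![-(1 / (2 * I)) * weakDeriv (fun y => u y * nuInf σ u s y) x,
    (1 / 4) * nuInf σ u s x * s.integral x (fun y =>
      weakDeriv u y * v y + (1 / (2 * I)) * u y ^ 2 * v y ^ 2)]

/-- `μ_±(x, z) - μ_±^∞(x) e₁`. -/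
def muRem (σ : ℝ) (u : ℝ → ℂ) (s : Side) (x z : ℝ) : Fin 2 → ℂ :=
  jostMu σ u s x z - muInf σ u s x • e1

/-- `ν_±(x, z) - ν_±^∞(x) e₂`. -/
def nuRem (σ : ℝ) (u : ℝ → ℂ) (s : Side) (x z : ℝ) : Fin 2 → ℂ :=
  jostNu σ u s x z - nuInf σ u s x • e2

/-- `z (μ_±(x, z) - μ_±^∞(x) e₁) - α_±(x)`. -/
def muRem' (σ : ℝ) (u : ℝ → ℂ) (s : Side) (x z : ℝ) : Fin 2 → ℂ :=
  (z : ℂ) • muRem σ u s x z - alpha σ u s x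

/-- `z (ν_±(x, z) - ν_±^∞(x) e₂) - β_±(x)`. -/
def nuRem' (σ : ℝ) (u : ℝ → ℂ) (s : Side) (x z : ℝ) : Fin 2 → ℂ :=
  (z : ℂ) • nuRem σ u s x z - beta σ u s x

end NDNLS

end

open MeasureTheory Set
open scoped ENNReal NNReal ContDiff

noncomputable section

namespace NDNLS

/-! ### Plancherel for integrable square integrable functions, and Minkowski's inequality -/

section

open scoped FourierTransform SchwartzMap

/-! Everything reduces to one system on a left half-line. For a pair of potentials (q, r) put a =
-(1/2i)qr, b = (1/2i)q, c = r' - (1/2i)qr², d = (1/2i)qr and consider m₁ = 1 + ∫_{-∞}^x (a m₁ + b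
m₂), m₂ = ∫_{-∞}^x e^{2iz(x-y)} (c m₁ + d m₂). The Jost function μ₋ is the case (q, r) = (u, v).
Exchanging the components makes ν₋ the case (v, -u) at the parameter -z, and the reflection (x, z) ↦
(-x, -z) carries the side + to the side -. The potential v is treated as independent of u; the
nonlocal relation enters only because u and v have equal norms. The coefficients lie in the weighted
space L^{2,1}, hence in L¹, and the system is solved by a contraction in a sup norm weighted by
exp(2∫k), where k is the total size of the coefficients.

For the first claim, m∞ = exp(∫a) solves the first equation with m₂ = 0. So (m₁ - m∞, m₂) solves the
same system without the 1 and with the forcing h(x, z) = ∫_{-∞}^x e^{2iz(x-y)} f(y) dy, f = m∞ c, in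
the second equation. In z this is a Fourier transform of f cut off at x, so Plancherel bounds its
L²_z norm by 2‖f‖_{L²(-∞,x)}, which is O(1/⟨x⟩) for x ≤ 0 (`eLpNorm_oscInt_le`). Gronwall at each z,
followed by Minkowski, passes the decay on to the solution (`eLpNorm_gronwall`,
`IsSystem.eLpNorm_le_rho`). Increments by δ in z solve the system again, with an extra forcing of
relative size 2|δ||x-y| ≤ 2|δ||y| for y ≤ x ≤ 0. The decay just obtained pays for |y|, so the
increments are O(|δ|) in L²_z (`IsSystem.eLpNorm_incr_le_rho`) and the difference quotient criterion
gives H¹_z.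

For the second claim, the coefficient of 1/z is chosen so that z times the remainder minus this
coefficient solves the system once more, with forcing (1/2i)(2iz h + f) plus an oscillatory integral
of an L^{2,1} function. Integration by parts turns 2iz h + f formally into the oscillatory integral
of f', and f' ∈ L² because of the H² assumption (`eLpNorm_mul_oscInt_add_le`). No weight is needed
here, so x ranges over the whole line.

Lipschitz continuity costs little more: the difference of two solutions solves the system of the
first one, the differences of the coefficients joining the forcing (`IsSystem.sub`), and all
coefficients arise from the potentials by operations that preserve being bounded and Lipschitz on
bounded sets (`LipBdd`). Measurability in x of the z-derivative, needed for the Bochner space, comes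
from the Lusin–Souslin theorem (`memLinftyH1_of_bound`). -/

theorem fourier_ae_eq_lpFourier {f : ℝ → ℂ} (h1 : Integrable f) (h2 : MemLp f 2) :
    𝓕 f =ᵐ[volume] (𝓕 (h2.toLp f) : Lp ℂ 2 (volume : Measure ℝ)) := by
  have hcont : Continuous (𝓕 f) :=
    VectorFourier.fourierIntegral_continuous Real.continuous_fourierChar
      (by exact continuous_inner) h1
  refine ae_eq_of_integral_contDiff_smul_eq hcont.locallyIntegrable
    ((Lp.memLp _).locallyIntegrable (by norm_num)) fun φ hφ hφc => ?_
  have hφ' : ContDiff ℝ ∞ (fun x => (φ x : ℂ)) := Complex.ofRealCLM.contDiff.comp hφ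
  have hφc' : HasCompactSupport (fun x => (φ x : ℂ)) := hφc.comp_left (g := fun x : ℝ => (x : ℂ)) rfl
  let ψ : 𝓢(ℝ, ℂ) := hφc'.toSchwartzMap hφ'
  have e : ∀ x, ψ x = φ x := fun x => rfl
  -- Tested against ψ, both transforms move onto ψ: the `L²` one by its compatibility with tempered
  -- distributions, the integral one by Fubini (`h3`).
  have h := congrArg (fun T => T ψ) (Lp.fourier_toTemperedDistribution_eq (h2.toLp f))
  simp only [TemperedDistribution.fourier_apply, Lp.toTemperedDistribution_apply] at h
  have hψ : Integrable (ψ : ℝ → ℂ) := ψ.integrable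
  have h3 := VectorFourier.integral_fourierIntegral_smul_eq_flip (L := innerₗ ℝ) (μ := volume)
    (ν := volume) (e := Real.fourierChar) Real.continuous_fourierChar
    (by exact continuous_inner) hψ h1
  have e1 : ∀ x, (𝓕 ψ : 𝓢(ℝ, ℂ)) x = 𝓕 (ψ : ℝ → ℂ) x := fun x => by
    rw [SchwartzMap.fourier_coe]
  calc ∫ x, φ x • 𝓕 f x = ∫ x, ψ x • 𝓕 f x := by simp [e]
    _ = ∫ x, 𝓕 (ψ : ℝ → ℂ) x • f x := by
        simp only [flip_innerₗ] at h3
        exact h3.symm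
    _ = ∫ x, (𝓕 ψ : 𝓢(ℝ, ℂ)) x • h2.toLp f x := by
        refine integral_congr_ae ?_
        filter_upwards [h2.coeFn_toLp] with x hx
        rw [hx, e1]
    _ = _ := by rw [h]; simp [e]

theorem eLpNorm_fourier {f : ℝ → ℂ} (h1 : Integrable f) (h2 : MemLp f 2) :
    eLpNorm (𝓕 f) 2 = eLpNorm f 2 := by
  rw [eLpNorm_congr_ae (fourier_ae_eq_lpFourier h1 h2), ← Lp.enorm_def, ← ofReal_norm,
    Lp.norm_fourier_eq, ofReal_norm, Lp.enorm_toLp]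

/-- Minkowski's integral inequality in `L²`. -/
theorem eLpNorm_lintegral_le {α β : Type*} [MeasurableSpace α] [MeasurableSpace β]
    {μ : Measure α} {ν : Measure β} [SFinite μ] [SFinite ν] {F : α → β → ℝ≥0∞}
    (hF : Measurable (Function.uncurry F)) :
    eLpNorm (fun z => ∫⁻ y, F y z ∂μ) 2 ν ≤ ∫⁻ y, eLpNorm (F y) 2 ν ∂μ := by
  have hn : ∀ g : β → ℝ≥0∞, eLpNorm g 2 ν = (∫⁻ z, g z ^ (2 : ℝ) ∂ν) ^ (1 / (2 : ℝ)) := fun g => by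
    rw [eLpNorm_eq_lintegral_rpow_enorm_toReal two_ne_zero ENNReal.ofNat_ne_top]
    simp
  have hsec : ∀ y, Measurable (F y) := fun y => hF.of_uncurry_left
  have hsec' : ∀ z, Measurable (fun y => F y z) := fun z => hF.of_uncurry_right
  have hmN : Measurable fun y => eLpNorm (F y) 2 ν := by
    simp only [hn]
    exact (Measurable.lintegral_prod_right' (f := fun p : α × β => F p.1 p.2 ^ (2 : ℝ))
      (hF.pow_const _)).pow_const _
  rw [hn, one_div, ENNReal.rpow_inv_le_iff (by norm_num)]
  -- The square becomes a double integral over y and y', Tonelli moves the z integral inside, and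
  -- Cauchy–Schwarz in z separates the two factors again.
  calc ∫⁻ z, (∫⁻ y, F y z ∂μ) ^ (2 : ℝ) ∂ν
      = ∫⁻ z, ∫⁻ y, ∫⁻ y', F y z * F y' z ∂μ ∂μ ∂ν := by
        refine lintegral_congr fun z => ?_
        rw [ENNReal.rpow_two, sq, ← lintegral_mul_const _ (hsec' z)]
        exact lintegral_congr fun y => (lintegral_const_mul _ (hsec' z)).symm
    _ = ∫⁻ y, ∫⁻ z, ∫⁻ y', F y z * F y' z ∂μ ∂ν ∂μ := by
        rw [lintegral_lintegral_swap]
        refine Measurable.aemeasurable ?_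
        refine Measurable.lintegral_prod_right' (f := fun p : (β × α) × α => F p.1.2 p.1.1 * F p.2 p.1.1) ?_
        exact (hF.comp (by fun_prop : Measurable fun p : (β × α) × α => (p.1.2, p.1.1))).mul
          (hF.comp (by fun_prop : Measurable fun p : (β × α) × α => (p.2, p.1.1)))
    _ = ∫⁻ y, ∫⁻ y', ∫⁻ z, F y z * F y' z ∂ν ∂μ ∂μ := by
        refine lintegral_congr fun y => ?_
        rw [lintegral_lintegral_swap]
        exact (((hsec y).comp measurable_fst).mul
          (hF.comp (by fun_prop : Measurable fun p : β × α => (p.2, p.1)))).aemeasurable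
    _ ≤ ∫⁻ y, ∫⁻ y', eLpNorm (F y) 2 ν * eLpNorm (F y') 2 ν ∂μ ∂μ := by
        refine lintegral_mono fun y => lintegral_mono fun y' => ?_
        rw [hn, hn]
        exact ENNReal.lintegral_mul_le_Lp_mul_Lq ν Real.HolderConjugate.two_two
          (hsec y).aemeasurable (hsec y').aemeasurable
    _ = _ := by
        rw [ENNReal.rpow_two, sq, ← lintegral_mul_const _ hmN]
        exact lintegral_congr fun y => lintegral_const_mul _ hmN

/-! ### Primitives on (-∞, x]: product rule and exponential -/

theorem continuous_setIntegral_Iic {E : Type*} [NormedAddCommGroup E] [NormedSpace ℝ E]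
    {h : ℝ → E} (hh : Integrable h) :
    Continuous fun y => ∫ t in Iic y, h t := by
  have : (fun y => ∫ t in Iic y, h t) = fun y => (∫ t in Iic 0, h t) + ∫ t in (0 : ℝ)..y, h t := by
    funext y
    rw [← intervalIntegral.integral_Iic_sub_Iic hh.integrableOn hh.integrableOn]
    abel
  rw [this]
  exact continuous_const.add (hh.continuous_primitive 0)

theorem norm_setIntegral_le_integral_norm {E : Type*} [NormedAddCommGroup E] [NormedSpace ℝ E]
    {h : ℝ → E} (hh : Integrable h) (s : Set ℝ) :
    ‖∫ t in s, h t‖ ≤ ∫ t, ‖h t‖ :=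
  (norm_integral_le_integral_norm _).trans
    (setIntegral_le_integral hh.norm (Filter.Eventually.of_forall fun _ => norm_nonneg _))

/-- The product rule for primitives of integrable functions. -/
theorem setIntegral_Iic_mul_setIntegral_Iic {f g : ℝ → ℂ} (hf : Integrable f) (hg : Integrable g)
    (x : ℝ) : (∫ y in Iic x, f y) * (∫ y in Iic x, g y) =
      ∫ y in Iic x, (f y * (∫ t in Iic y, g t) + (∫ t in Iic y, f t) * g y) := by
  set μ := (volume : Measure ℝ).restrict (Iic x)
  have hfg : Integrable (fun p : ℝ × ℝ => f p.1 * g p.2) (μ.prod μ) :=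
    hf.restrict.mul_prod hg.restrict
  -- Fubini on the square (-∞, x]², cut along its diagonal: each half produces one of the two terms.
  have hS : MeasurableSet {p : ℝ × ℝ | p.2 ≤ p.1} := measurableSet_le measurable_snd measurable_fst
  have h1 : ∫ p in {p : ℝ × ℝ | p.2 ≤ p.1}, f p.1 * g p.2 ∂(μ.prod μ) =
      ∫ y in Iic x, f y * ∫ t in Iic y, g t := by
    rw [← integral_indicator hS, integral_prod _ (hfg.indicator hS)]
    refine setIntegral_congr_fun measurableSet_Iic fun y hy => ?_
    have : ∀ t, indicator {p : ℝ × ℝ | p.2 ≤ p.1} (fun p => f p.1 * g p.2) (y, t) =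
        indicator (Iic y) (fun t => f y * g t) t := fun t => by simp [indicator]
    simp only [this]
    rw [integral_indicator measurableSet_Iic, Measure.restrict_restrict measurableSet_Iic,
      inter_eq_left.2 (Iic_subset_Iic.2 hy), integral_const_mul]
  have h2 : ∫ p in {p : ℝ × ℝ | p.2 ≤ p.1}ᶜ, f p.1 * g p.2 ∂(μ.prod μ) =
      ∫ y in Iic x, (∫ t in Iic y, f t) * g y := by
    rw [← integral_indicator hS.compl, integral_prod_symm _ (hfg.indicator hS.compl)]
    refine setIntegral_congr_fun measurableSet_Iic fun y hy => ?_
    have : ∀ t, indicator {p : ℝ × ℝ | p.2 ≤ p.1}ᶜ (fun p => f p.1 * g p.2) (t, y) =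
        indicator (Iio y) (fun t => f t * g y) t := fun t => by simp [indicator]
    simp only [this]
    rw [integral_indicator measurableSet_Iio, Measure.restrict_restrict measurableSet_Iio,
      inter_eq_left.2 ((Iio_subset_Iic_self).trans (Iic_subset_Iic.2 hy)), integral_mul_const,
      integral_Iic_eq_integral_Iio]
  rw [integral_add, ← h1, ← h2, integral_add_compl hS hfg]
  · exact (integral_prod_mul (μ := μ) (ν := μ) f g).symm
  · exact (hf.mul_bdd (c := ∫ t, ‖g t‖) (continuous_setIntegral_Iic hg).aestronglyMeasurable
      (Filter.Eventually.of_forall fun y => norm_setIntegral_le_integral_norm hg _)).restrict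
  · exact (hg.bdd_mul (c := ∫ t, ‖f t‖) (continuous_setIntegral_Iic hf).aestronglyMeasurable
      (Filter.Eventually.of_forall fun y => norm_setIntegral_le_integral_norm hf _)).restrict

/-- Write A for the primitive of a. The product rule applied to a and a Aⁿ gives A^(n+2)/(n+1) =
((n+2)/(n+1)) ∫ a A^(n+1). Nothing is differentiated, so integrability of a suffices. -/
theorem setIntegral_Iic_mul_pow {a : ℝ → ℂ} (ha : Integrable a) (n : ℕ) (x : ℝ) :
    ∫ y in Iic x, a y * (∫ t in Iic y, a t) ^ n = (∫ y in Iic x, a y) ^ (n + 1) / (n + 1) := by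
  induction n generalizing x with
  | zero => simp
  | succ n ih =>
    have hp : ∀ m : ℕ, Integrable fun y => a y * (∫ t in Iic y, a t) ^ m := fun m =>
      ha.mul_bdd (c := (∫ t, ‖a t‖) ^ m) ((continuous_setIntegral_Iic ha).pow m).aestronglyMeasurable
        (Filter.Eventually.of_forall fun y => by
          rw [norm_pow]; gcongr; exact norm_setIntegral_le_integral_norm ha _)
    have h := setIntegral_Iic_mul_setIntegral_Iic ha (hp n) x
    simp only [ih] at h
    have e : ∀ y, a y * ((∫ t in Iic y, a t) ^ (n + 1) / (n + 1)) +
        (∫ t in Iic y, a t) * (a y * (∫ t in Iic y, a t) ^ n) =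
        ((n + 2 : ℂ) / (n + 1)) * (a y * (∫ t in Iic y, a t) ^ (n + 1)) := fun y => by
      have : (n + 1 : ℂ) ≠ 0 := by exact_mod_cast n.succ_ne_zero
      field_simp
      ring
    simp only [e, integral_const_mul] at h
    have h1 : (n + 1 : ℂ) ≠ 0 := by exact_mod_cast n.succ_ne_zero
    have h2 : (n + 2 : ℂ) ≠ 0 := by exact_mod_cast (n + 1).succ_ne_zero
    push_cast
    have h3 : (n + 1 + 1 : ℂ) ≠ 0 := by rwa [add_assoc, one_add_one_eq_two]
    rw [eq_div_iff h3]
    field_simp at h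
    linear_combination -h

/-- The primitive of `a * exp (∫ a)`. -/
theorem setIntegral_Iic_mul_exp {a : ℝ → ℂ} (ha : Integrable a) (x : ℝ) :
    ∫ y in Iic x, a y * Complex.exp (∫ t in Iic y, a t) =
      Complex.exp (∫ y in Iic x, a y) - 1 := by
  set N := ∫ t, ‖a t‖
  have hb : ∀ (n : ℕ) y, ‖((∫ t in Iic y, a t) ^ n / n.factorial : ℂ)‖ ≤ N ^ n / (n.factorial : ℝ) :=
    fun n y => by
      rw [norm_div, norm_pow]
      simp only [RCLike.norm_natCast]
      gcongr
      exact norm_setIntegral_le_integral_norm ha _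
  have hi : ∀ n : ℕ, Integrable fun y => a y * ((∫ t in Iic y, a t) ^ n / n.factorial) := fun n =>
    ha.mul_bdd (c := N ^ n / n.factorial)
      (((continuous_setIntegral_Iic ha).pow n).div_const _).aestronglyMeasurable
        (Filter.Eventually.of_forall fun y => hb n y)
  -- The exponential series is integrated term by term, dominated by N * N ^ n / n!. The term of
  -- index n integrates to the term of index n + 1, so the zeroth term is missing and accounts for
  -- the -1.
  have hs := hasSum_integral_of_summable_integral_norm (μ := volume.restrict (Iic x))
    (F := fun (n : ℕ) y => a y * ((∫ t in Iic y, a t) ^ n / n.factorial)) (fun n => (hi n).restrict) ?_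
  · have e1 : ∀ y, ∑' n : ℕ, a y * ((∫ t in Iic y, a t) ^ n / n.factorial) =
        a y * Complex.exp (∫ t in Iic y, a t) := fun y => by
      rw [tsum_mul_left, Complex.exp_eq_exp_ℂ, NormedSpace.exp_eq_tsum_div]
    have e2 : ∀ n : ℕ, ∫ y in Iic x, a y * ((∫ t in Iic y, a t) ^ n / n.factorial) =
        (∫ y in Iic x, a y) ^ (n + 1) / (n + 1).factorial := fun n => by
      simp only [← mul_div_assoc]
      rw [integral_div, setIntegral_Iic_mul_pow ha, Nat.factorial_succ]
      push_cast
      rw [div_div]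
    simp only [e1, e2] at hs
    have h2 := NormedSpace.expSeries_div_hasSum_exp (𝔸 := ℂ) (∫ y in Iic x, a y)
    rw [← Complex.exp_eq_exp_ℂ] at h2
    rw [← hasSum_nat_add_iff' 1] at h2
    simp at h2
    exact hs.unique h2
  · refine Summable.of_nonneg_of_le (fun n => integral_nonneg fun y => norm_nonneg _) (fun n => ?_)
      ((Real.summable_pow_div_factorial N).mul_left N)
    calc ∫ y in Iic x, ‖a y * ((∫ t in Iic y, a t) ^ n / n.factorial)‖
        ≤ ∫ y in Iic x, ‖a y‖ * (N ^ n / n.factorial) := by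
          refine integral_mono (hi n).norm.restrict (ha.norm.mul_const _).restrict fun y => ?_
          simp only [norm_mul]
          gcongr
          exact hb n y
      _ = (∫ y in Iic x, ‖a y‖) * (N ^ n / n.factorial) := by rw [integral_mul_const]
      _ ≤ N * (N ^ n / n.factorial) := by
          gcongr
          · exact setIntegral_le_integral ha.norm (Filter.Eventually.of_forall fun _ => norm_nonneg _)

/-! ### Gronwall inequalities, pointwise and in L² -/

theorem integrable_mul_exp_primitive {k : ℝ → ℝ} (hk : Integrable k) :
    Integrable fun y => k y * Real.exp (2 * ∫ t in Iic y, k t) := by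
  have hc : Continuous fun y => Real.exp (2 * ∫ t in Iic y, k t) :=
    Real.continuous_exp.comp (continuous_const.mul (continuous_setIntegral_Iic hk))
  refine hk.mul_bdd (c := Real.exp (2 * ∫ t, ‖k t‖)) hc.aestronglyMeasurable
      (Filter.Eventually.of_forall fun y => ?_)
  rw [Real.norm_of_nonneg (Real.exp_pos _).le]
  gcongr
  exact (le_abs_self _).trans (norm_setIntegral_le_integral_norm hk _)

/-- The 2 in the exponent is chosen so that integrating k against the weight returns at most half of
the weight. This is the contraction constant in Gronwall's inequality and in the fixed point
argument. -/
theorem setIntegral_Iic_mul_exp_real {k : ℝ → ℝ} (hk : Integrable k) (x : ℝ) :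
    ∫ y in Iic x, k y * Real.exp (2 * ∫ t in Iic y, k t) =
      (Real.exp (2 * ∫ t in Iic x, k t) - 1) / 2 := by
  have h := setIntegral_Iic_mul_exp (a := fun y => ((2 * k y : ℝ) : ℂ)) (hk.const_mul 2).ofReal x
  simp only [integral_complex_ofReal, ← Complex.ofReal_exp, ← Complex.ofReal_mul,
    integral_const_mul] at h
  have h' : ∫ y in Iic x, 2 * k y * Real.exp (2 * ∫ t in Iic y, k t) =
      Real.exp (2 * ∫ t in Iic x, k t) - 1 := by exact_mod_cast h
  simp only [mul_assoc, integral_const_mul] at h'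
  linarith

theorem lintegral_Iic_mul_exp_le {k : ℝ → ℝ} (hk : Integrable k) (h0 : ∀ x, 0 ≤ k x) (x : ℝ) :
    ∫⁻ y in Iic x, ENNReal.ofReal (k y) * ENNReal.ofReal (Real.exp (2 * ∫ t in Iic y, k t)) ≤
      ENNReal.ofReal (Real.exp (2 * ∫ t in Iic x, k t)) / 2 := by
  simp only [← ENNReal.ofReal_mul (h0 _)]
  rw [← ofReal_integral_eq_lintegral_ofReal (integrable_mul_exp_primitive hk).restrict
    (Filter.Eventually.of_forall fun y => mul_nonneg (h0 y) (Real.exp_pos _).le),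
    setIntegral_Iic_mul_exp_real hk, ← ENNReal.ofReal_ofNat 2, ← ENNReal.ofReal_div_of_pos two_pos]
  exact ENNReal.ofReal_le_ofReal (by linarith)

/-- The supremum S of φ / exp(2∫k) over (-∞, x₀] satisfies S ≤ G + S/2. The a priori bound M makes S
finite, so S/2 can be cancelled and S ≤ 2G. Measurability of φ plays no role. -/
theorem gronwall_const {k : ℝ → ℝ} (hk : Integrable k) (h0 : ∀ x, 0 ≤ k x) {φ : ℝ → ℝ≥0∞}
    {G M : ℝ≥0∞} (hM : M ≠ ⊤) {x₀ : ℝ} (hφM : ∀ x ≤ x₀, φ x ≤ M)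
    (hφ : ∀ x ≤ x₀, φ x ≤ G + ∫⁻ y in Iic x, ENNReal.ofReal (k y) * φ y) :
    φ x₀ ≤ ENNReal.ofReal (2 * Real.exp (2 * ∫ t, k t)) * G := by
  set E : ℝ → ℝ≥0∞ := fun x => ENNReal.ofReal (Real.exp (2 * ∫ t in Iic x, k t))
  have hE1 : ∀ x, 1 ≤ E x := fun x => by
    rw [← ENNReal.ofReal_one]
    refine ENNReal.ofReal_le_ofReal (Real.one_le_exp ?_)
    exact mul_nonneg zero_le_two (integral_nonneg h0)
  have hE0 : ∀ x, E x ≠ 0 := fun x => (zero_lt_one.trans_le (hE1 x)).ne'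
  have hEt : ∀ x, E x ≠ ⊤ := fun x => ENNReal.ofReal_ne_top
  set S := ⨆ x : Iic x₀, φ x / E x
  have hSφ : ∀ x ≤ x₀, φ x ≤ S * E x := fun x hx => by
    rw [← ENNReal.div_le_iff (hE0 x) (hEt x)]
    exact le_iSup (fun x : Iic x₀ => φ x / E x) ⟨x, hx⟩
  have hSM : S ≤ M := iSup_le fun x => (ENNReal.div_le_of_le_mul (by
    calc φ x ≤ M := hφM x x.2
      _ ≤ M * E x := le_mul_of_one_le_right' (hE1 x)))
  have hS : S ≤ G + S / 2 := iSup_le fun ⟨x, hx⟩ => by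
    rw [ENNReal.div_le_iff (hE0 x) (hEt x)]
    calc φ x ≤ G + ∫⁻ y in Iic x, ENNReal.ofReal (k y) * φ y := hφ x hx
      _ ≤ G + ∫⁻ y in Iic x, S * (ENNReal.ofReal (k y) * E y) := by
        refine add_le_add le_rfl ?_
        refine setLIntegral_mono' (measurableSet_Iic : MeasurableSet (Iic x)) fun y hy => ?_
        rw [mul_left_comm]
        gcongr
        exact hSφ y (le_trans hy hx)
      _ ≤ G * E x + S * (E x / 2) := by
        rw [lintegral_const_mul' _ _ (ne_top_of_le_ne_top hM hSM)]
        gcongr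
        · exact le_mul_of_one_le_right' (hE1 x)
        · exact lintegral_Iic_mul_exp_le hk h0 x
      _ = (G + S / 2) * E x := by
        rw [add_mul, div_eq_mul_inv, div_eq_mul_inv]; ring
  have hS2 : S ≤ 2 * G := by
    have hSt : S / 2 ≠ ⊤ := ENNReal.div_ne_top (ne_top_of_le_ne_top hM hSM) two_ne_zero
    have : S / 2 + S / 2 ≤ G + S / 2 := by rwa [ENNReal.add_halves]
    have h3 := ENNReal.le_of_add_le_add_right hSt this
    calc S = S / 2 + S / 2 := (ENNReal.add_halves S).symm
      _ ≤ G + G := add_le_add h3 h3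
      _ = 2 * G := (two_mul G).symm
  calc φ x₀ ≤ S * E x₀ := hSφ x₀ le_rfl
    _ ≤ 2 * G * ENNReal.ofReal (Real.exp (2 * ∫ t, k t)) := by
      gcongr ?_ * ENNReal.ofReal ?_
      · gcongr
        · exact Filter.Eventually.of_forall h0
        · exact Measure.restrict_le_self
    _ = _ := by
      rw [ENNReal.ofReal_mul zero_le_two, ENNReal.ofReal_ofNat]; ring

/-- The function ∫ k φ itself satisfies an inequality with the constant forcing ∫_{-∞}^{x₀} k F, to
which `gronwall_const` applies. A forcing depending on x is thus allowed, and only finiteness of ∫ k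
φ is needed, not boundedness of φ. -/
theorem gronwall {k : ℝ → ℝ} (hk : Integrable k) (hkm : Measurable k) (h0 : ∀ x, 0 ≤ k x)
    {φ F : ℝ → ℝ≥0∞} (hF : Measurable F) {x₀ : ℝ}
    (hφM : ∫⁻ y in Iic x₀, ENNReal.ofReal (k y) * φ y ≠ ⊤)
    (hφ : ∀ x ≤ x₀, φ x ≤ F x + ∫⁻ y in Iic x, ENNReal.ofReal (k y) * φ y) :
    φ x₀ ≤ F x₀ + ENNReal.ofReal (2 * Real.exp (2 * ∫ t, k t)) *
      ∫⁻ y in Iic x₀, ENNReal.ofReal (k y) * F y := by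
  refine (hφ x₀ le_rfl).trans (by
    gcongr
    refine gronwall_const (φ := fun x => ∫⁻ y in Iic x, ENNReal.ofReal (k y) * φ y) hk h0
      hφM (fun x hx => lintegral_mono_set (Iic_subset_Iic.2 hx)) (fun x hx => ?_)
    calc ∫⁻ y in Iic x, ENNReal.ofReal (k y) * φ y
        ≤ ∫⁻ y in Iic x, (ENNReal.ofReal (k y) * F y + ENNReal.ofReal (k y) *
            ∫⁻ t in Iic y, ENNReal.ofReal (k t) * φ t) := by
          refine setLIntegral_mono' measurableSet_Iic fun y hy => ?_
          rw [← mul_add]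
          gcongr
          exact hφ y (le_trans hy hx)
      _ = (∫⁻ y in Iic x, ENNReal.ofReal (k y) * F y) + _ :=
          lintegral_add_left (hkm.ennreal_ofReal.mul hF) _
      _ ≤ _ := by
          gcongr ?_ + _
          exact lintegral_mono_set (Iic_subset_Iic.2 hx))

theorem eLpNorm_two_ennreal {β : Type*} [MeasurableSpace β] (ν : Measure β) (g : β → ℝ≥0∞) :
    eLpNorm g 2 ν = (∫⁻ z, g z ^ (2 : ℝ) ∂ν) ^ (1 / (2 : ℝ)) := by
  rw [eLpNorm_eq_lintegral_rpow_enorm_toReal two_ne_zero ENNReal.ofNat_ne_top]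
  simp

theorem eLpNorm_two_const_mul {β : Type*} [MeasurableSpace β] (ν : Measure β) (c : ℝ≥0∞)
    {g : β → ℝ≥0∞} (hg : Measurable g) :
    eLpNorm (fun z => c * g z) 2 ν = c * eLpNorm g 2 ν := by
  simp only [eLpNorm_two_ennreal, ENNReal.mul_rpow_of_nonneg _ _ (zero_le_two (α := ℝ))]
  rw [lintegral_const_mul _ (hg.pow_const _), ENNReal.mul_rpow_of_nonneg _ _ (by norm_num),
    ← ENNReal.rpow_mul]
  norm_num

theorem eLpNorm_lintegral_mul_le {k : ℝ → ℝ} (hk : Integrable k) (hkm : Measurable k)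
    (h0 : ∀ x, 0 ≤ k x) {F : ℝ → ℝ → ℝ≥0∞} (hF : Measurable (Function.uncurry F)) {x₀ : ℝ}
    {c : ℝ≥0∞} (hc : ∀ᵐ y, y ≤ x₀ → eLpNorm (F y) 2 ≤ c) :
    Measurable (fun z => ∫⁻ y in Iic x₀, ENNReal.ofReal (k y) * F y z) ∧
      eLpNorm (fun z => ∫⁻ y in Iic x₀, ENNReal.ofReal (k y) * F y z) 2 ≤
        ENNReal.ofReal (∫ t, k t) * c := by
  have hm2 : Measurable (Function.uncurry fun y z => ENNReal.ofReal (k y) * F y z) :=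
    (hkm.ennreal_ofReal.comp measurable_fst).mul hF
  have hm3 : Measurable (fun z => ∫⁻ y in Iic x₀, ENNReal.ofReal (k y) * F y z) :=
    Measurable.lintegral_prod_left hm2
  have h1 : ∫⁻ y in Iic x₀, eLpNorm (fun z => ENNReal.ofReal (k y) * F y z) 2 volume ≤
      ∫⁻ y in Iic x₀, ENNReal.ofReal (k y) * c := by
    refine lintegral_mono_ae ((ae_restrict_iff' measurableSet_Iic).2 ?_)
    filter_upwards [hc] with y hy hy'
    rw [eLpNorm_two_const_mul _ _ hF.of_uncurry_left]
    exact mul_le_mul_right (hy hy') _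
  have h2 : ∫⁻ y in Iic x₀, ENNReal.ofReal (k y) * c ≤ ENNReal.ofReal (∫ t, k t) * c := by
    rw [lintegral_mul_const _ hkm.ennreal_ofReal,
      ofReal_integral_eq_lintegral_ofReal hk (Filter.Eventually.of_forall h0)]
    exact mul_le_mul_left (setLIntegral_le_lintegral _ _) _
  exact ⟨hm3, (eLpNorm_lintegral_le hm2).trans (h1.trans h2)⟩

/-- Gronwall is applied at each z separately and the norm in z is taken only afterwards, Minkowski
bringing it inside the y integrals. The two kinds of forcing are measured differently: h uniformly
in x with values in `L²`, g in L¹ of y with values in `L²`. -/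
theorem eLpNorm_gronwall {k : ℝ → ℝ} (hk : Integrable k) (hkm : Measurable k) (h0 : ∀ x, 0 ≤ k x)
    {P h g : ℝ → ℝ → ℝ≥0∞} (hh : Measurable (Function.uncurry h))
    (hg : Measurable (Function.uncurry g)) {x₀ : ℝ}
    (hPM : ∀ z, ∫⁻ y in Iic x₀, ENNReal.ofReal (k y) * P y z ≠ ⊤)
    (hP : ∀ z, ∀ x ≤ x₀, P x z ≤ h x z + (∫⁻ y in Iic x, ENNReal.ofReal (k y) * P y z) +
      ∫⁻ y in Iic x, g y z)
    {H B : ℝ≥0∞} (hH₀ : eLpNorm (h x₀) 2 ≤ H) (hH : ∀ᵐ y, y ≤ x₀ → eLpNorm (h y) 2 ≤ H)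
    (hB : ∫⁻ y in Iic x₀, eLpNorm (g y) 2 ≤ B) :
    eLpNorm (P x₀) 2 ≤ (1 + ENNReal.ofReal (2 * Real.exp (2 * ∫ t, k t)) *
      ENNReal.ofReal (∫ t, k t)) * (H + B) := by
  set C := ENNReal.ofReal (2 * Real.exp (2 * ∫ t, k t))
  obtain ⟨I, hIdef⟩ : ∃ I : ℝ → ℝ≥0∞, ∀ z, I z = ∫⁻ y in Iic x₀, g y z := ⟨_, fun _ => rfl⟩
  obtain ⟨F, hFdef⟩ : ∃ F : ℝ → ℝ → ℝ≥0∞, ∀ x z, F x z = h x z + I z := ⟨_, fun _ _ => rfl⟩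
  have hI : Measurable I := by
    rw [show I = fun z => ∫⁻ y in Iic x₀, g y z from funext hIdef]
    exact Measurable.lintegral_prod_left hg
  have hF : Measurable (Function.uncurry F) := by
    rw [show Function.uncurry F = fun p => Function.uncurry h p + I p.2 from
      funext fun p => hFdef p.1 p.2]
    exact hh.add (hI.comp measurable_snd)
  have hIB : eLpNorm I 2 ≤ B := by
    rw [show I = fun z => ∫⁻ y in Iic x₀, g y z from funext hIdef]
    exact (eLpNorm_lintegral_le hg).trans hB
  have hFx : ∀ x, eLpNorm (h x) 2 ≤ H → eLpNorm (F x) 2 ≤ H + B := fun x hx => by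
    rw [show F x = h x + I from funext fun z => hFdef x z]
    exact (eLpNorm_add_le hh.of_uncurry_left.aestronglyMeasurable
      hI.aestronglyMeasurable one_le_two).trans (add_le_add hx hIB)
  have h1 : ∀ z, P x₀ z ≤ F x₀ z + C * ∫⁻ y in Iic x₀, ENNReal.ofReal (k y) * F y z := fun z => by
    refine gronwall (φ := fun x => P x z) hk hkm h0 (F := fun x => F x z) hF.of_uncurry_right
      (hPM z) fun x hx => ?_
    refine (hP z x hx).trans ?_
    rw [add_right_comm, hFdef, hIdef]
    gcongr
  obtain ⟨hm3, h2⟩ := eLpNorm_lintegral_mul_le hk hkm h0 hF (x₀ := x₀) (c := H + B)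
    (hH.mono fun y hy hy' => hFx y (hy hy'))
  have h3 : eLpNorm (P x₀) 2 ≤
      eLpNorm (F x₀ + fun z => C * ∫⁻ y in Iic x₀, ENNReal.ofReal (k y) * F y z) 2 :=
    eLpNorm_mono_enorm fun z => by simpa using h1 z
  refine h3.trans ((eLpNorm_add_le hF.of_uncurry_left.aestronglyMeasurable
    (hm3.const_mul C).aestronglyMeasurable one_le_two).trans ?_)
  rw [eLpNorm_two_const_mul _ _ hm3]
  calc _ ≤ (H + B) + C * (ENNReal.ofReal (∫ t, k t) * (H + B)) := by
        gcongr
        exact hFx x₀ hH₀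
    _ = _ := by ring

/-! ### Oscillatory integrals in L² of the frequency -/

/-- The oscillatory integral `∫_{-∞}^x e^{2iz(x-y)} f(y) dy`. -/
def oscInt (f : ℝ → ℂ) (x z : ℝ) : ℂ :=
  ∫ y in Iic x, Complex.exp (2 * Complex.I * z * (x - y)) * f y

theorem norm_exp_two_I_mul (z t : ℝ) : ‖Complex.exp (2 * Complex.I * z * t)‖ = 1 := by
  rw [show 2 * Complex.I * z * t = ((2 * z * t : ℝ) : ℂ) * Complex.I by push_cast; ring]
  exact Complex.norm_exp_ofReal_mul_I _

/-- The dilation costs a^(-1/2), at most 2 when a ≥ 1/4. It is applied with a = 1/π, where π ≤ 4 is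
enough. -/
theorem eLpNorm_comp_mul_right_le (f : ℝ → ℂ) {a : ℝ} (ha : 1 / 4 ≤ a)
    (hf : AEStronglyMeasurable f) :
    eLpNorm (fun z => f (z * a)) 2 ≤ 2 * eLpNorm f 2 := by
  have ha0 : 0 < a := by linarith
  have hm := Real.map_volume_mul_right ha0.ne'
  have hf' : AEStronglyMeasurable f (Measure.map (· * a) volume) := by
    rw [hm]; exact hf.smul_measure _
  have := eLpNorm_map_measure (p := 2) hf' (measurable_mul_const a).aemeasurable
  rw [hm, eLpNorm_smul_measure_of_ne_top ENNReal.ofNat_ne_top] at this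
  rw [show (fun z => f (z * a)) = f ∘ (· * a) from rfl, ← this, smul_eq_mul]
  gcongr
  rw [abs_of_pos (inv_pos.2 ha0)]
  calc ENNReal.ofReal a⁻¹ ^ (1 / (2 : ℝ≥0∞)).toReal ≤ ENNReal.ofReal 4 ^ (1 / (2 : ℝ≥0∞)).toReal := by
        gcongr
        rw [inv_le_comm₀ ha0 (by norm_num)]
        linarith
    _ = 2 := by
        rw [show (4 : ℝ) = 2 ^ (2 : ℝ) by norm_num, ← ENNReal.ofReal_rpow_of_pos two_pos,
          ← ENNReal.rpow_mul]
        simp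

/-- The `L²_z` bound of oscillatory integrals over a measurable set. -/
theorem eLpNorm_oscillatory_le {f : ℝ → ℂ} (h1 : Integrable f) (h2 : MemLp f 2) (x : ℝ) :
    eLpNorm (fun z : ℝ => ∫ y : ℝ, Complex.exp (2 * Complex.I * z * (x - y)) * f y) 2 ≤
      2 * eLpNorm f 2 := by
  -- Up to the unimodular factor e^{2izx}, the integral is the Fourier transform of f at the
  -- frequency z/π.
  have e : ∀ z : ℝ, ∫ y : ℝ, Complex.exp (2 * Complex.I * z * (x - y)) * f y =
      Complex.exp (2 * Complex.I * z * x) * 𝓕 f (z * Real.pi⁻¹) := fun z => by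
    rw [Real.fourier_eq', ← integral_const_mul]
    refine integral_congr_ae (Filter.Eventually.of_forall fun y => ?_)
    simp only [smul_eq_mul]
    rw [← mul_assoc, ← Complex.exp_add]
    congr 2
    have := Real.pi_ne_zero
    simp only [RCLike.inner_apply, conj_trivial]
    push_cast
    have : (Real.pi : ℂ) ≠ 0 := by exact_mod_cast Real.pi_ne_zero
    field_simp
    ring
  have hcont : Continuous (𝓕 f) :=
    VectorFourier.fourierIntegral_continuous Real.continuous_fourierChar
      (by exact continuous_inner) h1
  calc _ = eLpNorm (fun z : ℝ => 𝓕 f (z * Real.pi⁻¹)) 2 := by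
        refine eLpNorm_congr_norm_ae (Filter.Eventually.of_forall fun z => ?_)
        simp only [e, norm_mul, norm_exp_two_I_mul, one_mul]
    _ ≤ 2 * eLpNorm (𝓕 f) 2 := by
        refine eLpNorm_comp_mul_right_le _ ?_ hcont.aestronglyMeasurable
        rw [one_div]
        exact inv_anti₀ Real.pi_pos Real.pi_le_four
    _ = _ := by rw [eLpNorm_fourier h1 h2]

/-- The cut-off at x is part of the function to which Plancherel is applied, so only the tail of f
appears on the right. This tail is the source of all decay in x. -/
theorem eLpNorm_oscInt_le {f : ℝ → ℂ} (h1 : Integrable f) (h2 : MemLp f 2) (x : ℝ) :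
    eLpNorm (oscInt f x) 2 ≤ 2 * eLpNorm f 2 (volume.restrict (Iic x)) := by
  rw [← eLpNorm_indicator_eq_eLpNorm_restrict measurableSet_Iic]
  refine le_of_eq_of_le ?_ (eLpNorm_oscillatory_le (h1.indicator measurableSet_Iic)
    (h2.indicator measurableSet_Iic) x)
  congr 1
  funext z
  rw [oscInt, ← integral_indicator measurableSet_Iic]
  congr 1
  funext y
  simp only [indicator]
  split_ifs <;> simp

end

/-! ### Weak derivatives on the line and their primitives -/

theorem LocallyIntegrable.comp_neg {E : Type*} [NormedAddCommGroup E] {f : ℝ → E} (h : LocallyIntegrable f) :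
    LocallyIntegrable fun x => f (-x) := by
  intro x
  obtain ⟨s, hs, hi⟩ := h (-x)
  refine ⟨-s, ?_, ?_⟩
  · exact (continuous_neg (G := ℝ)).continuousAt.preimage_mem_nhds hs
  · exact ((Measure.measurePreserving_neg (volume : Measure ℝ)).integrableOn_comp_preimage
      (MeasurableEquiv.neg ℝ).measurableEmbedding).2 hi

theorem intervalIntegrable_of_locallyIntegrable {E : Type*} [NormedAddCommGroup E] {f : ℝ → E}
    (h : LocallyIntegrable f) (a b : ℝ) : IntervalIntegrable f volume a b :=
  (h.integrableOn_isCompact isCompact_uIcc).intervalIntegrable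

section WeakDeriv

variable {E : Type*} [NormedAddCommGroup E] [NormedSpace ℝ E]

theorem integrable_smul_of_locallyIntegrable {f : ℝ → E} (hf : LocallyIntegrable f) {φ : ℝ → ℝ}
    (hφ : Continuous φ) (hφc : HasCompactSupport φ) : Integrable fun x => φ x • f x :=
  hf.integrable_smul_left_of_hasCompactSupport hφ hφc

theorem HasWeakDeriv.ae_unique [CompleteSpace E] {f g g' : ℝ → E} (h : HasWeakDeriv f g)
    (h' : HasWeakDeriv f g') : g =ᵐ[volume] g' :=
  ae_eq_of_integral_contDiff_smul_eq h.2.1 h'.2.1 fun φ hφ hφc =>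
    neg_injective ((h.2.2 φ hφ hφc).symm.trans (h'.2.2 φ hφ hφc))

theorem HasWeakDeriv.congr {f f' g g' : ℝ → E} (h : HasWeakDeriv f g) (hf : f =ᵐ[volume] f')
    (hg : g =ᵐ[volume] g') : HasWeakDeriv f' g' := by
  refine ⟨h.1.congr hf, h.2.1.congr hg, fun φ hφ hφc => ?_⟩
  rw [← integral_congr_ae (hf.mono fun x hx => congrArg (deriv φ x • ·) hx),
    ← integral_congr_ae (hg.mono fun x hx => congrArg (φ x • ·) hx)]
  exact h.2.2 φ hφ hφc

theorem hasWeakDeriv_weakDeriv {f g : ℝ → E} (h : HasWeakDeriv f g) :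
    HasWeakDeriv f (weakDeriv f) := by
  have h' : ∃ g, HasWeakDeriv f g := ⟨g, h⟩
  rw [weakDeriv, dif_pos h']
  exact h'.choose_spec

theorem weakDeriv_ae_eq [CompleteSpace E] {f g : ℝ → E} (h : HasWeakDeriv f g) :
    weakDeriv f =ᵐ[volume] g :=
  (hasWeakDeriv_weakDeriv h).ae_unique h

theorem HasWeakDeriv.add {f f' g g' : ℝ → E} (h : HasWeakDeriv f g) (h' : HasWeakDeriv f' g') :
    HasWeakDeriv (f + f') (g + g') := by
  refine ⟨h.1.add h'.1, h.2.1.add h'.2.1, fun φ hφ hφc => ?_⟩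
  have hd := hφ.continuous_deriv (by simp)
  simp only [Pi.add_apply, smul_add]
  rw [integral_add, integral_add, h.2.2 φ hφ hφc, h'.2.2 φ hφ hφc, neg_add]
  · exact integrable_smul_of_locallyIntegrable h.2.1 hφ.continuous hφc
  · exact integrable_smul_of_locallyIntegrable h'.2.1 hφ.continuous hφc
  · exact integrable_smul_of_locallyIntegrable h.1 hd hφc.deriv
  · exact integrable_smul_of_locallyIntegrable h'.1 hd hφc.deriv

theorem HasWeakDeriv.clm_comp {F : Type*} [NormedAddCommGroup F] [NormedSpace ℝ F]
    [CompleteSpace E] [CompleteSpace F] {f g : ℝ → E} (h : HasWeakDeriv f g) (T : E →L[ℝ] F) :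
    HasWeakDeriv (fun x => T (f x)) (fun x => T (g x)) := by
  refine ⟨fun x => ?_, fun x => ?_, fun φ hφ hφc => ?_⟩
  · obtain ⟨s, hs, hi⟩ := h.1 x
    exact ⟨s, hs, T.integrable_comp hi⟩
  · obtain ⟨s, hs, hi⟩ := h.2.1 x
    exact ⟨s, hs, T.integrable_comp hi⟩
  have hd := hφ.continuous_deriv (by simp)
  simp only [← map_smul]
  rw [T.integral_comp_comm (integrable_smul_of_locallyIntegrable h.1 hd hφc.deriv),
    T.integral_comp_comm (integrable_smul_of_locallyIntegrable h.2.1 hφ.continuous hφc),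
    h.2.2 φ hφ hφc, map_neg]

theorem HasWeakDeriv.neg {f g : ℝ → E} (h : HasWeakDeriv f g) : HasWeakDeriv (-f) (-g) := by
  refine ⟨h.1.neg, h.2.1.neg, fun φ hφ hφc => ?_⟩
  simp only [Pi.neg_apply, smul_neg, integral_neg, h.2.2 φ hφ hφc]

theorem HasWeakDeriv.sub {f f' g g' : ℝ → E} (h : HasWeakDeriv f g) (h' : HasWeakDeriv f' g') :
    HasWeakDeriv (f - f') (g - g') := by
  simpa only [sub_eq_add_neg] using h.add h'.neg

theorem HasWeakDeriv.const_mul {f g : ℝ → ℂ} (h : HasWeakDeriv f g) (c : ℂ) :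
    HasWeakDeriv (fun x => c * f x) (fun x => c * g x) :=
  h.clm_comp ((ContinuousLinearMap.mul ℝ ℂ) c)

theorem HasWeakDeriv.comp_neg {f g : ℝ → E} (h : HasWeakDeriv f g) :
    HasWeakDeriv (fun x => f (-x)) (fun x => - g (-x)) := by
  refine ⟨LocallyIntegrable.comp_neg h.1, (LocallyIntegrable.comp_neg h.2.1).neg, fun φ hφ hφc => ?_⟩
  have h1 := h.2.2 (fun x => φ (-x)) (hφ.comp contDiff_neg)
    (hφc.comp_homeomorph (Homeomorph.neg ℝ))
  rw [← integral_neg_eq_self, ← integral_neg_eq_self (fun x => φ x • -g (-x))]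
  simp only [neg_neg, smul_neg, integral_neg, deriv_comp_neg, neg_smul] at h1 ⊢
  exact neg_injective h1

theorem hasWeakDeriv_pi {f g : ℝ → Fin 2 → ℂ}
    (h : ∀ i, HasWeakDeriv (fun x => f x i) (fun x => g x i)) : HasWeakDeriv f g := by
  have hl : ∀ {k : ℝ → Fin 2 → ℂ}, (∀ i, LocallyIntegrable fun x => k x i) → LocallyIntegrable k := by
    intro k hk
    rw [locallyIntegrable_iff]
    intro K hK
    exact Integrable.of_eval fun i => (hk i).integrableOn_isCompact hK
  have hf := hl fun i => (h i).1
  have hg := hl fun i => (h i).2.1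
  refine ⟨hf, hg, fun φ hφ hφc => ?_⟩
  have hd := hφ.continuous_deriv (by simp)
  have h1 := integrable_smul_of_locallyIntegrable hf hd hφc.deriv
  have h2 := integrable_smul_of_locallyIntegrable hg hφ.continuous hφc
  funext i
  rw [Pi.neg_apply, eval_integral fun i => h1.eval i, eval_integral fun i => h2.eval i]
  exact (h i).2.2 φ hφ hφc

end WeakDeriv

/-- Cutting f and g off to (a, b] reduces the product rule to `setIntegral_Iic_mul_setIntegral_Iic`;
the values of F and G at a contribute terms that are linear in f and g. -/
theorem intervalIntegral_mul_add_mul {f g : ℝ → ℂ} (hf : LocallyIntegrable f)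
    (hg : LocallyIntegrable g) {F G : ℝ → ℂ} (hF : ∀ x, F x = F 0 + ∫ t in (0 : ℝ)..x, f t)
    (hG : ∀ x, G x = G 0 + ∫ t in (0 : ℝ)..x, g t) {a b : ℝ} (hab : a ≤ b) :
    F b * G b - F a * G a = ∫ y in a..b, (f y * G y + F y * g y) := by
  have hfi : ∀ s t : ℝ, IntervalIntegrable f volume s t := intervalIntegrable_of_locallyIntegrable hf
  have hgi : ∀ s t : ℝ, IntervalIntegrable g volume s t := intervalIntegrable_of_locallyIntegrable hg
  have hFa : ∀ x, F x = F a + ∫ t in a..x, f t := fun x => by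
    rw [hF x, hF a, add_assoc, intervalIntegral.integral_add_adjacent_intervals (hfi _ _) (hfi _ _)]
  have hGa : ∀ x, G x = G a + ∫ t in a..x, g t := fun x => by
    rw [hG x, hG a, add_assoc, intervalIntegral.integral_add_adjacent_intervals (hgi _ _) (hgi _ _)]
  set f1 := indicator (Ioc a b) f
  set g1 := indicator (Ioc a b) g
  have hf1 : Integrable f1 := (integrable_indicator_iff measurableSet_Ioc).2
    ((intervalIntegrable_iff_integrableOn_Ioc_of_le hab).1 (hfi a b))
  have hg1 : Integrable g1 := (integrable_indicator_iff measurableSet_Ioc).2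
    ((intervalIntegrable_iff_integrableOn_Ioc_of_le hab).1 (hgi a b))
  have key : ∀ (h : ℝ → ℂ) (y : ℝ), y ∈ Icc a b →
      ∫ t in Iic y, indicator (Ioc a b) h t = ∫ t in a..y, h t := fun h y hy => by
    rw [setIntegral_indicator measurableSet_Ioc, intervalIntegral.integral_of_le hy.1]
    congr 2
    ext t
    simp only [mem_inter_iff, mem_Iic, mem_Ioc]
    exact ⟨fun h => ⟨h.2.1, h.1⟩, fun h => ⟨h.2, h.1, h.2.trans hy.2⟩⟩
  have hP := setIntegral_Iic_mul_setIntegral_Iic hf1 hg1 b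
  have e : ∫ y in Iic b, (f1 y * (∫ t in Iic y, g1 t) + (∫ t in Iic y, f1 t) * g1 y) =
      ∫ y in a..b, (f y * (∫ t in a..y, g t) + (∫ t in a..y, f t) * g y) := by
    rw [← key _ b ⟨hab, le_rfl⟩]
    refine setIntegral_congr_fun measurableSet_Iic fun y _ => ?_
    by_cases hy : y ∈ Ioc a b
    · simp only [f1, g1, indicator_of_mem hy, key _ y (Ioc_subset_Icc_self hy)]
    · simp only [f1, g1, indicator_of_notMem hy, zero_mul, mul_zero, add_zero]
  rw [e, key _ b ⟨hab, le_rfl⟩, key _ b ⟨hab, le_rfl⟩] at hP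
  have hFc : Continuous fun y => ∫ t in a..y, f t := intervalIntegral.continuous_primitive hfi a
  have hGc : Continuous fun y => ∫ t in a..y, g t := intervalIntegral.continuous_primitive hgi a
  have e2 : ∀ y, f y * G y + F y * g y = (f y * (∫ t in a..y, g t) + (∫ t in a..y, f t) * g y) +
      (f y * G a + F a * g y) := fun y => by rw [hFa y, hGa y]; ring
  simp only [e2]
  rw [intervalIntegral.integral_add, ← hP, intervalIntegral.integral_add,
    intervalIntegral.integral_mul_const, intervalIntegral.integral_const_mul, hFa b, hGa b]
  · ring
  · exact (hfi a b).mul_const _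
  · exact (hgi a b).const_mul _
  · exact ((hfi a b).mul_continuousOn hGc.continuousOn).add
      ((hgi a b).continuousOn_mul hFc.continuousOn)
  · exact ((hfi a b).mul_const _).add ((hgi a b).const_mul _)

/-- This is the product rule for φ G on an interval containing the support of φ, where the boundary
terms vanish. -/
theorem hasWeakDeriv_of_primitive {G g : ℝ → ℂ} (hg : LocallyIntegrable g)
    (hG : ∀ x, G x = G 0 + ∫ t in (0 : ℝ)..x, g t) : HasWeakDeriv G g := by
  have hGc : Continuous G := by
    rw [show G = fun x => G 0 + ∫ t in (0 : ℝ)..x, g t from funext hG]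
    exact continuous_const.add
      (intervalIntegral.continuous_primitive (intervalIntegrable_of_locallyIntegrable hg) 0)
  refine ⟨hGc.locallyIntegrable, hg, fun φ hφ hφc => ?_⟩
  have hd : Continuous (deriv φ) := hφ.continuous_deriv (by simp)
  have hφd : Differentiable ℝ φ := hφ.differentiable (by simp)
  obtain ⟨R, hR⟩ := hφc.isCompact.isBounded.subset_ball_lt 0 0
  have hsupp : ∀ x, x ∉ Ioo (-R) R → φ x = 0 := fun x hx => by
    by_contra h
    have := hR.2 (subset_tsupport _ h)
    rw [Real.ball_eq_Ioo] at this
    simp only [zero_sub, zero_add] at this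
    exact hx this
  have hsupp' : ∀ x, x ∉ Ioo (-R) R → deriv φ x = 0 := fun x hx => by
    by_contra h
    have := hR.2 (support_deriv_subset h)
    rw [Real.ball_eq_Ioo] at this
    simp only [zero_sub, zero_add] at this
    exact hx this
  have hF : ∀ x, (φ x : ℂ) = (φ 0 : ℂ) + ∫ t in (0 : ℝ)..x, ((deriv φ t : ℝ) : ℂ) := fun x => by
    rw [intervalIntegral.integral_ofReal,
      intervalIntegral.integral_deriv_eq_sub (fun y _ => hφd y) (hd.intervalIntegrable _ _)]
    push_cast; ring
  have hp := intervalIntegral_mul_add_mul (F := fun x => (φ x : ℂ))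
    (f := fun x => ((deriv φ x : ℝ) : ℂ)) (Complex.continuous_ofReal.comp hd).locallyIntegrable hg hF hG
    (neg_le_self hR.1.le)
  simp only [hsupp R (by simp), hsupp (-R) (by simp), Complex.ofReal_zero, zero_mul, sub_zero] at hp
  have hi1 := integrable_smul_of_locallyIntegrable hGc.locallyIntegrable hd hφc.deriv
  have hi2 := integrable_smul_of_locallyIntegrable hg hφ.continuous hφc
  rw [eq_neg_iff_add_eq_zero, ← integral_add hi1 hi2, hp,
    intervalIntegral.integral_of_le (neg_le_self hR.1.le),
    setIntegral_eq_integral_of_forall_compl_eq_zero]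
  · simp only [Complex.real_smul]
  · intro x hx
    have : x ∉ Ioo (-R) R := fun h => hx (Ioo_subset_Ioc_self h)
    simp [hsupp x this, hsupp' x this]

/-- Du Bois-Reymond's argument: after subtracting (∫φ) φ₀, with φ₀ a fixed bump of integral one, a
test function has integral zero and is the derivative of the test function ψ. Hence f pairs with φ
as the constant ∫ φ₀ f does. -/
theorem HasWeakDeriv.ae_eq_const {f : ℝ → ℂ} (h : HasWeakDeriv f 0) :
    ∃ c, f =ᵐ[volume] fun _ => c := by
  obtain ⟨b⟩ : Nonempty (ContDiffBump (0 : ℝ)) := ⟨⟨1, 2, one_pos, one_lt_two⟩⟩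
  set φ₀ : ℝ → ℝ := b.normed volume
  have h₀ : ContDiff ℝ ∞ φ₀ := b.contDiff_normed
  have h₀c : HasCompactSupport φ₀ := b.hasCompactSupport_normed
  have h₀i : ∫ x, φ₀ x = 1 := b.integral_normed
  refine ⟨∫ x, φ₀ x • f x, ae_eq_of_integral_contDiff_smul_eq h.1 (locallyIntegrable_const _)
    fun φ hφ hφc => ?_⟩
  set c := ∫ x, φ x
  set η : ℝ → ℝ := fun x => φ x - c * φ₀ x
  have hη : ContDiff ℝ ∞ η := hφ.sub (contDiff_const.mul h₀)
  have hηc : HasCompactSupport η := hφc.sub (h₀c.mul_left)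
  have hηi : Integrable η := hη.continuous.integrable_of_hasCompactSupport hηc
  have hη0 : ∫ x, η x = 0 := by
    rw [integral_sub (hφ.continuous.integrable_of_hasCompactSupport hφc)
      ((h₀.continuous.integrable_of_hasCompactSupport h₀c).const_mul _), integral_const_mul, h₀i]
    simp [c]
  set ψ : ℝ → ℝ := fun x => ∫ t in Iic x, η t
  have hψd : ∀ x, HasDerivAt ψ (η x) x := fun x => by
    have e : ψ = fun x => (∫ t in Iic 0, η t) + ∫ t in (0 : ℝ)..x, η t := by
      funext y
      rw [← intervalIntegral.integral_Iic_sub_Iic hηi.integrableOn hηi.integrableOn]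
      simp [ψ]
    rw [e]
    exact (intervalIntegral.integral_hasDerivAt_right (hη.continuous.intervalIntegrable _ _)
      (hη.continuous.stronglyMeasurableAtFilter _ _) hη.continuous.continuousAt).const_add _
  have hψ' : deriv ψ = η := funext fun x => (hψd x).deriv
  have hψ : ContDiff ℝ ∞ ψ := by
    rw [contDiff_infty_iff_deriv, hψ']
    exact ⟨fun x => (hψd x).differentiableAt, hη⟩
  obtain ⟨R, hR⟩ := hηc.isCompact.isBounded.subset_ball_lt 0 0
  have hsupp : ∀ x, x ∉ Ioo (-R) R → η x = 0 := fun x hx => by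
    by_contra h
    have := hR.2 (subset_tsupport _ h)
    rw [Real.ball_eq_Ioo] at this
    simp only [zero_sub, zero_add] at this
    exact hx this
  have hψc : HasCompactSupport ψ := by
    refine HasCompactSupport.intro (K := Icc (-R) R) isCompact_Icc fun x hx => ?_
    rcases lt_or_ge x (-R) with hxR | hxR
    · refine setIntegral_eq_zero_of_forall_eq_zero fun t ht => hsupp t fun h => ?_
      exact absurd (h.1.trans_le ht) (not_lt.2 hxR.le)
    · have hxR' : R < x := by
        by_contra h'
        exact hx ⟨hxR, not_lt.1 h'⟩
      rw [← hη0]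
      refine setIntegral_eq_integral_of_forall_compl_eq_zero fun t ht => hsupp t fun h => ?_
      exact ht (h.2.le.trans hxR'.le)
  have hw := h.2.2 ψ hψ hψc
  simp only [hψ', Pi.zero_apply, smul_zero, integral_zero, neg_zero] at hw
  have hi1 := integrable_smul_of_locallyIntegrable h.1 hφ.continuous hφc
  have hi2 := integrable_smul_of_locallyIntegrable h.1 h₀.continuous h₀c
  have e : ∀ x, η x • f x = φ x • f x - c • (φ₀ x • f x) := fun x => by
    simp only [η, sub_smul, mul_smul]
  simp only [e] at hw
  rw [integral_sub hi1 (by exact hi2.smul c), integral_smul, sub_eq_zero] at hw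
  rw [hw, integral_smul_const]

theorem HasWeakDeriv.exists_primitive {f g : ℝ → ℂ} (h : HasWeakDeriv f g) :
    ∃ c, f =ᵐ[volume] fun x => c + ∫ t in (0 : ℝ)..x, g t := by
  have h1 : HasWeakDeriv (fun x => ∫ t in (0 : ℝ)..x, g t) g :=
    hasWeakDeriv_of_primitive h.2.1 fun x => by simp
  obtain ⟨c, hc⟩ := HasWeakDeriv.ae_eq_const (by simpa using h.sub h1)
  refine ⟨c, hc.mono fun x hx => ?_⟩
  simp only [Pi.sub_apply] at hx
  rw [← hx]; ring

/-- Both factors agree almost everywhere with continuous primitives, and for those the rule is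
integration by parts. -/
theorem HasWeakDeriv.mul {f f' g g' : ℝ → ℂ} (hf : HasWeakDeriv f f') (hg : HasWeakDeriv g g') :
    HasWeakDeriv (fun x => f x * g x) (fun x => f' x * g x + f x * g' x) := by
  obtain ⟨c, hc⟩ := hf.exists_primitive
  obtain ⟨d, hd⟩ := hg.exists_primitive
  set F : ℝ → ℂ := fun x => c + ∫ t in (0 : ℝ)..x, f' t
  set G : ℝ → ℂ := fun x => d + ∫ t in (0 : ℝ)..x, g' t
  have hFc : Continuous F := continuous_const.add
    (intervalIntegral.continuous_primitive (intervalIntegrable_of_locallyIntegrable hf.2.1) 0)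
  have hGc : Continuous G := continuous_const.add
    (intervalIntegral.continuous_primitive (intervalIntegrable_of_locallyIntegrable hg.2.1) 0)
  have hF0 : ∀ x, F x = F 0 + ∫ t in (0 : ℝ)..x, f' t := fun x => by simp [F]
  have hG0 : ∀ x, G x = G 0 + ∫ t in (0 : ℝ)..x, g' t := fun x => by simp [G]
  have hl : LocallyIntegrable fun x => f' x * G x + F x * g' x := by
    refine LocallyIntegrable.add ?_ ?_
    · rw [locallyIntegrable_iff]
      exact fun K hK => (hf.2.1.integrableOn_isCompact hK).mul_continuousOn hGc.continuousOn hK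
    · rw [locallyIntegrable_iff]
      exact fun K hK => (hg.2.1.integrableOn_isCompact hK).continuousOn_mul hFc.continuousOn hK
  have := hasWeakDeriv_of_primitive (G := fun x => F x * G x) hl fun x => by
    rcases le_total 0 x with hx | hx
    · rw [← intervalIntegral_mul_add_mul hf.2.1 hg.2.1 hF0 hG0 hx]; ring
    · rw [intervalIntegral.integral_symm,
        ← intervalIntegral_mul_add_mul hf.2.1 hg.2.1 hF0 hG0 hx]; ring
  refine this.congr ?_ ?_
  · filter_upwards [hc, hd] with x h1 h2
    rw [h1, h2]
  · filter_upwards [hc, hd] with x h1 h2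
    rw [h1, h2]

/-- A nonzero constant is not square integrable on a half-line. -/
theorem not_memLp_two_of_le_norm {f : ℝ → ℂ} (hf : MemLp f 2) {ε a : ℝ} (hε : 0 < ε) :
    ¬ ∀ᵐ x, x ≤ a → ε ≤ ‖f x‖ := by
  intro h
  have h1 : MemLp (fun _ : ℝ => ε) 2 (volume.restrict (Iic a)) := by
    refine (hf.restrict (Iic a)).of_le aestronglyMeasurable_const
      ((ae_restrict_iff' measurableSet_Iic).2 (h.mono fun x hx hxa => ?_))
    rw [Real.norm_of_nonneg hε.le]
    exact hx hxa
  rw [memLp_const_iff two_ne_zero ENNReal.ofNat_ne_top] at h1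
  simp [hε.ne'] at h1

/-- The primitive of g vanishes at -∞, so f would stay close to the integration constant d there.
Square integrability forces d = 0. -/
theorem HasWeakDeriv.ae_eq_setIntegral_Iic {f g : ℝ → ℂ} (h : HasWeakDeriv f g) (hf : MemLp f 2)
    (hg : Integrable g) : f =ᵐ[volume] fun x => ∫ t in Iic x, g t := by
  obtain ⟨c, hc⟩ := h.exists_primitive
  set d := c - ∫ t in Iic 0, g t
  have hd : f =ᵐ[volume] fun x => d + ∫ t in Iic x, g t := by
    refine hc.mono fun x hx => ?_
    rw [hx]
    simp only
    rw [← intervalIntegral.integral_Iic_sub_Iic hg.integrableOn hg.integrableOn]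
    simp only [d]; ring
  suffices hd0 : d = 0 by simpa [hd0] using hd
  by_contra hd0
  have hpos : 0 < ‖d‖ / 2 := by positivity
  have ht : Filter.Tendsto (fun x => ∫ t in Iic x, g t) Filter.atBot (nhds 0) :=
    tendsto_integral_Iic_zero Filter.tendsto_id
  obtain ⟨a, ha⟩ := Filter.eventually_atBot.1 (ht.eventually (Metric.ball_mem_nhds 0 hpos))
  refine not_memLp_two_of_le_norm hf (a := a) hpos (hd.mono fun x hx hxa => ?_)
  have h1 := ha x hxa
  simp only [dist_zero_right] at h1
  rw [hx]
  have := norm_sub_le (d + ∫ t in Iic x, g t) (∫ t in Iic x, g t)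
  rw [add_sub_cancel_right] at this
  linarith

/-! ### Difference quotients and weak derivatives -/

/-- Translating the test function by δ gives the convolution of t ↦ φ(-t) with f at the point δ; its
derivative at 0 falls on the smooth factor. -/
theorem tendsto_difference_quotient_integral {f : ℝ → ℂ} (hf : LocallyIntegrable f) {φ : ℝ → ℝ}
    (hφ : ContDiff ℝ ∞ φ) (hφc : HasCompactSupport φ) :
    Filter.Tendsto (fun δ : ℝ => δ⁻¹ • ((∫ z, φ (z - δ) • f z) - ∫ z, φ z • f z))
      (nhdsWithin 0 {0}ᶜ) (nhds (-∫ z, deriv φ z • f z)) := by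
  have hφn : ContDiff ℝ ∞ (fun t => φ (-t)) := hφ.comp contDiff_neg
  have hφnc : HasCompactSupport (fun t => φ (-t)) := hφc.comp_homeomorph (Homeomorph.neg ℝ)
  have h := hφnc.hasDerivAt_convolution_left (ContinuousLinearMap.lsmul ℝ ℝ (E := ℂ)) (μ := volume)
    (hφn.of_le (by exact_mod_cast le_top)) hf 0
  rw [hasDerivAt_iff_tendsto_slope] at h
  have e : ∀ (ψ : ℝ → ℝ) δ, (convolution ψ f (ContinuousLinearMap.lsmul ℝ ℝ (E := ℂ)) volume) δ =
      ∫ z, ψ (δ - z) • f z := fun ψ δ => by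
    rw [convolution_eq_swap]
    rfl
  have e2 : ∀ z, deriv (fun t => φ (-t)) (0 - z) = - deriv φ z := fun z => by
    rw [deriv_comp_neg]; simp
  rw [e] at h
  simp only [e2, neg_smul, integral_neg] at h
  refine h.congr fun δ => ?_
  simp only [slope, e, vsub_eq_sub, sub_zero, neg_sub, zero_sub, neg_neg]

/-- A square integrable function whose difference quotients are bounded in `L²` has a weak
derivative in `L²`. -/
theorem exists_hasWeakDeriv_of_eLpNorm_translate_sub_le {f : ℝ → ℂ} (hf : MemLp f 2) {C : ℝ≥0}
    (h : ∀ δ : ℝ, eLpNorm (fun z => f (z + δ) - f z) 2 ≤ C * ‖δ‖ₑ) :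
    ∃ g, HasWeakDeriv f g ∧ MemLp g 2 ∧ eLpNorm g 2 ≤ C := by
  have hfl : LocallyIntegrable f := hf.locallyIntegrable one_le_two
  have hft : ∀ δ : ℝ, MemLp (fun z => f (z + δ)) 2 := fun δ =>
    hf.comp_measurePreserving (measurePreserving_add_right volume δ)
  have hq : ∀ δ : ℝ, MemLp (fun z => δ⁻¹ • (f (z + δ) - f z)) 2 := fun δ =>
    ((hft δ).sub hf).const_smul δ⁻¹
  set D : ℝ → Lp ℂ 2 (volume : Measure ℝ) := fun δ => (hq δ).toLp
  have hD : ∀ δ, δ ≠ 0 → ‖D δ‖ ≤ C := fun δ hδ => by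
    rw [← coe_nnnorm, NNReal.coe_le_coe, ← ENNReal.coe_le_coe, ← enorm_eq_nnnorm, Lp.enorm_toLp]
    have : (fun z => δ⁻¹ • (f (z + δ) - f z)) = δ⁻¹ • fun z => (f (z + δ) - f z) := rfl
    rw [this, eLpNorm_const_smul, enorm_inv hδ, mul_comm, ← div_eq_mul_inv]
    exact ENNReal.div_le_of_le_mul (h δ)
  set T : ℝ → WeakDual ℂ (Lp ℂ 2 (volume : Measure ℝ)) := fun δ =>
    StrongDual.toWeakDual (InnerProductSpace.toDual ℂ _ (D δ))
  -- By Banach–Alaoglu the bounded difference quotients converge weakly along this ultrafilter, and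
  -- the limit g stays in the ball of radius C.
  set U := Ultrafilter.of (nhdsWithin (0 : ℝ) {0}ᶜ)
  have hU : (U : Filter ℝ) ≤ nhdsWithin 0 {0}ᶜ := Ultrafilter.of_le _
  obtain ⟨ℓ, hℓ, hℓU⟩ := (WeakDual.isCompact_closedBall (𝕜 := ℂ)
    (0 : StrongDual ℂ (Lp ℂ 2 (volume : Measure ℝ))) C).ultrafilter_le_nhds (U.map T) (by
      rw [Filter.le_principal_iff]
      refine Filter.mem_map.2 (hU ?_)
      filter_upwards [self_mem_nhdsWithin] with δ hδ
      simp only [mem_preimage, T, mem_closedBall_zero_iff]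
      simpa using hD δ hδ)
  set g : Lp ℂ 2 (volume : Measure ℝ) := (InnerProductSpace.toDual ℂ _).symm (WeakDual.toStrongDual ℓ)
  have hg : ‖g‖ ≤ C := by
    simpa [g] using hℓ
  have hlim : ∀ ψ : Lp ℂ 2 (volume : Measure ℝ),
      Filter.Tendsto (fun δ => inner ℂ (D δ) ψ) U (nhds (inner ℂ g ψ)) := fun ψ => by
    have h1 : Filter.Tendsto T U (nhds ℓ) := hℓU
    have h2 := ((WeakDual.eval_continuous ψ).tendsto ℓ).comp h1
    have h3 : ℓ ψ = inner ℂ g ψ := by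
      rw [← InnerProductSpace.toDual_apply_apply, LinearIsometryEquiv.apply_symm_apply]
      rfl
    rw [h3] at h2
    exact h2
  refine ⟨g, ⟨hfl, (Lp.memLp g).locallyIntegrable one_le_two, fun φ hφ hφc => ?_⟩, Lp.memLp g, ?_⟩
  · have hφ2 : MemLp (fun z => (φ z : ℂ)) 2 :=
      (Complex.continuous_ofReal.comp hφ.continuous).memLp_of_hasCompactSupport
        (hφc.comp_left (g := fun x : ℝ => (x : ℂ)) rfl)
    have hin : ∀ k : Lp ℂ 2 (volume : Measure ℝ), inner ℂ k (hφ2.toLp) =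
        (starRingEnd ℂ) (∫ z, φ z • k z) := fun k => by
      rw [L2.inner_def, ← integral_conj]
      refine integral_congr_ae ?_
      filter_upwards [hφ2.coeFn_toLp] with z hz
      rw [hz]
      simp [RCLike.inner_apply]
    -- Discrete integration by parts: the translation passes from f to the test function, where the
    -- limit in δ can be computed.
    have hDφ : ∀ δ, ∫ z, φ z • D δ z =
        δ⁻¹ • ((∫ z, φ (z - δ) • f z) - ∫ z, φ z • f z) := fun δ => by
      have hi : Integrable fun z => φ z • f z :=
        integrable_smul_of_locallyIntegrable hfl hφ.continuous hφc
      have hi2 : Integrable fun z => φ z • f (z + δ) :=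
        integrable_smul_of_locallyIntegrable ((hft δ).locallyIntegrable one_le_two) hφ.continuous hφc
      have e1 : ∫ z, φ (z - δ) • f z = ∫ z, φ z • f (z + δ) := by
        rw [← integral_add_right_eq_self (fun z => φ (z - δ) • f z) δ]
        simp
      rw [e1, ← integral_sub hi2 hi, ← integral_smul]
      refine integral_congr_ae ?_
      filter_upwards [(hq δ).coeFn_toLp] with z hz
      rw [hz, smul_comm, smul_sub]
    have h1 := hlim hφ2.toLp
    simp only [hin, hDφ] at h1
    have h2 := (Complex.continuous_conj.tendsto _).comp
      ((tendsto_difference_quotient_integral hfl hφ hφc).mono_left hU)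
    have h3 := tendsto_nhds_unique h1 h2
    rw [← (starRingEnd ℂ).injective h3 |>.symm, neg_neg]
  · rw [← Lp.enorm_def, enorm_eq_nnnorm, ENNReal.coe_le_coe]
    exact hg

/-! ### Membership in the Bochner spaces -/

section Measurability

/-- In a second countable space the open balls generate the Borel sets, so measurability of a map
can be tested on its distances to points. -/
theorem measurable_of_measurable_edist {α X : Type*} [MeasurableSpace α] [PseudoEMetricSpace X]
    [SecondCountableTopology X] [MeasurableSpace X] [BorelSpace X] {F : α → X}
    (h : ∀ c, Measurable fun a => edist (F a) c) : Measurable F := by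
  have hb : TopologicalSpace.IsTopologicalBasis {s : Set X | ∃ c r, s = Metric.eball c r} := by
    refine TopologicalSpace.isTopologicalBasis_of_isOpen_of_nhds ?_ ?_
    · rintro s ⟨c, r, rfl⟩
      exact Metric.isOpen_eball
    · intro a u ha hu
      obtain ⟨r, hr, hru⟩ := EMetric.isOpen_iff.1 hu a ha
      exact ⟨_, ⟨a, r, rfl⟩, Metric.mem_eball_self hr, hru⟩
  rw [BorelSpace.measurable_eq (α := X), hb.borel_eq_generateFrom]
  refine measurable_generateFrom ?_
  rintro s ⟨c, r, rfl⟩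
  exact measurableSet_lt (h c) measurable_const

variable {E : Type*} [NormedAddCommGroup E]

open Classical in
/-- The `L²`-valued map of a jointly measurable function (zero at the points where the section is
not square integrable). -/
def toL2 (f : ℝ → ℝ → E) (x : ℝ) : Lp E 2 (volume : Measure ℝ) :=
  if h : MemLp (f x) 2 then h.toLp else 0

theorem measurable_eLpNorm_section [MeasurableSpace E] [BorelSpace E] {f : ℝ → ℝ → E} (hf : Measurable (Function.uncurry f)) :
    Measurable fun x => eLpNorm (f x) 2 := by
  simp only [eLpNorm_eq_lintegral_rpow_enorm_toReal two_ne_zero ENNReal.ofNat_ne_top]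
  exact (Measurable.lintegral_prod_right' (f := fun p : ℝ × ℝ =>
    ‖Function.uncurry f p‖ₑ ^ (2 : ℝ≥0∞).toReal) (hf.enorm.pow_const _)).pow_const _

/-- Where the section is square integrable, its distance to a fixed c is the norm of a section of a
jointly measurable function, and this is measurable in x by Tonelli. -/
theorem measurable_toL2 [MeasurableSpace E] [BorelSpace E] [SecondCountableTopology E]
    {f : ℝ → ℝ → E} (hf : Measurable (Function.uncurry f))
    [MeasurableSpace (Lp E 2 (volume : Measure ℝ))] [BorelSpace (Lp E 2 (volume : Measure ℝ))]
    [SecondCountableTopology (Lp E 2 (volume : Measure ℝ))] :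
    Measurable (toL2 f) := by
  classical
  have hS : MeasurableSet {x | MemLp (f x) 2} := by
    have : {x | MemLp (f x) 2} = {x | eLpNorm (f x) 2 < ⊤} := by
      ext x
      exact ⟨fun h => h.2, fun h => ⟨hf.of_uncurry_left.aestronglyMeasurable, h⟩⟩
    rw [this]
    exact measurableSet_lt (measurable_eLpNorm_section hf) measurable_const
  refine measurable_of_measurable_edist fun c => ?_
  obtain ⟨c', hc', hcc'⟩ := (Lp.aestronglyMeasurable c)
  have hm : Measurable fun x => eLpNorm (fun z => f x z - c' z) 2 :=
    measurable_eLpNorm_section (f := fun x z => f x z - c' z)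
      (hf.sub (hc'.measurable.comp measurable_snd))
  have : (fun x => edist (toL2 f x) c) = fun x => {x | MemLp (f x) 2}.piecewise
      (fun x => eLpNorm (fun z => f x z - c' z) 2) (fun _ => edist 0 c) x := by
    funext x
    by_cases hx : MemLp (f x) 2
    · rw [piecewise_eq_of_mem _ _ _ (by exact hx), toL2, dif_pos hx, Lp.edist_def]
      refine eLpNorm_congr_ae ?_
      filter_upwards [hx.coeFn_toLp, hcc'] with z h1 h2
      simp [h1, h2]
    · rw [piecewise_eq_of_notMem _ _ _ (by exact hx), toL2, dif_neg hx]
  rw [this]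
  exact hm.piecewise hS measurable_const

end Measurability

theorem secondCountable_L2 (E : Type*) [NormedAddCommGroup E] [SecondCountableTopology E] :
    SecondCountableTopology (Lp E 2 (volume : Measure ℝ)) := by
  have : Fact ((2 : ℝ≥0∞) ≠ ⊤) := ⟨ENNReal.ofNat_ne_top⟩
  have : TopologicalSpace.SeparableSpace E := inferInstance
  infer_instance

/-- Here f is a jointly measurable version of f'. The distinction is needed because the expansion
coefficients contain a weak derivative, which is determined only up to a null set of x. -/
theorem memLinftyL2_of_bound {E : Type*} [NormedAddCommGroup E] [NormedSpace ℝ E]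
    [MeasurableSpace E] [BorelSpace E] [SecondCountableTopology E] {S : Set ℝ} {f f' : ℝ → ℝ → E}
    (hf : Measurable (Function.uncurry f)) {C : ℝ≥0}
    (hC : ∀ᵐ x ∂(volume.restrict S), eLpNorm (f x) 2 ≤ C)
    (hff' : ∀ᵐ x ∂(volume.restrict S), f x = f' x) :
    MemLp (toL2 f) ⊤ (volume.restrict S) ∧
      ∀ᵐ x ∂(volume.restrict S), toL2 f x =ᵐ[volume] f' x := by
  let : MeasurableSpace (Lp E 2 (volume : Measure ℝ)) := borel _
  have : BorelSpace (Lp E 2 (volume : Measure ℝ)) := ⟨rfl⟩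
  have := secondCountable_L2 E
  have h2 : ∀ᵐ x ∂(volume.restrict S), ∃ h : MemLp (f x) 2, toL2 f x = h.toLp := by
    filter_upwards [hC] with x hx
    have h : MemLp (f x) 2 :=
      ⟨hf.of_uncurry_left.aestronglyMeasurable, hx.trans_lt ENNReal.coe_lt_top⟩
    exact ⟨h, dif_pos h⟩
  refine ⟨memLp_top_of_bound (measurable_toL2 hf).aestronglyMeasurable C ?_, ?_⟩
  · filter_upwards [hC, h2] with x hx ⟨h, he⟩
    rw [he, ← coe_nnnorm, NNReal.coe_le_coe, ← ENNReal.coe_le_coe, ← enorm_eq_nnnorm, Lp.enorm_toLp]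
    exact hx
  · filter_upwards [h2, hff'] with x ⟨h, he⟩ h3
    rw [he, ← h3]
    exact h.coeFn_toLp

/-- The pairs of a square integrable function and its square integrable weak derivative. -/
def weakDerivGraph (E : Type*) [NormedAddCommGroup E] [NormedSpace ℝ E] :
    Set (Lp E 2 (volume : Measure ℝ) × Lp E 2 (volume : Measure ℝ)) :=
  {p | HasWeakDeriv p.1 p.2}

/-- Each test function imposes the equality of two continuous functionals on L² × L². -/
theorem isClosed_weakDerivGraph (E : Type*) [NormedAddCommGroup E] [NormedSpace ℝ E]
    [CompleteSpace E] : IsClosed (weakDerivGraph E) := by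
  have hc : ∀ {ψ : ℝ → ℝ}, Continuous ψ → HasCompactSupport ψ →
      Continuous fun f : Lp E 2 (volume : Measure ℝ) => ∫ x, ψ x • f x := fun {ψ} hψ hψc => by
    have hm : MemLp ψ 2 := hψ.memLp_of_hasCompactSupport hψc
    have : (fun f : Lp E 2 (volume : Measure ℝ) => ∫ x, ψ x • f x) =
        (ContinuousLinearMap.lsmul ℝ ℝ (E := E)).lpPairing volume 2 2 hm.toLp := by
      funext f
      rw [ContinuousLinearMap.lpPairing_eq_integral]
      refine integral_congr_ae ?_
      filter_upwards [hm.coeFn_toLp] with z hz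
      rw [hz]; rfl
    rw [this]
    exact ContinuousLinearMap.continuous _
  have : weakDerivGraph E = ⋂ (φ : ℝ → ℝ) (_ : ContDiff ℝ ∞ φ) (_ : HasCompactSupport φ),
      {p | ∫ x, deriv φ x • p.1 x = - ∫ x, φ x • p.2 x} := by
    ext p
    simp only [weakDerivGraph, mem_ofPred_eq, mem_iInter]
    exact ⟨fun h => h.2.2, fun h => ⟨(Lp.memLp _).locallyIntegrable one_le_two,
      (Lp.memLp _).locallyIntegrable one_le_two, h⟩⟩
  rw [this]
  refine isClosed_iInter fun φ => isClosed_iInter fun hφ => isClosed_iInter fun hφc => ?_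
  exact isClosed_eq ((hc (hφ.continuous_deriv (by simp)) hφc.deriv).comp continuous_fst)
    ((hc hφ.continuous hφc).comp continuous_snd).neg

/-- A derivative is given for almost every x with no measurable dependence on x. The graph of the
weak derivative is closed in L² × L², hence Polish, and its projection to the first factor is
continuous and injective. By Lusin–Souslin the projection is a measurable embedding, so the point of
the graph above `toL2 f x` depends measurably on x. -/
theorem memLinftyH1_of_bound {E : Type*} [NormedAddCommGroup E] [NormedSpace ℝ E] [CompleteSpace E]
    [MeasurableSpace E] [BorelSpace E] [SecondCountableTopology E] {S : Set ℝ} {f f' : ℝ → ℝ → E}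
    (hf : Measurable (Function.uncurry f)) {C C' : ℝ≥0}
    (hC : ∀ᵐ x ∂(volume.restrict S), eLpNorm (f x) 2 ≤ C)
    (hC' : ∀ᵐ x ∂(volume.restrict S), ∃ g, HasWeakDeriv (f x) g ∧ MemLp g 2 ∧ eLpNorm g 2 ≤ C')
    (hff' : ∀ᵐ x ∂(volume.restrict S), f x = f' x) :
    MemLinftyH1 S f' := by
  classical
  let : MeasurableSpace (Lp E 2 (volume : Measure ℝ)) := borel _
  have : BorelSpace (Lp E 2 (volume : Measure ℝ)) := ⟨rfl⟩
  have := secondCountable_L2 E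
  obtain ⟨h1, h2⟩ := memLinftyL2_of_bound hf hC hff'
  have : PolishSpace (weakDerivGraph E) := (isClosed_weakDerivGraph E).polishSpace
  set π : weakDerivGraph E → Lp E 2 (volume : Measure ℝ) := fun p => p.1.1
  have hπi : Function.Injective π := by
    rintro ⟨⟨a, b⟩, hab⟩ ⟨⟨a', b'⟩, hab'⟩ h
    simp only [π] at h
    subst h
    have : b = b' := Lp.ext (HasWeakDeriv.ae_unique hab hab')
    subst this
    rfl
  have hπ : MeasurableEmbedding π :=
    (continuous_fst.comp continuous_subtype_val).measurableEmbedding hπi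
  have h0 : ((0, 0) : Lp E 2 (volume : Measure ℝ) × Lp E 2 (volume : Measure ℝ)) ∈
      weakDerivGraph E := by
    have hz : (0 : ℝ → E) =ᵐ[volume] ((0 : Lp E 2 (volume : Measure ℝ)) : ℝ → E) :=
      (Lp.coeFn_zero E 2 volume).symm
    refine HasWeakDeriv.congr (f := 0) (g := 0) ?_ hz hz
    exact ⟨locallyIntegrable_zero, locallyIntegrable_zero, fun φ _ _ => by simp⟩
  -- The default value (0, 0) is taken only on a null subset of `S`, by `hC'` and the bound on f.
  set Z : ℝ → weakDerivGraph E := fun x =>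
    if h : ∃ g, (toL2 f x, g) ∈ weakDerivGraph E then ⟨(toL2 f x, h.choose), h.choose_spec⟩
    else ⟨(0, 0), h0⟩
  have hZ : Measurable Z := by
    rw [← hπ.measurable_comp_iff]
    have hR : MeasurableSet (toL2 f ⁻¹' range π) := measurable_toL2 hf hπ.measurableSet_range
    have : π ∘ Z = (toL2 f ⁻¹' range π).piecewise (toL2 f) (fun _ => 0) := by
      funext x
      by_cases hx : ∃ g, (toL2 f x, g) ∈ weakDerivGraph E
      · have hx' : x ∈ toL2 f ⁻¹' range π := ⟨⟨_, hx.choose_spec⟩, rfl⟩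
        rw [piecewise_eq_of_mem _ _ _ hx']
        simp only [Function.comp_apply, Z, dif_pos hx, π]
      · have hx' : x ∉ toL2 f ⁻¹' range π := by
          rintro ⟨⟨⟨a, b⟩, hab⟩, h⟩
          simp only [π] at h
          subst h
          exact hx ⟨b, hab⟩
        rw [piecewise_eq_of_notMem _ _ _ hx']
        simp only [Function.comp_apply, Z, dif_neg hx, π]
    rw [this]
    exact (measurable_toL2 hf).piecewise hR measurable_const
  have hG : Measurable fun x => (Z x).1.2 :=
    (continuous_snd.comp continuous_subtype_val).measurable.comp hZ
  have hmain : ∀ᵐ x ∂(volume.restrict S), HasWeakDeriv (f' x) (Z x).1.2 ∧ ‖(Z x).1.2‖ ≤ C' := by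
    filter_upwards [h2, hff', hC'] with x hx hfx ⟨g, hg, hg2, hgC⟩
    have hx2 : ∃ g, (toL2 f x, g) ∈ weakDerivGraph E := by
      refine ⟨hg2.toLp, ?_⟩
      rw [hfx] at hg
      exact hg.congr hx.symm hg2.coeFn_toLp.symm
    have hZx : Z x = ⟨(toL2 f x, hx2.choose), hx2.choose_spec⟩ := dif_pos hx2
    have hw : HasWeakDeriv (f' x) (Z x).1.2 := by
      rw [hZx]
      exact HasWeakDeriv.congr (show HasWeakDeriv (toL2 f x) hx2.choose from hx2.choose_spec) hx
        Filter.EventuallyEq.rfl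
    refine ⟨hw, ?_⟩
    rw [← coe_nnnorm, NNReal.coe_le_coe, ← ENNReal.coe_le_coe, ← enorm_eq_nnnorm, Lp.enorm_def]
    rw [hfx] at hg
    rw [eLpNorm_congr_ae (hw.ae_unique hg)]
    exact hgC
  refine ⟨toL2 f, fun x => (Z x).1.2, h1,
    memLp_top_of_bound hG.aestronglyMeasurable C' (hmain.mono fun x hx => hx.2), ?_⟩
  filter_upwards [h2, hmain] with x hx hx'
  exact ⟨hx, hx'.1⟩

/-! ### The Volterra system: existence, joint continuity, uniqueness -/

/-- The total size of four coefficients. -/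
def kern (a b c d : ℝ → ℂ) (y : ℝ) : ℝ := ‖a y‖ + ‖b y‖ + ‖c y‖ + ‖d y‖

theorem kern_nonneg (a b c d : ℝ → ℂ) (y : ℝ) : 0 ≤ kern a b c d y := by
  unfold kern; positivity

/-- Measurable integrable coefficients of a Volterra system. -/
structure IsCoeff (a b c d : ℝ → ℂ) : Prop where
  ma : Measurable a
  mb : Measurable b
  mc : Measurable c
  md : Measurable d
  ia : Integrable a
  ib : Integrable b
  ic : Integrable c
  id : Integrable d

section

variable {a b c d : ℝ → ℂ}

theorem IsCoeff.integrable_kern (h : IsCoeff a b c d) : Integrable (kern a b c d) :=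
  ((h.ia.norm.add h.ib.norm).add h.ic.norm).add h.id.norm

theorem IsCoeff.measurable_kern (h : IsCoeff a b c d) : Measurable (kern a b c d) :=
  ((h.ma.norm.add h.mb.norm).add h.mc.norm).add h.md.norm

/-- Dominated convergence: the indicator of (-∞, p.1] is discontinuous in p at p₀ only for the
single point y = p₀.1, a null set. -/
theorem continuous_volterra_integral {G : ℝ → ℝ × ℝ → ℂ} (hG : ∀ y, Continuous (G y))
    (hm : ∀ p, AEStronglyMeasurable (fun y => G y p)) {β : ℝ → ℝ} (hβ : Integrable β)
    (hGβ : ∀ y p, ‖G y p‖ ≤ β y) : Continuous fun p : ℝ × ℝ => ∫ y in Iic p.1, G y p := by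
  have e : (fun p : ℝ × ℝ => ∫ y in Iic p.1, G y p) =
      fun p => ∫ y, indicator (Iic p.1) (fun y => G y p) y := by
    funext p
    rw [integral_indicator measurableSet_Iic]
  rw [e, continuous_iff_continuousAt]
  intro p₀
  refine continuousAt_of_dominated (bound := β)
    (Filter.Eventually.of_forall fun p => (hm p).indicator measurableSet_Iic)
    (Filter.Eventually.of_forall fun p => Filter.Eventually.of_forall fun y => ?_) hβ ?_
  · exact (norm_indicator_le_norm_self _ _).trans (hGβ y p)
  · have hne : ∀ᵐ y : ℝ, y ≠ p₀.1 := by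
      simp [ae_iff, measure_singleton]
    filter_upwards [hne] with y hy
    rcases lt_or_gt_of_ne hy with hlt | hlt
    · refine (hG y).continuousAt.congr ?_
      filter_upwards [continuous_fst.continuousAt.eventually (lt_mem_nhds hlt)] with p hp
      have hp' : y ∈ Iic p.1 := mem_Iic.2 (le_of_lt hp)
      exact (indicator_of_mem hp' (fun y => G y p)).symm
    · refine (continuousAt_const : ContinuousAt (fun _ : ℝ × ℝ => (0 : ℂ)) p₀).congr ?_
      filter_upwards [continuous_fst.continuousAt.eventually (gt_mem_nhds hlt)] with p hp
      have hp' : y ∉ Iic p.1 := fun h => absurd (mem_Iic.1 h) (not_le.2 hp)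
      exact (indicator_of_notMem hp' (fun y => G y p)).symm

-- A fixed point in the bounded continuous functions of (x, z), for the unknown n = m / W with W =
-- exp(2∫k). Since ∫ k W ≤ W/2 and the exponential is unimodular, the map is a contraction with
-- constant 1/2. Working with both variables at once yields joint continuity, hence the joint
-- measurability required by Tonelli and Minkowski.
open BoundedContinuousFunction in
theorem exists_volterra_solution (h : IsCoeff a b c d) : ∃ m₁ m₂ : ℝ → ℝ → ℂ,
    Continuous (Function.uncurry m₁) ∧ Continuous (Function.uncurry m₂) ∧
    (∃ M : ℝ, ∀ x z, ‖m₁ x z‖ ≤ M ∧ ‖m₂ x z‖ ≤ M) ∧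
    (∀ x z, m₁ x z = 1 + ∫ y in Iic x, (a y * m₁ y z + b y * m₂ y z)) ∧
    (∀ x z, m₂ x z = ∫ y in Iic x, Complex.exp (2 * Complex.I * z * (x - y)) *
      (c y * m₁ y z + d y * m₂ y z)) := by
  set k := kern a b c d
  have hk := h.integrable_kern
  have k0 := kern_nonneg a b c d
  set W : ℝ → ℝ := fun x => Real.exp (2 * ∫ t in Iic x, k t)
  have hWc : Continuous W :=
    Real.continuous_exp.comp (continuous_const.mul (continuous_setIntegral_Iic hk))
  have hW0 : ∀ x, 0 < W x := fun x => Real.exp_pos _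
  have hW1 : ∀ x, 1 ≤ W x := fun x => Real.one_le_exp (mul_nonneg zero_le_two (integral_nonneg k0))
  set N := Real.exp (2 * ∫ t, k t)
  have hWN : ∀ x, W x ≤ N := fun x => Real.exp_le_exp.2 (by
    gcongr
    · exact Filter.Eventually.of_forall k0
    · exact Measure.restrict_le_self)
  have hkW : Integrable fun y => k y * W y := integrable_mul_exp_primitive hk
  have hI : ∀ x, ∫ y in Iic x, k y * W y ≤ W x / 2 := fun x => by
    rw [setIntegral_Iic_mul_exp_real hk]; simp only [W]; linarith
  have key : ∀ (x : ℝ) {G : ℝ → ℂ} {C : ℝ}, 0 ≤ C → (∀ y, ‖G y‖ ≤ k y * W y * C) →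
      ‖∫ y in Iic x, G y‖ ≤ W x / 2 * C := fun x G C hC hG => by
    calc ‖∫ y in Iic x, G y‖ ≤ ∫ y in Iic x, k y * W y * C :=
          norm_integral_le_of_norm_le (hkW.mul_const C).restrict (Filter.Eventually.of_forall hG)
      _ = (∫ y in Iic x, k y * W y) * C := integral_mul_const _ _
      _ ≤ _ := by gcongr; exact hI x
  set X := BoundedContinuousFunction (ℝ × ℝ) (ℂ × ℂ)
  -- The integrands of the two equations, written for n with m = W n.
  set G₁ : X → ℝ → ℝ × ℝ → ℂ := fun n y p =>
    W y * (a y * (n (y, p.2)).1 + b y * (n (y, p.2)).2)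
  set G₂ : X → ℝ → ℝ × ℝ → ℂ := fun n y p =>
    W y * (Complex.exp (2 * Complex.I * p.2 * (p.1 - y)) *
      (c y * (n (y, p.2)).1 + d y * (n (y, p.2)).2))
  have hlin : ∀ (s t : ℝ → ℂ) (y : ℝ) (v : ℂ × ℂ), ‖s y‖ + ‖t y‖ ≤ k y →
      ‖s y * v.1 + t y * v.2‖ ≤ k y * ‖v‖ := fun s t y v hst => by
    calc ‖s y * v.1 + t y * v.2‖ ≤ ‖s y‖ * ‖v.1‖ + ‖t y‖ * ‖v.2‖ := by
          refine (norm_add_le _ _).trans ?_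
          rw [norm_mul, norm_mul]
      _ ≤ ‖s y‖ * ‖v‖ + ‖t y‖ * ‖v‖ := by
          gcongr
          · exact norm_fst_le v
          · exact norm_snd_le v
      _ = (‖s y‖ + ‖t y‖) * ‖v‖ := by ring
      _ ≤ _ := by gcongr
  have hab : ∀ y, ‖a y‖ + ‖b y‖ ≤ k y := fun y => by
    simp only [k, kern]; linarith [norm_nonneg (c y), norm_nonneg (d y)]
  have hcd : ∀ y, ‖c y‖ + ‖d y‖ ≤ k y := fun y => by
    simp only [k, kern]; linarith [norm_nonneg (a y), norm_nonneg (b y)]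
  have hWn : ∀ y, ‖(W y : ℂ)‖ = W y := fun y => by
    rw [Complex.norm_real, Real.norm_of_nonneg (hW0 y).le]
  have bd₁ : ∀ (v : ℂ × ℂ) y, ‖(W y : ℂ) * (a y * v.1 + b y * v.2)‖ ≤ k y * W y * ‖v‖ :=
    fun v y => by
      rw [norm_mul, hWn]
      have := mul_le_mul_of_nonneg_left (hlin a b y v (hab y)) (hW0 y).le
      linarith
  have bd₂ : ∀ (v : ℂ × ℂ) (z t : ℝ) y, ‖(W y : ℂ) * (Complex.exp (2 * Complex.I * z * t) *
      (c y * v.1 + d y * v.2))‖ ≤ k y * W y * ‖v‖ := fun v z t y => by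
      rw [norm_mul, hWn, norm_mul, norm_exp_two_I_mul, one_mul]
      have := mul_le_mul_of_nonneg_left (hlin c d y v (hcd y)) (hW0 y).le
      linarith
  have kW0 : ∀ y, 0 ≤ k y * W y := fun y => mul_nonneg (k0 y) (hW0 y).le
  have bG₁ : ∀ (n : X) y p, ‖G₁ n y p‖ ≤ k y * W y * ‖n‖ := fun n y p =>
    (bd₁ _ y).trans (mul_le_mul_of_nonneg_left (n.norm_coe_le_norm _) (kW0 y))
  have bG₂ : ∀ (n : X) y p, ‖G₂ n y p‖ ≤ k y * W y * ‖n‖ := fun n y p => by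
    have := (bd₂ (n (y, p.2)) p.2 (p.1 - y) y).trans
      (mul_le_mul_of_nonneg_left (n.norm_coe_le_norm _) (kW0 y))
    simpa [G₂] using this
  have mG₁ : ∀ (n : X) p, Measurable fun y => G₁ n y p := fun n p => by
    have h1 : Measurable fun y : ℝ => n (y, p.2) :=
      (n.continuous.comp (by fun_prop)).measurable
    exact (Complex.measurable_ofReal.comp hWc.measurable).mul
      ((h.ma.mul h1.fst).add (h.mb.mul h1.snd))
  have mG₂ : ∀ (n : X) p, Measurable fun y => G₂ n y p := fun n p => by
    have h1 : Measurable fun y : ℝ => n (y, p.2) :=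
      (n.continuous.comp (by fun_prop)).measurable
    exact (Complex.measurable_ofReal.comp hWc.measurable).mul
      ((by fun_prop : Measurable fun y : ℝ =>
        Complex.exp (2 * Complex.I * p.2 * (p.1 - y))).mul ((h.mc.mul h1.fst).add (h.md.mul h1.snd)))
  have cG₁ : ∀ n : X, Continuous fun p : ℝ × ℝ => ∫ y in Iic p.1, G₁ n y p := fun n =>
    continuous_volterra_integral (fun y => by
      have := n.continuous; fun_prop) (fun p => (mG₁ n p).aestronglyMeasurable)
      (hkW.mul_const ‖n‖) (bG₁ n)
  have cG₂ : ∀ n : X, Continuous fun p : ℝ × ℝ => ∫ y in Iic p.1, G₂ n y p := fun n =>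
    continuous_volterra_integral (fun y => by
      have := n.continuous; fun_prop) (fun p => (mG₂ n p).aestronglyMeasurable)
      (hkW.mul_const ‖n‖) (bG₂ n)
  have iG₁ : ∀ (n : X) p, Integrable fun y => G₁ n y p := fun n p =>
    (hkW.mul_const ‖n‖).mono' (mG₁ n p).aestronglyMeasurable
      (Filter.Eventually.of_forall fun y => bG₁ n y p)
  have iG₂ : ∀ (n : X) p, Integrable fun y => G₂ n y p := fun n p =>
    (hkW.mul_const ‖n‖).mono' (mG₂ n p).aestronglyMeasurable
      (Filter.Eventually.of_forall fun y => bG₂ n y p)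
  have hWi : ∀ x, ‖((W x)⁻¹ : ℂ)‖ = (W x)⁻¹ := fun x => by rw [norm_inv, hWn]
  have hWWi : ∀ x C, (W x)⁻¹ * (W x / 2 * C) = C / 2 := fun x C => by
    have := (hW0 x).ne'
    field_simp
  set T : X → X := fun n => BoundedContinuousFunction.ofNormedAddCommGroup
    (fun p => ((W p.1 : ℂ)⁻¹ * (1 + ∫ y in Iic p.1, G₁ n y p),
      (W p.1 : ℂ)⁻¹ * ∫ y in Iic p.1, G₂ n y p))
    (by
      have h1 := cG₁ n
      have h2 := cG₂ n
      have h3 : Continuous fun p : ℝ × ℝ => (W p.1 : ℂ)⁻¹ :=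
        Continuous.inv₀ (Complex.continuous_ofReal.comp (hWc.comp continuous_fst))
          fun p => by exact_mod_cast (hW0 p.1).ne'
      exact (h3.mul (continuous_const.add h1)).prodMk (h3.mul h2))
    (1 + ‖n‖) (fun p => by
      have h1 := key p.1 (norm_nonneg n) (bG₁ n · p)
      have h2 := key p.1 (norm_nonneg n) (bG₂ n · p)
      have h3 := inv_le_one_of_one_le₀ (hW1 p.1)
      have h4 := inv_pos.2 (hW0 p.1)
      refine norm_prod_le_iff.2 ⟨?_, ?_⟩
      · simp only [norm_mul, hWi]
        calc (W p.1)⁻¹ * ‖1 + ∫ y in Iic p.1, G₁ n y p‖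
            ≤ (W p.1)⁻¹ * (1 + W p.1 / 2 * ‖n‖) := by
              gcongr
              refine (norm_add_le _ _).trans ?_
              rw [norm_one]
              gcongr
          _ = (W p.1)⁻¹ + ‖n‖ / 2 := by rw [mul_add, mul_one, hWWi]
          _ ≤ _ := by linarith [norm_nonneg n]
      · simp only [norm_mul, hWi]
        calc (W p.1)⁻¹ * ‖∫ y in Iic p.1, G₂ n y p‖
            ≤ (W p.1)⁻¹ * (W p.1 / 2 * ‖n‖) := by gcongr
          _ = ‖n‖ / 2 := hWWi _ _
          _ ≤ _ := by linarith [norm_nonneg n])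
  have hT : ContractingWith (1 / 2) T := by
    refine ⟨by norm_num, LipschitzWith.of_dist_le_mul fun n n' => ?_⟩
    have hd0 : 0 ≤ dist n n' := dist_nonneg
    rw [BoundedContinuousFunction.dist_le (by positivity)]
    intro p
    have hnn : ∀ y, ‖n (y, p.2) - n' (y, p.2)‖ ≤ dist n n' := fun y => by
      rw [← dist_eq_norm]; exact BoundedContinuousFunction.dist_coe_le_dist _
    have e1 : (∫ y in Iic p.1, G₁ n y p) - ∫ y in Iic p.1, G₁ n' y p =
        ∫ y in Iic p.1, (G₁ n y p - G₁ n' y p) :=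
      (integral_sub (iG₁ n p).restrict (iG₁ n' p).restrict).symm
    have e2 : (∫ y in Iic p.1, G₂ n y p) - ∫ y in Iic p.1, G₂ n' y p =
        ∫ y in Iic p.1, (G₂ n y p - G₂ n' y p) :=
      (integral_sub (iG₂ n p).restrict (iG₂ n' p).restrict).symm
    have h1 := key p.1 (G := fun y => G₁ n y p - G₁ n' y p) hd0 fun y => by
      have e : G₁ n y p - G₁ n' y p = W y * (a y * (n (y, p.2) - n' (y, p.2)).1 +
          b y * (n (y, p.2) - n' (y, p.2)).2) := by
        simp only [G₁, Prod.fst_sub, Prod.snd_sub]; ring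
      rw [e]
      exact (bd₁ _ y).trans (mul_le_mul_of_nonneg_left (hnn y) (kW0 y))
    have h2 := key p.1 (G := fun y => G₂ n y p - G₂ n' y p) hd0 fun y => by
      have e : G₂ n y p - G₂ n' y p = W y * (Complex.exp (2 * Complex.I * p.2 * ((p.1 - y : ℝ) : ℂ)) *
          (c y * (n (y, p.2) - n' (y, p.2)).1 + d y * (n (y, p.2) - n' (y, p.2)).2)) := by
        simp only [G₂, Prod.fst_sub, Prod.snd_sub, Complex.ofReal_sub]; ring
      rw [e]
      exact (bd₂ _ _ _ y).trans (mul_le_mul_of_nonneg_left (hnn y) (kW0 y))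
    have h4 := (inv_pos.2 (hW0 p.1)).le
    have hc : ((1 / 2 : ℝ≥0) : ℝ) * dist n n' = dist n n' / 2 := by push_cast; ring
    rw [hc, dist_eq_norm]
    refine norm_prod_le_iff.2 ⟨?_, ?_⟩
    · change ‖(W p.1 : ℂ)⁻¹ * (1 + ∫ y in Iic p.1, G₁ n y p) -
        (W p.1 : ℂ)⁻¹ * (1 + ∫ y in Iic p.1, G₁ n' y p)‖ ≤ _
      rw [← mul_sub, add_sub_add_left_eq_sub, e1, norm_mul, hWi, ← hWWi p.1]
      gcongr
    · change ‖(W p.1 : ℂ)⁻¹ * (∫ y in Iic p.1, G₂ n y p) -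
        (W p.1 : ℂ)⁻¹ * (∫ y in Iic p.1, G₂ n' y p)‖ ≤ _
      rw [← mul_sub, e2, norm_mul, hWi, ← hWWi p.1]
      gcongr
  obtain ⟨n, hn, -⟩ := hT.exists_fixedPoint 0 (edist_ne_top _ _)
  have hfix : ∀ p, T n p = n p := fun p => by rw [hn.eq]
  have hW0c : ∀ x, (W x : ℂ) ≠ 0 := fun x => by exact_mod_cast (hW0 x).ne'
  have hWcc : Continuous fun p : ℝ × ℝ => (W p.1 : ℂ) :=
    Complex.continuous_ofReal.comp (hWc.comp continuous_fst)
  refine ⟨fun x z => W x * (n (x, z)).1, fun x z => W x * (n (x, z)).2,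
    hWcc.mul (by exact continuous_fst.comp n.continuous),
    hWcc.mul (by exact continuous_snd.comp n.continuous), ⟨N * ‖n‖, fun x z => ⟨?_, ?_⟩⟩,
    fun x z => ?_, fun x z => ?_⟩
  · rw [norm_mul, hWn]
    gcongr
    · exact hWN x
    · exact (norm_fst_le _).trans (n.norm_coe_le_norm _)
  · rw [norm_mul, hWn]
    gcongr
    · exact hWN x
    · exact (norm_snd_le _).trans (n.norm_coe_le_norm _)
  · have h1 : (W x : ℂ)⁻¹ * (1 + ∫ y in Iic x, G₁ n y (x, z)) = (n (x, z)).1 :=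
      congrArg Prod.fst (hfix (x, z))
    beta_reduce
    rw [← h1, mul_inv_cancel_left₀ (hW0c x)]
    congr 2
    funext y
    simp only [G₁]; ring
  · have h1 : (W x : ℂ)⁻¹ * (∫ y in Iic x, G₂ n y (x, z)) = (n (x, z)).2 :=
      congrArg Prod.snd (hfix (x, z))
    beta_reduce
    rw [← h1, mul_inv_cancel_left₀ (hW0c x)]
    congr 1
    funext y
    simp only [G₂]; ring

theorem ofReal_kern (a b c d : ℝ → ℂ) (y : ℝ) :
    ENNReal.ofReal (kern a b c d y) = ‖a y‖ₑ + ‖b y‖ₑ + ‖c y‖ₑ + ‖d y‖ₑ := by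
  rw [kern, ENNReal.ofReal_add (by positivity) (by positivity),
    ENNReal.ofReal_add (by positivity) (by positivity),
    ENNReal.ofReal_add (by positivity) (by positivity)]
  simp only [ofReal_norm]

theorem enorm_exp_two_I_mul (z x y : ℝ) : ‖Complex.exp (2 * Complex.I * z * (x - y))‖ₑ = 1 := by
  rw [← ofReal_norm, ← Complex.ofReal_sub, norm_exp_two_I_mul, ENNReal.ofReal_one]

/-- The exponential disappears in absolute value and both components combine into one scalar
inequality of Gronwall type. The term h stays outside the integral because its size in z comes from
oscillation, which absolute values under the integral would destroy. -/
theorem enorm_volterra_le {q₁ q₂ g₁ g₂ : ℝ → ℂ} {x z : ℝ} {u v h : ℂ} (hc : IsCoeff a b c d)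
    (hq₁ : AEStronglyMeasurable q₁) (hq₂ : AEStronglyMeasurable q₂)
    (hg₁ : AEStronglyMeasurable g₁)
    (hu : u = ∫ y in Iic x, (a y * q₁ y + b y * q₂ y + g₁ y))
    (hv : v = h + ∫ y in Iic x, Complex.exp (2 * Complex.I * z * (x - y)) *
      (c y * q₁ y + d y * q₂ y + g₂ y)) :
    ‖u‖ₑ + ‖v‖ₑ ≤ ‖h‖ₑ + (∫⁻ y in Iic x, ENNReal.ofReal (kern a b c d y) * (‖q₁ y‖ₑ + ‖q₂ y‖ₑ)) +
      ∫⁻ y in Iic x, (‖g₁ y‖ₑ + ‖g₂ y‖ₑ) := by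
  have h1 : ‖u‖ₑ ≤ ∫⁻ y in Iic x, ((‖a y‖ₑ * ‖q₁ y‖ₑ + ‖b y‖ₑ * ‖q₂ y‖ₑ) + ‖g₁ y‖ₑ) := by
    rw [hu]
    refine (enorm_integral_le_lintegral_enorm _).trans (lintegral_mono fun y => ?_)
    refine (enorm_add_le _ _).trans (add_le_add ((enorm_add_le _ _).trans ?_) le_rfl)
    rw [enorm_mul, enorm_mul]
  have h2 : ‖v‖ₑ ≤ ‖h‖ₑ +
      ∫⁻ y in Iic x, ((‖c y‖ₑ * ‖q₁ y‖ₑ + ‖d y‖ₑ * ‖q₂ y‖ₑ) + ‖g₂ y‖ₑ) := by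
    rw [hv]
    refine (enorm_add_le _ _).trans (add_le_add le_rfl ?_)
    refine (enorm_integral_le_lintegral_enorm _).trans (lintegral_mono fun y => ?_)
    rw [enorm_mul, enorm_exp_two_I_mul, one_mul]
    refine (enorm_add_le _ _).trans (add_le_add ((enorm_add_le _ _).trans ?_) le_rfl)
    rw [enorm_mul, enorm_mul]
  have m1 : AEMeasurable (fun y => ‖a y‖ₑ * ‖q₁ y‖ₑ + ‖b y‖ₑ * ‖q₂ y‖ₑ + ‖g₁ y‖ₑ)
      (volume.restrict (Iic x)) :=
    ((((hc.ma.enorm.aemeasurable).mul hq₁.enorm).add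
      ((hc.mb.enorm.aemeasurable).mul hq₂.enorm)).add hg₁.enorm).restrict
  have m2 : AEMeasurable (fun y => ENNReal.ofReal (kern a b c d y) * (‖q₁ y‖ₑ + ‖q₂ y‖ₑ))
      (volume.restrict (Iic x)) :=
    ((hc.measurable_kern.ennreal_ofReal.aemeasurable).mul (hq₁.enorm.add hq₂.enorm)).restrict
  calc ‖u‖ₑ + ‖v‖ₑ ≤ _ := add_le_add h1 h2
    _ = ‖h‖ₑ + ∫⁻ y in Iic x, (((‖a y‖ₑ * ‖q₁ y‖ₑ + ‖b y‖ₑ * ‖q₂ y‖ₑ) + ‖g₁ y‖ₑ) +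
          ((‖c y‖ₑ * ‖q₁ y‖ₑ + ‖d y‖ₑ * ‖q₂ y‖ₑ) + ‖g₂ y‖ₑ)) := by
        rw [lintegral_add_left' m1]; ring
    _ ≤ ‖h‖ₑ + ∫⁻ y in Iic x, (ENNReal.ofReal (kern a b c d y) * (‖q₁ y‖ₑ + ‖q₂ y‖ₑ) +
          (‖g₁ y‖ₑ + ‖g₂ y‖ₑ)) := by
        refine add_le_add le_rfl (lintegral_mono fun y => ?_)
        beta_reduce
        rw [ofReal_kern]
        have e : (‖a y‖ₑ + ‖b y‖ₑ + ‖c y‖ₑ + ‖d y‖ₑ) * (‖q₁ y‖ₑ + ‖q₂ y‖ₑ) + (‖g₁ y‖ₑ + ‖g₂ y‖ₑ) =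
            (((‖a y‖ₑ * ‖q₁ y‖ₑ + ‖b y‖ₑ * ‖q₂ y‖ₑ) + ‖g₁ y‖ₑ) +
              ((‖c y‖ₑ * ‖q₁ y‖ₑ + ‖d y‖ₑ * ‖q₂ y‖ₑ) + ‖g₂ y‖ₑ)) +
            (‖b y‖ₑ * ‖q₁ y‖ₑ + ‖a y‖ₑ * ‖q₂ y‖ₑ + ‖d y‖ₑ * ‖q₁ y‖ₑ + ‖c y‖ₑ * ‖q₂ y‖ₑ) := by ring
        rw [e]
        exact le_self_add
    _ = _ := by rw [lintegral_add_left' m2, add_assoc]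

/-- The difference solves the system without forcing, and Gronwall with F = 0 annihilates it. Bounds
almost everywhere suffice, since they only serve to make ∫ k φ finite; the conclusion holds at every
x because the equations do. -/
theorem volterra_solution_unique (hc : IsCoeff a b c d) {z : ℝ} {m₁ m₂ n₁ n₂ : ℝ → ℂ} {M : ℝ}
    (hm₁ : AEStronglyMeasurable m₁) (hm₂ : AEStronglyMeasurable m₂)
    (hn₁ : AEStronglyMeasurable n₁) (hn₂ : AEStronglyMeasurable n₂)
    (bm : ∀ᵐ y, ‖m₁ y‖ ≤ M ∧ ‖m₂ y‖ ≤ M) (bn : ∀ᵐ y, ‖n₁ y‖ ≤ M ∧ ‖n₂ y‖ ≤ M)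
    (em₁ : ∀ x, m₁ x = 1 + ∫ y in Iic x, (a y * m₁ y + b y * m₂ y))
    (em₂ : ∀ x, m₂ x = ∫ y in Iic x, Complex.exp (2 * Complex.I * z * (x - y)) *
      (c y * m₁ y + d y * m₂ y))
    (en₁ : ∀ x, n₁ x = 1 + ∫ y in Iic x, (a y * n₁ y + b y * n₂ y))
    (en₂ : ∀ x, n₂ x = ∫ y in Iic x, Complex.exp (2 * Complex.I * z * (x - y)) *
      (c y * n₁ y + d y * n₂ y)) (x : ℝ) : m₁ x = n₁ x ∧ m₂ x = n₂ x := by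
  have hbd : ∀ {f m : ℝ → ℂ}, Integrable f → AEStronglyMeasurable m → (∀ᵐ y, ‖m y‖ ≤ M) →
      Integrable fun y => f y * m y := fun hf hm hb => hf.mul_bdd hm hb
  have hI1 := ((hbd hc.ia hm₁ (bm.mono fun _ h => h.1)).add (hbd hc.ib hm₂ (bm.mono fun _ h => h.2)))
  have hI2 := ((hbd hc.ia hn₁ (bn.mono fun _ h => h.1)).add (hbd hc.ib hn₂ (bn.mono fun _ h => h.2)))
  have hJ1 := ((hbd hc.ic hm₁ (bm.mono fun _ h => h.1)).add (hbd hc.id hm₂ (bm.mono fun _ h => h.2)))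
  have hJ2 := ((hbd hc.ic hn₁ (bn.mono fun _ h => h.1)).add (hbd hc.id hn₂ (bn.mono fun _ h => h.2)))
  have hexp : ∀ (x : ℝ) {f : ℝ → ℂ}, Integrable f →
      Integrable fun y : ℝ => Complex.exp (2 * Complex.I * z * (x - y)) * f y := fun x f hf =>
    hf.bdd_mul (c := 1) (by fun_prop) (Filter.Eventually.of_forall fun y => by
      rw [← Complex.ofReal_sub, norm_exp_two_I_mul])
  have d1 : ∀ x, m₁ x - n₁ x = ∫ y in Iic x, (a y * (m₁ y - n₁ y) + b y * (m₂ y - n₂ y) + 0) := by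
    intro x
    rw [em₁ x, en₁ x, add_sub_add_left_eq_sub, ← integral_sub (by exact hI1.restrict)
      (by exact hI2.restrict)]
    congr 1; funext y; ring
  have d2 : ∀ x : ℝ, m₂ x - n₂ x = 0 + ∫ y in Iic x, Complex.exp (2 * Complex.I * z * (x - y)) *
      (c y * (m₁ y - n₁ y) + d y * (m₂ y - n₂ y) + 0) := by
    intro x
    rw [em₂ x, en₂ x, ← integral_sub (by exact (hexp x hJ1).restrict)
      (by exact (hexp x hJ2).restrict), zero_add]
    congr 1; funext y; ring
  set φ : ℝ → ℝ≥0∞ := fun y => ‖m₁ y - n₁ y‖ₑ + ‖m₂ y - n₂ y‖ₑ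
  have hφ : ∀ x, φ x ≤ 0 + ∫⁻ y in Iic x, ENNReal.ofReal (kern a b c d y) * φ y := fun x => by
    have := enorm_volterra_le hc (hm₁.sub hn₁) (hm₂.sub hn₂)
      (aestronglyMeasurable_const (b := (0 : ℂ))) (g₂ := fun _ => 0) (d1 x) (d2 x)
    simpa using this
  have hfin : ∫⁻ y in Iic x, ENNReal.ofReal (kern a b c d y) * φ y ≠ ⊤ := by
    have hφM : ∀ᵐ y, φ y ≤ ENNReal.ofReal (4 * M) := by
      filter_upwards [bm, bn] with y h1 h2
      have h3 : 0 ≤ M := (norm_nonneg _).trans h1.1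
      calc φ y ≤ (‖m₁ y‖ₑ + ‖n₁ y‖ₑ) + (‖m₂ y‖ₑ + ‖n₂ y‖ₑ) := add_le_add enorm_sub_le enorm_sub_le
        _ = ENNReal.ofReal (‖m₁ y‖ + ‖n₁ y‖ + (‖m₂ y‖ + ‖n₂ y‖)) := by
            rw [ENNReal.ofReal_add (by positivity) (by positivity),
              ENNReal.ofReal_add (by positivity) (by positivity),
              ENNReal.ofReal_add (by positivity) (by positivity)]
            simp only [ofReal_norm]
        _ ≤ _ := ENNReal.ofReal_le_ofReal (by linarith [h1.1, h1.2, h2.1, h2.2])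
    refine ne_top_of_le_ne_top ?_ ((setLIntegral_le_lintegral (Iic x) _).trans
      (lintegral_mono_ae (hφM.mono fun y hy => mul_le_mul_right hy _)))
    rw [lintegral_mul_const' _ _ ENNReal.ofReal_ne_top]
    exact ENNReal.mul_ne_top hc.integrable_kern.lintegral_lt_top.ne ENNReal.ofReal_ne_top
  have h0 := gronwall hc.integrable_kern hc.measurable_kern (kern_nonneg a b c d) (φ := φ)
    (F := fun _ => 0) measurable_const hfin fun y _ => hφ y
  simp only [mul_zero, lintegral_zero, add_zero, nonpos_iff_eq_zero, φ, add_eq_zero,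
    enorm_eq_zero, sub_eq_zero] at h0
  exact h0

end

/-! ### Systems with forcing, their differences and their increments in z -/

/-- The pointwise sum of the sizes of two functions. -/
def vsum (p₁ p₂ : ℝ → ℝ → ℂ) (x z : ℝ) : ℝ≥0∞ := ‖p₁ x z‖ₑ + ‖p₂ x z‖ₑ

/-- The increment of `p` in its second variable. -/
def incr (δ : ℝ) (p : ℝ → ℝ → ℂ) (x z : ℝ) : ℂ := p x (z + δ) - p x z

theorem measurable_vsum {p₁ p₂ : ℝ → ℝ → ℂ} (h₁ : Measurable (Function.uncurry p₁))
    (h₂ : Measurable (Function.uncurry p₂)) : Measurable (Function.uncurry (vsum p₁ p₂)) :=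
  h₁.enorm.add h₂.enorm

theorem measurable_translate {β : Type*} [MeasurableSpace β] {p : ℝ → ℝ → β}
    (h : Measurable (Function.uncurry p)) (δ : ℝ) :
    Measurable (Function.uncurry fun x z => p x (z + δ)) :=
  h.comp (measurable_fst.prodMk (measurable_snd.add_const δ))

theorem measurable_incr {p : ℝ → ℝ → ℂ} (h : Measurable (Function.uncurry p)) (δ : ℝ) :
    Measurable (Function.uncurry (incr δ p)) :=
  (measurable_translate h δ).sub h

/-- A Volterra system in `x` with forcing terms, depending on the parameter `z`. -/
structure IsSystem (a b c d : ℝ → ℂ) (h g₁ g₂ p₁ p₂ : ℝ → ℝ → ℂ) : Prop where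
  mh : Measurable (Function.uncurry h)
  mg₁ : Measurable (Function.uncurry g₁)
  mg₂ : Measurable (Function.uncurry g₂)
  mp₁ : Measurable (Function.uncurry p₁)
  mp₂ : Measurable (Function.uncurry p₂)
  ip₁ : ∀ z, Integrable fun y => kern a b c d y * ‖p₁ y z‖
  ip₂ : ∀ z, Integrable fun y => kern a b c d y * ‖p₂ y z‖
  ig₁ : ∀ z, Integrable fun y => g₁ y z
  ig₂ : ∀ z, Integrable fun y => g₂ y z
  eq₁ : ∀ x z, p₁ x z = ∫ y in Iic x, (a y * p₁ y z + b y * p₂ y z + g₁ y z)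
  eq₂ : ∀ x z, p₂ x z = h x z + ∫ y in Iic x, Complex.exp (2 * Complex.I * z * (x - y)) *
    (c y * p₁ y z + d y * p₂ y z + g₂ y z)

/-- The constant of the Gronwall estimate. -/
def gconst (κ : ℝ) : ℝ≥0∞ := 1 + ENNReal.ofReal (2 * Real.exp (2 * κ)) * ENNReal.ofReal κ

theorem gconst_ne_top (κ : ℝ) : gconst κ ≠ ⊤ := by
  unfold gconst; finiteness

theorem gconst_mono {κ κ' : ℝ} (h : κ ≤ κ') : gconst κ ≤ gconst κ' := by
  unfold gconst; gcongr

section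

variable {a b c d : ℝ → ℂ} {h g₁ g₂ p₁ p₂ : ℝ → ℝ → ℂ}

theorem integrable_mul_of_kern {s p : ℝ → ℂ} (hs : Measurable s) (hp : Measurable p)
    (hsk : ∀ y, ‖s y‖ ≤ kern a b c d y) (hi : Integrable fun y => kern a b c d y * ‖p y‖) :
    Integrable fun y => s y * p y :=
  hi.mono' (hs.mul hp).aestronglyMeasurable (Filter.Eventually.of_forall fun y => by
    rw [norm_mul]; exact mul_le_mul_of_nonneg_right (hsk y) (norm_nonneg _))

theorem norm_le_kern (a b c d : ℝ → ℂ) (y : ℝ) : ‖a y‖ ≤ kern a b c d y ∧ ‖b y‖ ≤ kern a b c d y ∧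
    ‖c y‖ ≤ kern a b c d y ∧ ‖d y‖ ≤ kern a b c d y := by
  have := norm_nonneg (a y)
  have := norm_nonneg (b y)
  have := norm_nonneg (c y)
  have := norm_nonneg (d y)
  unfold kern
  refine ⟨?_, ?_, ?_, ?_⟩ <;> linarith

theorem integrable_exp_mul {f : ℝ → ℂ} (hf : Integrable f) (x z : ℝ) :
    Integrable fun y : ℝ => Complex.exp (2 * Complex.I * z * (x - y)) * f y :=
  hf.bdd_mul (c := 1) (by fun_prop) (Filter.Eventually.of_forall fun y => by
    rw [← Complex.ofReal_sub, norm_exp_two_I_mul])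

namespace IsSystem

variable (hs : IsSystem a b c d h g₁ g₂ p₁ p₂) (hc : IsCoeff a b c d)
include hs hc

theorem integrable₁ (z : ℝ) : Integrable fun y => a y * p₁ y z + b y * p₂ y z + g₁ y z :=
  ((integrable_mul_of_kern hc.ma hs.mp₁.of_uncurry_right (fun y => (norm_le_kern a b c d y).1)
    (hs.ip₁ z)).add (integrable_mul_of_kern hc.mb hs.mp₂.of_uncurry_right
    (fun y => (norm_le_kern a b c d y).2.1) (hs.ip₂ z))).add (hs.ig₁ z)

theorem integrable₂ (z : ℝ) : Integrable fun y => c y * p₁ y z + d y * p₂ y z + g₂ y z :=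
  ((integrable_mul_of_kern hc.mc hs.mp₁.of_uncurry_right (fun y => (norm_le_kern a b c d y).2.2.1)
    (hs.ip₁ z)).add (integrable_mul_of_kern hc.md hs.mp₂.of_uncurry_right
    (fun y => (norm_le_kern a b c d y).2.2.2) (hs.ip₂ z))).add (hs.ig₂ z)

theorem lintegral_kern_ne_top (z : ℝ) :
    ∫⁻ y, ENNReal.ofReal (kern a b c d y) * vsum p₁ p₂ y z ≠ ⊤ := by
  have h1 := (hs.ip₁ z).lintegral_lt_top.ne
  have h2 := (hs.ip₂ z).lintegral_lt_top.ne
  simp only [ENNReal.ofReal_mul (kern_nonneg a b c d _), ofReal_norm] at h1 h2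
  simp only [vsum, mul_add]
  rw [lintegral_add_left]
  · exact ENNReal.add_ne_top.2 ⟨h1, h2⟩
  · exact hc.measurable_kern.ennreal_ofReal.mul hs.mp₁.of_uncurry_right.enorm

/-- `eLpNorm_gronwall` for a system. The coefficients enter the constant only through κ, which makes
the estimate uniform on bounded sets of potentials. -/
theorem eLpNorm_le {κ : ℝ} (hκ : ∫ y, kern a b c d y ≤ κ) {x₀ : ℝ} {H B : ℝ≥0∞}
    (hH₀ : eLpNorm (h x₀) 2 ≤ H) (hH : ∀ᵐ y, y ≤ x₀ → eLpNorm (h y) 2 ≤ H)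
    (hB : ∫⁻ y in Iic x₀, eLpNorm (vsum g₁ g₂ y) 2 ≤ B) :
    eLpNorm (vsum p₁ p₂ x₀) 2 ≤ gconst κ * (H + B) := by
  refine le_trans ?_ (mul_le_mul_left (gconst_mono hκ) _)
  refine eLpNorm_gronwall hc.integrable_kern hc.measurable_kern (kern_nonneg a b c d)
    (h := fun x z => ‖h x z‖ₑ) (g := vsum g₁ g₂) hs.mh.enorm (measurable_vsum hs.mg₁ hs.mg₂)
    (fun z => ne_top_of_le_ne_top (hs.lintegral_kern_ne_top hc z) (setLIntegral_le_lintegral _ _))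
    (fun z x _ => enorm_volterra_le hc hs.mp₁.of_uncurry_right.aestronglyMeasurable
      hs.mp₂.of_uncurry_right.aestronglyMeasurable hs.mg₁.of_uncurry_right.aestronglyMeasurable
      (hs.eq₁ x z) (hs.eq₂ x z)) ?_ ?_ hB
  · rwa [eLpNorm_enorm]
  · simpa only [eLpNorm_enorm] using hH

/-- Since a p - a' p' = a (p - p') + (a - a') p', the difference of two solutions solves the first
system, the terms (a - a') p' joining the forcing. Lipschitz estimates thereby follow from bounds
for a single system. -/
theorem sub {a' b' c' d' : ℝ → ℂ} {h' g₁' g₂' p₁' p₂' : ℝ → ℝ → ℂ}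
    (hs' : IsSystem a' b' c' d' h' g₁' g₂' p₁' p₂') (hc' : IsCoeff a' b' c' d')
    (i₁ : ∀ z, Integrable fun y => kern a b c d y * ‖p₁' y z‖)
    (i₂ : ∀ z, Integrable fun y => kern a b c d y * ‖p₂' y z‖) :
    IsSystem a b c d (fun x z => h x z - h' x z)
      (fun y z => g₁ y z - g₁' y z + ((a y - a' y) * p₁' y z + (b y - b' y) * p₂' y z))
      (fun y z => g₂ y z - g₂' y z + ((c y - c' y) * p₁' y z + (d y - d' y) * p₂' y z))
      (fun x z => p₁ x z - p₁' x z) (fun x z => p₂ x z - p₂' x z) := by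
  have hsub : ∀ {q q' : ℝ → ℝ → ℂ}, Measurable (Function.uncurry q) →
      Measurable (Function.uncurry q') →
      (∀ z, Integrable fun y => kern a b c d y * ‖q y z‖) →
      (∀ z, Integrable fun y => kern a b c d y * ‖q' y z‖) →
      ∀ z, Integrable fun y => kern a b c d y * ‖q y z - q' y z‖ := fun hq hq' h1 h2 z =>
    ((h1 z).add (h2 z)).mono' (hc.measurable_kern.mul
      (hq.of_uncurry_right.sub hq'.of_uncurry_right).norm).aestronglyMeasurable
      (Filter.Eventually.of_forall fun y => by
        have h0 := kern_nonneg a b c d y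
        rw [Real.norm_of_nonneg (by positivity), Pi.add_apply, ← mul_add]
        exact mul_le_mul_of_nonneg_left (norm_sub_le _ _) h0)
  have hmul : ∀ {s : ℝ → ℂ} {q : ℝ → ℝ → ℂ}, Measurable s → Measurable (Function.uncurry q) →
      Measurable (Function.uncurry fun y z => s y * q y z) := fun h1 h2 =>
    (h1.comp measurable_fst).mul h2
  have hd : ∀ {s s' : ℝ → ℂ} {q : ℝ → ℝ → ℂ}, Measurable s → Measurable s' →
      Measurable (Function.uncurry q) →
      (∀ y, ‖s y‖ ≤ kern a b c d y) → (∀ y, ‖s' y‖ ≤ kern a' b' c' d' y) →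
      (∀ z, Integrable fun y => kern a b c d y * ‖q y z‖) →
      (∀ z, Integrable fun y => kern a' b' c' d' y * ‖q y z‖) →
      ∀ z, Integrable fun y => (s y - s' y) * q y z := fun hs hs' hq h1 h2 h3 h4 z => by
    have := (integrable_mul_of_kern hs hq.of_uncurry_right h1 (h3 z)).sub
      (integrable_mul_of_kern hs' hq.of_uncurry_right h2 (h4 z))
    simp only [sub_mul]
    exact this
  have k := norm_le_kern a b c d
  have k' := norm_le_kern a' b' c' d'
  refine ⟨hs.mh.sub hs'.mh, (hs.mg₁.sub hs'.mg₁).add ((hmul (hc.ma.sub hc'.ma) hs'.mp₁).add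
      (hmul (hc.mb.sub hc'.mb) hs'.mp₂)), (hs.mg₂.sub hs'.mg₂).add
      ((hmul (hc.mc.sub hc'.mc) hs'.mp₁).add (hmul (hc.md.sub hc'.md) hs'.mp₂)),
    hs.mp₁.sub hs'.mp₁, hs.mp₂.sub hs'.mp₂, hsub hs.mp₁ hs'.mp₁ hs.ip₁ i₁,
    hsub hs.mp₂ hs'.mp₂ hs.ip₂ i₂, fun z => ?_, fun z => ?_, fun x z => ?_, fun x z => ?_⟩
  · exact ((hs.ig₁ z).sub (hs'.ig₁ z)).add
      ((hd hc.ma hc'.ma hs'.mp₁ (fun y => (k y).1) (fun y => (k' y).1) i₁ hs'.ip₁ z).add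
        (hd hc.mb hc'.mb hs'.mp₂ (fun y => (k y).2.1) (fun y => (k' y).2.1) i₂ hs'.ip₂ z))
  · exact ((hs.ig₂ z).sub (hs'.ig₂ z)).add
      ((hd hc.mc hc'.mc hs'.mp₁ (fun y => (k y).2.2.1) (fun y => (k' y).2.2.1) i₁ hs'.ip₁ z).add
        (hd hc.md hc'.md hs'.mp₂ (fun y => (k y).2.2.2) (fun y => (k' y).2.2.2) i₂ hs'.ip₂ z))
  · rw [hs.eq₁ x z, hs'.eq₁ x z, ← integral_sub (hs.integrable₁ hc z).restrict
      (hs'.integrable₁ hc' z).restrict]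
    congr 1; funext y; ring
  · rw [hs.eq₂ x z, hs'.eq₂ x z, add_sub_add_comm,
      ← integral_sub (integrable_exp_mul (hs.integrable₂ hc z) x z).restrict
      (integrable_exp_mul (hs'.integrable₂ hc' z) x z).restrict]
    congr 2; funext y; ring

end IsSystem

theorem enorm_exp_sub_exp_le (z δ t : ℝ) :
    ‖Complex.exp (2 * Complex.I * (z + δ : ℝ) * t) - Complex.exp (2 * Complex.I * z * t)‖ₑ ≤
      2 * ‖δ‖ₑ * ‖t‖ₑ := by
  have e : Complex.exp (2 * Complex.I * (z + δ : ℝ) * t) - Complex.exp (2 * Complex.I * z * t) =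
      Complex.exp (2 * Complex.I * z * t) * (Complex.exp (Complex.I * (2 * δ * t : ℝ)) - 1) := by
    rw [mul_sub, mul_one, ← Complex.exp_add]
    congr 2
    push_cast
    ring
  rw [e, enorm_mul, ← ofReal_norm, norm_exp_two_I_mul, ENNReal.ofReal_one, one_mul, ← ofReal_norm]
  calc _ ≤ ENNReal.ofReal ‖2 * δ * t‖ :=
        ENNReal.ofReal_le_ofReal (Real.norm_exp_I_mul_ofReal_sub_one_le)
    _ = _ := by
        rw [ofReal_norm, enorm_mul, enorm_mul]
        congr 2
        simp [Real.enorm_eq_ofReal]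

/-- The forcing term in the system of the increments of a solution. -/
def incrForcing (a b c d : ℝ → ℂ) (g₁ g₂ p₁ p₂ : ℝ → ℝ → ℂ) (δ y z : ℝ) : ℝ≥0∞ :=
  vsum (incr δ g₁) (incr δ g₂) y z + 2 * ‖δ‖ₑ * ‖y‖ₑ *
    (ENNReal.ofReal (kern a b c d y) * vsum p₁ p₂ y (z + δ) + ‖g₂ y (z + δ)‖ₑ)

/-- The increment solves the same system, the variation of the exponential contributing one more
forcing term. For y ≤ x ≤ 0 this variation is at most 2|δ|(x - y) ≤ 2|δ||y|; restricting to x ≤ 0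
makes the bound independent of x. -/
theorem IsSystem.eLpNorm_incr_le (hs : IsSystem a b c d h g₁ g₂ p₁ p₂) (hc : IsCoeff a b c d)
    {κ : ℝ} (hκ : ∫ y, kern a b c d y ≤ κ) {x₀ : ℝ} (hx₀ : x₀ ≤ 0) {δ : ℝ} {H B : ℝ≥0∞}
    (hH : ∀ y ≤ x₀, eLpNorm (incr δ h y) 2 ≤ H)
    (hB : ∫⁻ y in Iic x₀, eLpNorm (incrForcing a b c d g₁ g₂ p₁ p₂ δ y) 2 ≤ B) :
    eLpNorm (vsum (incr δ p₁) (incr δ p₂) x₀) 2 ≤ gconst κ * (H + B) := by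
  refine le_trans ?_ (mul_le_mul_left (gconst_mono hκ) _)
  have mf1 : Measurable (Function.uncurry fun y z => 2 * ‖δ‖ₑ * ‖y‖ₑ *
    (ENNReal.ofReal (kern a b c d y) * vsum p₁ p₂ y (z + δ) + ‖g₂ y (z + δ)‖ₑ)) :=
    ((measurable_fst.enorm).const_mul _).mul
      (((hc.measurable_kern.ennreal_ofReal.comp measurable_fst).mul
        (measurable_translate (measurable_vsum hs.mp₁ hs.mp₂) δ)).add
        (measurable_translate hs.mg₂ δ).enorm)
  have mf : Measurable (Function.uncurry (incrForcing a b c d g₁ g₂ p₁ p₂ δ)) :=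
    (measurable_vsum (measurable_incr hs.mg₁ δ) (measurable_incr hs.mg₂ δ)).add mf1
  refine eLpNorm_gronwall hc.integrable_kern hc.measurable_kern (kern_nonneg a b c d)
    (h := fun x z => ‖incr δ h x z‖ₑ) (g := incrForcing a b c d g₁ g₂ p₁ p₂ δ)
    (measurable_incr hs.mh δ).enorm mf (fun z => ?_) (fun z x hx => ?_) ?_ ?_ hB
  · refine ne_top_of_le_ne_top (ENNReal.add_ne_top.2 ⟨hs.lintegral_kern_ne_top hc (z + δ),
      hs.lintegral_kern_ne_top hc z⟩) ((setLIntegral_le_lintegral _ _).trans ?_)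
    rw [← lintegral_add_left]
    · refine lintegral_mono fun y => ?_
      beta_reduce
      rw [← mul_add]
      gcongr
      calc vsum (incr δ p₁) (incr δ p₂) y z ≤ (‖p₁ y (z + δ)‖ₑ + ‖p₁ y z‖ₑ) +
            (‖p₂ y (z + δ)‖ₑ + ‖p₂ y z‖ₑ) := add_le_add enorm_sub_le enorm_sub_le
        _ = _ := by simp only [vsum]; ring
    · exact hc.measurable_kern.ennreal_ofReal.mul
        (measurable_vsum hs.mp₁ hs.mp₂).of_uncurry_right
  · have e1 : incr δ p₁ x z = ∫ y in Iic x, (a y * incr δ p₁ y z + b y * incr δ p₂ y z +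
        incr δ g₁ y z) := by
      rw [incr, hs.eq₁ x (z + δ), hs.eq₁ x z, ← integral_sub (hs.integrable₁ hc _).restrict
        (hs.integrable₁ hc _).restrict]
      congr 1; funext y; simp only [incr]; ring
    set E : ℝ → ℝ → ℂ := fun z y => Complex.exp (2 * Complex.I * z * (x - y))
    -- `R` carries the variation of the exponential. It enters `enorm_volterra_le` in the place of
    -- h, and its bound `hR` then becomes the second part of `incrForcing`.
    set R := ∫ y in Iic x, (E (z + δ) y - E z y) *
      (c y * p₁ y (z + δ) + d y * p₂ y (z + δ) + g₂ y (z + δ))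
    have iR : Integrable fun y => (E (z + δ) y - E z y) *
        (c y * p₁ y (z + δ) + d y * p₂ y (z + δ) + g₂ y (z + δ)) := by
      simp only [sub_mul]
      exact (integrable_exp_mul (hs.integrable₂ hc (z + δ)) x (z + δ)).sub
        (integrable_exp_mul (hs.integrable₂ hc (z + δ)) x z)
    have e2 : incr δ p₂ x z = (incr δ h x z + R) + ∫ y in Iic x, E z y *
        (c y * incr δ p₁ y z + d y * incr δ p₂ y z + incr δ g₂ y z) := by
      have i3 : Integrable fun y => E z y *
          (c y * incr δ p₁ y z + d y * incr δ p₂ y z + incr δ g₂ y z) := by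
        have := (integrable_exp_mul (hs.integrable₂ hc (z + δ)) x z).sub
          (integrable_exp_mul (hs.integrable₂ hc z) x z)
        refine this.congr (Filter.Eventually.of_forall fun y => ?_)
        simp only [Pi.sub_apply, incr, E]; ring
      rw [incr, hs.eq₂ x (z + δ), hs.eq₂ x z, add_sub_add_comm,
        ← integral_sub (integrable_exp_mul (hs.integrable₂ hc _) x _).restrict
        (integrable_exp_mul (hs.integrable₂ hc _) x _).restrict, add_assoc,
        ← integral_add iR.restrict i3.restrict]
      congr 2; funext y; simp only [incr, E]; ring
    have hm := enorm_volterra_le hc (measurable_incr hs.mp₁ δ).of_uncurry_right.aestronglyMeasurable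
      (measurable_incr hs.mp₂ δ).of_uncurry_right.aestronglyMeasurable
      (measurable_incr hs.mg₁ δ).of_uncurry_right.aestronglyMeasurable e1 e2
    have hR : ‖R‖ₑ ≤ ∫⁻ y in Iic x, 2 * ‖δ‖ₑ * ‖y‖ₑ *
        (ENNReal.ofReal (kern a b c d y) * vsum p₁ p₂ y (z + δ) + ‖g₂ y (z + δ)‖ₑ) := by
      refine (enorm_integral_le_lintegral_enorm _).trans
        (setLIntegral_mono' measurableSet_Iic fun y hy => ?_)
      rw [enorm_mul]
      gcongr ?_ * ?_
      · have h1 := enorm_exp_sub_exp_le z δ (x - y)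
        simp only [Complex.ofReal_sub] at h1
        refine h1.trans ?_
        gcongr 2 * ‖δ‖ₑ * ?_
        rw [enorm_le_iff_norm_le, Real.norm_eq_abs, Real.norm_eq_abs, abs_of_nonneg
          (sub_nonneg.2 hy), abs_of_nonpos (le_trans hy (hx.trans hx₀))]
        linarith [hx.trans hx₀]
      · refine (enorm_add_le _ _).trans (add_le_add ((enorm_add_le _ _).trans ?_) le_rfl)
        rw [enorm_mul, enorm_mul, vsum, mul_add]
        have hle : ∀ {s : ℂ}, ‖s‖ ≤ kern a b c d y → ‖s‖ₑ ≤ ENNReal.ofReal (kern a b c d y) :=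
          fun hs => by rw [← ofReal_norm]; exact ENNReal.ofReal_le_ofReal hs
        exact add_le_add (mul_le_mul_left (hle (norm_le_kern a b c d y).2.2.1) _)
          (mul_le_mul_left (hle (norm_le_kern a b c d y).2.2.2) _)
    refine hm.trans ?_
    calc _ ≤ (‖incr δ h x z‖ₑ + ∫⁻ y in Iic x, 2 * ‖δ‖ₑ * ‖y‖ₑ *
          (ENNReal.ofReal (kern a b c d y) * vsum p₁ p₂ y (z + δ) + ‖g₂ y (z + δ)‖ₑ)) +
          (∫⁻ y in Iic x, ENNReal.ofReal (kern a b c d y) * vsum (incr δ p₁) (incr δ p₂) y z) +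
          ∫⁻ y in Iic x, vsum (incr δ g₁) (incr δ g₂) y z := by
          gcongr
          · exact (enorm_add_le _ _).trans (add_le_add le_rfl hR)
          · exact le_rfl
          · exact le_rfl
      _ = _ := by
          have : ∫⁻ y in Iic x, incrForcing a b c d g₁ g₂ p₁ p₂ δ y z =
              (∫⁻ y in Iic x, vsum (incr δ g₁) (incr δ g₂) y z) +
              ∫⁻ y in Iic x, 2 * ‖δ‖ₑ * ‖y‖ₑ *
                (ENNReal.ofReal (kern a b c d y) * vsum p₁ p₂ y (z + δ) + ‖g₂ y (z + δ)‖ₑ) :=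
            lintegral_add_left (measurable_vsum (measurable_incr hs.mg₁ δ)
              (measurable_incr hs.mg₂ δ)).of_uncurry_right _
          rw [this]; ring
  · rw [eLpNorm_enorm]; exact hH x₀ le_rfl
  · refine Filter.Eventually.of_forall fun y hy => ?_
    rw [eLpNorm_enorm]; exact hH y hy

end

/-! ### The weight ⟨x⟩ and the estimates on the negative half-line -/

/-- The inverse of the weight `⟨x⟩`. -/
def rho (x : ℝ) : ℝ≥0∞ := ENNReal.ofReal (√(1 + x ^ 2))⁻¹

/-- The `L²` norm with the weight `⟨x⟩`. -/
def norm21 (f : ℝ → ℂ) : ℝ≥0∞ := eLpNorm (weighted 1 f) 2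

theorem one_le_sqrt_one_add_sq (x : ℝ) : 1 ≤ √(1 + x ^ 2) := by
  rw [Real.one_le_sqrt]; nlinarith [sq_nonneg x]

theorem abs_le_sqrt_one_add_sq (x : ℝ) : |x| ≤ √(1 + x ^ 2) :=
  Real.abs_le_sqrt (by linarith)

theorem enorm_weighted_one (f : ℝ → ℂ) (x : ℝ) :
    ‖weighted 1 f x‖ₑ = ENNReal.ofReal √(1 + x ^ 2) * ‖f x‖ₑ := by
  rw [weighted, Real.rpow_one, enorm_smul, Real.enorm_eq_ofReal (Real.sqrt_nonneg _)]

theorem rho_le_one (x : ℝ) : rho x ≤ 1 := by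
  rw [rho, ← ENNReal.ofReal_one]
  exact ENNReal.ofReal_le_ofReal (inv_le_one_of_one_le₀ (one_le_sqrt_one_add_sq x))

theorem enorm_mul_rho_le_one (x : ℝ) : ‖x‖ₑ * rho x ≤ 1 := by
  have h0 : 0 < √(1 + x ^ 2) := zero_lt_one.trans_le (one_le_sqrt_one_add_sq x)
  rw [rho, Real.enorm_eq_ofReal_abs, ← ENNReal.ofReal_mul (abs_nonneg x), ← ENNReal.ofReal_one]
  refine ENNReal.ofReal_le_ofReal ?_
  rw [← div_eq_mul_inv, div_le_one h0]
  exact abs_le_sqrt_one_add_sq x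

theorem rho_mul_ofReal (x : ℝ) : rho x * ENNReal.ofReal √(1 + x ^ 2) = 1 := by
  have h0 : 0 < √(1 + x ^ 2) := zero_lt_one.trans_le (one_le_sqrt_one_add_sq x)
  rw [rho, ← ENNReal.ofReal_mul (by positivity), inv_mul_cancel₀ h0.ne', ENNReal.ofReal_one]

theorem rho_le_rho {x y : ℝ} (hyx : y ≤ x) (hx : x ≤ 0) : rho y ≤ rho x := by
  refine ENNReal.ofReal_le_ofReal (inv_anti₀ (zero_lt_one.trans_le (one_le_sqrt_one_add_sq x)) ?_)
  refine Real.sqrt_le_sqrt ?_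
  nlinarith

theorem measurable_rho : Measurable rho := by
  unfold rho; fun_prop

theorem enorm_le_weighted (f : ℝ → ℂ) (x : ℝ) : ‖f x‖ₑ ≤ ‖weighted 1 f x‖ₑ := by
  rw [enorm_weighted_one]
  refine le_mul_of_one_le_left' ?_
  rw [← ENNReal.ofReal_one]
  exact ENNReal.ofReal_le_ofReal (one_le_sqrt_one_add_sq x)

theorem eLpNorm_le_norm21 (f : ℝ → ℂ) : eLpNorm f 2 ≤ norm21 f :=
  eLpNorm_mono_enorm (enorm_le_weighted f)

/-- For y ≤ x ≤ 0 one has ⟨x⟩ ≤ ⟨y⟩, so the weight on the tail can be traded for the factor 1/⟨x⟩.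
-/
theorem eLpNorm_restrict_le_norm21 {f : ℝ → ℂ} {x : ℝ} (hx : x ≤ 0) :
    eLpNorm f 2 (volume.restrict (Iic x)) ≤ norm21 f * rho x := by
  have h : ∀ᵐ y ∂(volume.restrict (Iic x)),
      ‖f y‖ ≤ (√(1 + x ^ 2))⁻¹ * ‖weighted 1 f y‖ := by
    refine (ae_restrict_iff' measurableSet_Iic).2 (Filter.Eventually.of_forall fun y hy => ?_)
    have h0 : 0 < √(1 + x ^ 2) := zero_lt_one.trans_le (one_le_sqrt_one_add_sq x)
    rw [weighted, Real.rpow_one, norm_smul, Real.norm_of_nonneg (Real.sqrt_nonneg _), ← mul_assoc]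
    refine le_mul_of_one_le_left (norm_nonneg _) ?_
    rw [← div_eq_inv_mul, one_le_div h0]
    refine Real.sqrt_le_sqrt ?_
    have : y ≤ x := hy
    nlinarith
  refine (eLpNorm_le_mul_eLpNorm_of_ae_le_mul h 2).trans ?_
  rw [mul_comm, rho, norm21]
  gcongr
  exact Measure.restrict_le_self

/-- The `L²` norm of `1 / ⟨x⟩`. -/
def rhoNorm : ℝ≥0∞ := eLpNorm rho 2

theorem rhoNorm_ne_top : rhoNorm ≠ ⊤ := by
  rw [rhoNorm, eLpNorm_two_ennreal]
  refine ENNReal.rpow_ne_top_of_nonneg (by norm_num) ?_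
  have e : ∀ x : ℝ, rho x ^ (2 : ℝ) = ENNReal.ofReal (1 + x ^ 2)⁻¹ := fun x => by
    have h0 : (0 : ℝ) ≤ 1 + x ^ 2 := by positivity
    rw [rho, ENNReal.ofReal_rpow_of_nonneg (by positivity) zero_le_two, Real.rpow_two, inv_pow,
      Real.sq_sqrt h0]
  simp only [e]
  exact integrable_inv_one_add_sq.lintegral_lt_top.ne

/-- Cauchy–Schwarz for the product of 1/⟨x⟩, which is square integrable, and ⟨x⟩ f. -/
theorem lintegral_enorm_le_norm21 {f : ℝ → ℂ} (hf : AEStronglyMeasurable f) :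
    ∫⁻ x, ‖f x‖ₑ ≤ rhoNorm * norm21 f := by
  have hw : AEMeasurable (fun x => ‖weighted 1 f x‖ₑ) := by
    simp only [enorm_weighted_one]
    exact (by fun_prop : Measurable fun x : ℝ => ENNReal.ofReal √(1 + x ^ 2)).aemeasurable.mul
      hf.enorm
  calc ∫⁻ x, ‖f x‖ₑ = ∫⁻ x, (rho * fun x => ‖weighted 1 f x‖ₑ) x := by
        refine lintegral_congr fun x => ?_
        rw [Pi.mul_apply, enorm_weighted_one, ← mul_assoc, rho_mul_ofReal, one_mul]
    _ ≤ _ := by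
        refine (ENNReal.lintegral_mul_le_Lp_mul_Lq volume Real.HolderConjugate.two_two
          measurable_rho.aemeasurable hw).trans ?_
        rw [rhoNorm, norm21, ← eLpNorm_enorm (weighted 1 f), eLpNorm_two_ennreal,
          eLpNorm_two_ennreal]

theorem integrable_of_norm21 {f : ℝ → ℂ} (hf : AEStronglyMeasurable f) (h : norm21 f ≠ ⊤) :
    Integrable f :=
  ⟨hf, (lintegral_enorm_le_norm21 hf).trans_lt (ENNReal.mul_lt_top rhoNorm_ne_top.lt_top h.lt_top)⟩

theorem memLp_of_norm21 {f : ℝ → ℂ} (hf : AEStronglyMeasurable f) (h : norm21 f ≠ ⊤) :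
    MemLp f 2 := ⟨hf, (eLpNorm_le_norm21 f).trans_lt h.lt_top⟩

theorem measurable_oscInt {f : ℝ → ℂ} (hf : Integrable f) (hm : Measurable f) :
    Measurable (Function.uncurry (oscInt f)) := by
  refine Continuous.measurable ?_
  refine continuous_volterra_integral (G := fun y p =>
    Complex.exp (2 * Complex.I * p.2 * (p.1 - y)) * f y) (fun y => by fun_prop)
    (fun p => ?_) hf.norm (fun y p => ?_)
  · exact ((by fun_prop : Measurable fun y : ℝ =>
      Complex.exp (2 * Complex.I * p.2 * (p.1 - y))).mul hm).aestronglyMeasurable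
  · rw [norm_mul, ← Complex.ofReal_sub, norm_exp_two_I_mul, one_mul]

/-- With e^{2iz(x-y)} factored out, what remains does not depend on z, so the increment of an
oscillatory integral is again one. The factor equal to 1 is kept as an exponential at frequency 0 so
that `enorm_exp_sub_exp_le` applies. -/
theorem exp_add_mul_sub (z δ x y : ℝ) (w : ℂ) :
    Complex.exp (2 * Complex.I * (z + δ : ℝ) * (x - y)) * w -
      Complex.exp (2 * Complex.I * z * (x - y)) * w =
    Complex.exp (2 * Complex.I * z * (x - y)) *
      ((Complex.exp (2 * Complex.I * (0 + δ : ℝ) * (x - y : ℝ)) -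
        Complex.exp (2 * Complex.I * (0 : ℝ) * (x - y : ℝ))) * w) := by
  have e1 : Complex.exp (2 * Complex.I * (z + δ : ℝ) * (x - y)) =
      Complex.exp (2 * Complex.I * z * (x - y)) *
        Complex.exp (2 * Complex.I * (0 + δ : ℝ) * (x - y : ℝ)) := by
    rw [← Complex.exp_add]; congr 1; push_cast; ring
  have e2 : Complex.exp (2 * Complex.I * (0 : ℝ) * (x - y : ℝ)) = 1 := by
    rw [← Complex.exp_zero]; congr 1; push_cast; ring
  rw [e1, e2]; ring

/-- The density of the increment of an oscillatory integral. -/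
def incrDensity (f : ℝ → ℂ) (δ x : ℝ) : ℝ → ℂ := indicator (Iic x) fun y =>
  (Complex.exp (2 * Complex.I * (0 + δ : ℝ) * (x - y : ℝ)) -
    Complex.exp (2 * Complex.I * (0 : ℝ) * (x - y : ℝ))) * f y

theorem measurable_incrDensity {f : ℝ → ℂ} (hm : Measurable f) (δ x : ℝ) :
    Measurable (incrDensity f δ x) :=
  Measurable.indicator (((by fun_prop : Measurable fun y : ℝ =>
    Complex.exp (2 * Complex.I * (0 + δ : ℝ) * (x - y : ℝ))).sub
    (by fun_prop : Measurable fun y : ℝ =>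
      Complex.exp (2 * Complex.I * (0 : ℝ) * (x - y : ℝ)))).mul hm) measurableSet_Iic

theorem norm_incrDensity_le (f : ℝ → ℂ) (δ : ℝ) {x : ℝ} (hx : x ≤ 0) (y : ℝ) :
    ‖incrDensity f δ x y‖ ≤ (2 * ‖δ‖) * ‖weighted 1 f y‖ := by
  by_cases hy : y ∈ Iic x
  · have h1 := enorm_exp_sub_exp_le 0 δ (x - y)
    rw [← ofReal_norm, ← ofReal_norm, ← ofReal_norm, ← ENNReal.ofReal_ofNat 2,
      ← ENNReal.ofReal_mul zero_le_two, ← ENNReal.ofReal_mul (by positivity),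
      ENNReal.ofReal_le_ofReal_iff (by positivity)] at h1
    rw [incrDensity, indicator_of_mem hy, norm_mul, weighted, Real.rpow_one, norm_smul,
      Real.norm_of_nonneg (Real.sqrt_nonneg _), ← mul_assoc]
    refine mul_le_mul_of_nonneg_right (h1.trans ?_) (norm_nonneg _)
    refine mul_le_mul_of_nonneg_left (le_trans ?_ (abs_le_sqrt_one_add_sq y)) (by positivity)
    rw [Real.norm_eq_abs, abs_of_nonneg (sub_nonneg.2 hy), abs_of_nonpos (le_trans hy hx)]
    linarith
  · rw [incrDensity, indicator_of_notMem hy, norm_zero]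
    positivity

theorem norm_incrDensity_le_two (f : ℝ → ℂ) (δ x y : ℝ) :
    ‖incrDensity f δ x y‖ ≤ ‖(2 : ℂ) * f y‖ := by
  by_cases hy : y ∈ Iic x
  · rw [incrDensity, indicator_of_mem hy, norm_mul, norm_mul]
    refine mul_le_mul_of_nonneg_right ((norm_sub_le _ _).trans ?_) (norm_nonneg _)
    rw [norm_exp_two_I_mul, norm_exp_two_I_mul]
    norm_num
  · rw [incrDensity, indicator_of_notMem hy, norm_zero]
    positivity

theorem incr_oscInt_eq {f : ℝ → ℂ} (hi : Integrable f) (δ x : ℝ) : incr δ (oscInt f) x =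
    fun z : ℝ => ∫ y : ℝ, Complex.exp (2 * Complex.I * z * (x - y)) * incrDensity f δ x y := by
  funext z
  rw [incr, oscInt, oscInt, ← integral_sub (integrable_exp_mul hi _ _).restrict
    (integrable_exp_mul hi _ _).restrict, ← integral_indicator measurableSet_Iic]
  congr 1
  funext y
  by_cases hy : y ∈ Iic x
  · rw [incrDensity, indicator_of_mem hy, indicator_of_mem hy, exp_add_mul_sub]
  · rw [incrDensity, indicator_of_notMem hy, indicator_of_notMem hy, mul_zero]

/-- Plancherel for the density `incrDensity`: on x ≤ 0 it is at most 2|δ|⟨y⟩|f(y)|, whence the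
weighted norm, while the crude bound 2|f(y)| provides its integrability. -/
theorem eLpNorm_incr_oscInt_le {f : ℝ → ℂ} (hm : Measurable f) (hf : norm21 f ≠ ⊤) (δ : ℝ) {x : ℝ}
    (hx : x ≤ 0) : eLpNorm (incr δ (oscInt f) x) 2 ≤ 4 * norm21 f * ‖δ‖ₑ := by
  have hi := integrable_of_norm21 hm.aestronglyMeasurable hf
  have hk2 : eLpNorm (incrDensity f δ x) 2 ≤ 2 * ‖δ‖ₑ * norm21 f := by
    refine (eLpNorm_le_mul_eLpNorm_of_ae_le_mul
      (Filter.Eventually.of_forall (norm_incrDensity_le f δ hx)) 2).trans ?_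
    rw [ENNReal.ofReal_mul zero_le_two, ENNReal.ofReal_ofNat, ofReal_norm, norm21]
  have hkm := (measurable_incrDensity hm δ x).aestronglyMeasurable (μ := volume)
  have hki : Integrable (incrDensity f δ x) := (hi.const_mul 2).mono hkm
    (Filter.Eventually.of_forall (norm_incrDensity_le_two f δ x))
  have hkL : MemLp (incrDensity f δ x) 2 := ⟨hkm, hk2.trans_lt
    (ENNReal.mul_lt_top (ENNReal.mul_lt_top (by norm_num) enorm_lt_top) hf.lt_top)⟩
  rw [incr_oscInt_eq hi]
  refine (eLpNorm_oscillatory_le hki hkL x).trans ((mul_le_mul_right hk2 2).trans_eq ?_)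
  ring

theorem eLpNorm_translate {β : Type*} [TopologicalSpace β] [ContinuousENorm β] {g : ℝ → β}
    (hg : AEStronglyMeasurable g) (δ : ℝ) :
    eLpNorm (fun z => g (z + δ)) 2 = eLpNorm g 2 :=
  eLpNorm_comp_measurePreserving hg (measurePreserving_add_right volume δ)

theorem lintegral_ofReal_kern {a b c d : ℝ → ℂ} (hc : IsCoeff a b c d) {κ : ℝ}
    (hκ : ∫ y, kern a b c d y ≤ κ) :
    ∫⁻ y, ENNReal.ofReal (kern a b c d y) ≤ ENNReal.ofReal κ := by
  rw [← ofReal_integral_eq_lintegral_ofReal hc.integrable_kern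
    (Filter.Eventually.of_forall (kern_nonneg a b c d))]
  exact ENNReal.ofReal_le_ofReal hκ

section

variable {a b c d : ℝ → ℂ} {f : ℝ → ℂ} {h g₁ g₂ p₁ p₂ : ℝ → ℝ → ℂ} {κ : ℝ} {F Γ M : ℝ≥0∞}
  {γ : ℝ → ℝ≥0∞}

/-- The weighted `L²` estimate for solutions of a Volterra system whose forcing is an oscillatory
integral of a function in a weighted `L²` space. -/
theorem IsSystem.eLpNorm_le_rho (hs : IsSystem a b c d (oscInt f) g₁ g₂ p₁ p₂)
    (hc : IsCoeff a b c d) (hκ : ∫ y, kern a b c d y ≤ κ) (hm : Measurable f) (hf : norm21 f ≠ ⊤)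
    (hF : norm21 f ≤ F) (hγm : Measurable γ) (hγ : ∫⁻ y, γ y ≤ Γ)
    (hg : ∀ y ≤ 0, eLpNorm (vsum g₁ g₂ y) 2 ≤ γ y * rho y) {x : ℝ} (hx : x ≤ 0) :
    eLpNorm (vsum p₁ p₂ x) 2 ≤ gconst κ * (2 * F + Γ) * rho x := by
  have hi := integrable_of_norm21 hm.aestronglyMeasurable hf
  have h2 := memLp_of_norm21 hm.aestronglyMeasurable hf
  have hH : ∀ y ≤ x, eLpNorm (oscInt f y) 2 ≤ 2 * F * rho x := fun y hy => by
    refine (eLpNorm_oscInt_le hi h2 y).trans ?_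
    rw [mul_assoc]
    refine mul_le_mul_right ((eLpNorm_restrict_le_norm21 (hy.trans hx)).trans ?_) 2
    exact mul_le_mul' hF (rho_le_rho hy hx)
  have hB' : ∀ y ∈ Iic x, eLpNorm (vsum g₁ g₂ y) 2 ≤ γ y * rho x := fun y hy => by
    have hy' : y ≤ x := mem_Iic.1 hy
    exact (hg y (hy'.trans hx)).trans (mul_le_mul_right (rho_le_rho hy' hx) (γ y))
  have hB : ∫⁻ y in Iic x, eLpNorm (vsum g₁ g₂ y) 2 ≤ Γ * rho x := by
    refine (setLIntegral_mono' measurableSet_Iic hB').trans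
      ((setLIntegral_le_lintegral (Iic x) fun y => γ y * rho x).trans ?_)
    rw [lintegral_mul_const _ hγm]
    exact mul_le_mul_left hγ (rho x)
  refine (hs.eLpNorm_le hc hκ (hH x le_rfl) (Filter.Eventually.of_forall hH) hB).trans ?_
  exact le_of_eq (by ring)

/-- The factor |y| produced by the exponential is absorbed by the decay of p and g, through |y| ρ(y)
≤ 1. -/
theorem eLpNorm_incrForcing_le (hg₁ : Measurable (Function.uncurry g₁))
    (hg₂ : Measurable (Function.uncurry g₂)) (hp₁ : Measurable (Function.uncurry p₁))
    (hp₂ : Measurable (Function.uncurry p₂)) (δ : ℝ) {y : ℝ}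
    (hp : eLpNorm (vsum p₁ p₂ y) 2 ≤ M * rho y)
    (hg : eLpNorm (vsum g₁ g₂ y) 2 ≤ γ y * rho y)
    (hgi : eLpNorm (vsum (incr δ g₁) (incr δ g₂) y) 2 ≤ γ y * ‖δ‖ₑ) :
    eLpNorm (incrForcing a b c d g₁ g₂ p₁ p₂ δ y) 2 ≤
      (γ y + (2 * (ENNReal.ofReal (kern a b c d y) * M) + 2 * γ y)) * ‖δ‖ₑ := by
  have mp := measurable_vsum hp₁ hp₂
  have m1 : Measurable (vsum (incr δ g₁) (incr δ g₂) y) :=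
    (measurable_vsum (measurable_incr hg₁ δ) (measurable_incr hg₂ δ)).of_uncurry_left
  obtain ⟨P, hP⟩ : ∃ P : ℝ → ℝ≥0∞, ∀ z, P z = vsum p₁ p₂ y (z + δ) := ⟨_, fun _ => rfl⟩
  obtain ⟨G, hG⟩ : ∃ G : ℝ → ℝ≥0∞, ∀ z, G z = ‖g₂ y (z + δ)‖ₑ := ⟨_, fun _ => rfl⟩
  obtain ⟨k, hk⟩ : ∃ k : ℝ≥0∞, k = ENNReal.ofReal (kern a b c d y) := ⟨_, rfl⟩
  have m2 : Measurable P := by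
    rw [funext hP]; exact (measurable_translate mp δ).of_uncurry_left
  have m3 : Measurable G := by
    rw [funext hG]; exact (measurable_translate hg₂ δ).of_uncurry_left.enorm
  have m4 : Measurable fun z => k * P z + G z := (m2.const_mul _).add m3
  have e : incrForcing a b c d g₁ g₂ p₁ p₂ δ y = vsum (incr δ g₁) (incr δ g₂) y +
      fun z => 2 * ‖δ‖ₑ * ‖y‖ₑ * (k * P z + G z) := by
    funext z
    rw [Pi.add_apply, hP, hG, hk, incrForcing]
  have n2 : eLpNorm P 2 ≤ M * rho y := by
    rw [funext hP, eLpNorm_translate (g := vsum p₁ p₂ y) mp.of_uncurry_left.aestronglyMeasurable]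
    exact hp
  have n3 : eLpNorm G 2 ≤ γ y * rho y := by
    rw [funext hG, eLpNorm_enorm,
      eLpNorm_translate (g := g₂ y) hg₂.of_uncurry_left.aestronglyMeasurable]
    refine le_trans (eLpNorm_mono_enorm fun z => ?_) hg
    rw [enorm_eq_self]; exact le_add_self
  have n4 : eLpNorm (fun z => k * P z + G z) 2 ≤ (k * M + γ y) * rho y := by
    refine (eLpNorm_add_le (m2.const_mul _).aestronglyMeasurable m3.aestronglyMeasurable
      one_le_two).trans ?_
    rw [eLpNorm_two_const_mul _ _ m2, add_mul, mul_assoc]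
    exact add_le_add (mul_le_mul_right n2 k) n3
  rw [e, ← hk]
  refine (eLpNorm_add_le m1.aestronglyMeasurable (m4.const_mul _).aestronglyMeasurable
    one_le_two).trans ?_
  rw [eLpNorm_two_const_mul _ _ m4]
  calc _ ≤ γ y * ‖δ‖ₑ + 2 * ‖δ‖ₑ * ‖y‖ₑ * ((k * M + γ y) * rho y) :=
        add_le_add hgi (mul_le_mul_right n4 _)
    _ = γ y * ‖δ‖ₑ + 2 * ‖δ‖ₑ * (k * M + γ y) * (‖y‖ₑ * rho y) := by ring
    _ ≤ γ y * ‖δ‖ₑ + 2 * ‖δ‖ₑ * (k * M + γ y) * 1 :=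
        add_le_add le_rfl (mul_le_mul_right (enorm_mul_rho_le_one y) _)
    _ = _ := by ring

theorem lintegral_incr_bound_le (hc : IsCoeff a b c d) (hκ : ∫ y, kern a b c d y ≤ κ)
    (hγm : Measurable γ) (hγ : ∫⁻ y, γ y ≤ Γ) (D : ℝ≥0∞) (hD : D ≠ ⊤) :
    ∫⁻ y, (γ y + (2 * (ENNReal.ofReal (kern a b c d y) * M) + 2 * γ y)) * D ≤
      (3 * Γ + 2 * (ENNReal.ofReal κ * M)) * D := by
  have kf := hc.measurable_kern.ennreal_ofReal
  rw [lintegral_mul_const' _ _ hD, lintegral_add_left hγm,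
    lintegral_add_right _ (hγm.const_mul 2), lintegral_const_mul _ hγm,
    lintegral_const_mul _ (kf.mul_const M), lintegral_mul_const _ kf]
  refine mul_le_mul_left ?_ _
  calc _ ≤ Γ + (2 * (ENNReal.ofReal κ * M) + 2 * Γ) :=
        add_le_add hγ (add_le_add (mul_le_mul_right (mul_le_mul_left
          (lintegral_ofReal_kern hc hκ) _) _) (mul_le_mul_right hγ _))
    _ = _ := by ring

/-- The weighted bound `eLpNorm_le_rho` has to come first: its decay, with constant gconst κ * (2 *
F + Γ), is what makes the forcing of the increments integrable. -/
theorem IsSystem.eLpNorm_incr_le_rho (hs : IsSystem a b c d (oscInt f) g₁ g₂ p₁ p₂)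
    (hc : IsCoeff a b c d) (hκ : ∫ y, kern a b c d y ≤ κ) (hm : Measurable f) (hf : norm21 f ≠ ⊤)
    (hF : norm21 f ≤ F) (hγm : Measurable γ) (hγ : ∫⁻ y, γ y ≤ Γ)
    (hg : ∀ y ≤ 0, eLpNorm (vsum g₁ g₂ y) 2 ≤ γ y * rho y)
    (hgi : ∀ δ, ∀ y ≤ 0, eLpNorm (vsum (incr δ g₁) (incr δ g₂) y) 2 ≤ γ y * ‖δ‖ₑ) {x : ℝ}
    (hx : x ≤ 0) (δ : ℝ) : eLpNorm (vsum (incr δ p₁) (incr δ p₂) x) 2 ≤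
      gconst κ * (4 * F + (3 * Γ + 2 * (ENNReal.ofReal κ * (gconst κ * (2 * F + Γ))))) * ‖δ‖ₑ := by
  have first : ∀ x ≤ 0, eLpNorm (vsum p₁ p₂ x) 2 ≤ gconst κ * (2 * F + Γ) * rho x := fun x hx =>
    hs.eLpNorm_le_rho hc hκ hm hf hF hγm hγ hg hx
  have hB : ∫⁻ y in Iic x, eLpNorm (incrForcing a b c d g₁ g₂ p₁ p₂ δ y) 2 ≤
      (3 * Γ + 2 * (ENNReal.ofReal κ * (gconst κ * (2 * F + Γ)))) * ‖δ‖ₑ :=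
    (setLIntegral_mono' measurableSet_Iic fun y hy =>
      eLpNorm_incrForcing_le hs.mg₁ hs.mg₂ hs.mp₁ hs.mp₂ δ (first y (le_trans hy hx))
        (hg y (le_trans hy hx)) (hgi δ y (le_trans hy hx))).trans
      ((setLIntegral_le_lintegral _ _).trans
        (lintegral_incr_bound_le hc hκ hγm hγ _ enorm_ne_top))
  have hH : ∀ y ≤ x, eLpNorm (incr δ (oscInt f) y) 2 ≤ 4 * F * ‖δ‖ₑ := fun y hy =>
    (eLpNorm_incr_oscInt_le hm hf δ (hy.trans hx)).trans
      (mul_le_mul_left (mul_le_mul_right hF _) _)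
  refine (hs.eLpNorm_incr_le hc hκ hx hH hB).trans ?_
  rw [← add_mul, mul_assoc]

end

/-! ### Families that are bounded and Lipschitz on bounded sets -/

section

variable {ι : Type*}

theorem weighted_zero {E : Type*} [NormedAddCommGroup E] [NormedSpace ℝ E] (f : ℝ → E) :
    weighted 0 f = f := by
  funext x; rw [weighted, Real.rpow_zero, one_smul]

theorem measurable_weight (s : ℝ) : Measurable fun x : ℝ => √(1 + x ^ 2) ^ s := by fun_prop

theorem measurable_weighted (s : ℝ) {f : ℝ → ℂ} (hf : Measurable f) : Measurable (weighted s f) :=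
  (measurable_weight s).smul hf

theorem aestronglyMeasurable_weighted (s : ℝ) {f : ℝ → ℂ} (hf : AEStronglyMeasurable f) :
    AEStronglyMeasurable (weighted s f) :=
  (measurable_weight s).aestronglyMeasurable.smul hf

theorem eLpNorm_weighted_add_le (s : ℝ) {p : ℝ≥0∞} (hp : 1 ≤ p) {f g : ℝ → ℂ}
    (hf : Measurable f) (hg : Measurable g) : eLpNorm (weighted s fun x => f x + g x) p ≤
      eLpNorm (weighted s f) p + eLpNorm (weighted s g) p := by
  have e : (weighted s fun x => f x + g x) = weighted s f + weighted s g := by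
    funext x; simp only [weighted, Pi.add_apply, smul_add]
  rw [e]
  exact eLpNorm_add_le (measurable_weighted s hf).aestronglyMeasurable
    (measurable_weighted s hg).aestronglyMeasurable hp

theorem eLpNorm_weighted_mul_le (s : ℝ) (p : ℝ≥0∞) {f g : ℝ → ℂ} (hg : Measurable g) :
    eLpNorm (weighted s fun x => f x * g x) p ≤
      eLpNorm (weighted 0 f) ⊤ * eLpNorm (weighted s g) p := by
  have e : (weighted s fun x => f x * g x) = f • weighted s g := by
    funext x
    rw [weighted, Pi.smul_apply', weighted, smul_eq_mul, mul_smul_comm]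
  rw [e, weighted_zero]
  exact eLpNorm_smul_le_eLpNorm_top_mul_eLpNorm p (measurable_weighted s hg).aestronglyMeasurable f

/-- A family of functions which is bounded and Lipschitz continuous on the set `D` of parameters,
with respect to the distance `d` and the weighted `L^p` norm with the weight `⟨x⟩ ^ s`. -/
structure LipBdd (s : ℝ) (p : ℝ≥0∞) (D : Set ι) (d : ι → ι → ℝ≥0∞) (Φ : ι → ℝ → ℂ) : Prop where
  meas : ∀ u ∈ D, Measurable (Φ u)
  bdd : ∃ C : ℝ≥0, ∀ u ∈ D, eLpNorm (weighted s (Φ u)) p ≤ C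
  lip : ∃ C : ℝ≥0, ∀ u ∈ D, ∀ w ∈ D, eLpNorm (weighted s fun x => Φ u x - Φ w x) p ≤ C * d u w

namespace LipBdd

variable {s : ℝ} {p : ℝ≥0∞} {D : Set ι} {d : ι → ι → ℝ≥0∞} {Φ Ψ : ι → ℝ → ℂ}

theorem mono {D' : Set ι} {d' : ι → ι → ℝ≥0∞} (h : LipBdd s p D d Φ) (hD : D' ⊆ D)
    (hd : ∀ u w, d u w ≤ d' u w) : LipBdd s p D' d' Φ := by
  obtain ⟨C, hC⟩ := h.bdd
  obtain ⟨L, hL⟩ := h.lip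
  exact ⟨fun u hu => h.meas u (hD hu), ⟨C, fun u hu => hC u (hD hu)⟩, ⟨L, fun u hu w hw =>
    (hL u (hD hu) w (hD hw)).trans (mul_le_mul_right (hd u w) _)⟩⟩

theorem to_L2 (h : LipBdd 1 2 D d Φ) : LipBdd 0 2 D d Φ := by
  obtain ⟨C, hC⟩ := h.bdd
  obtain ⟨L, hL⟩ := h.lip
  refine ⟨h.meas, ⟨C, fun u hu => ?_⟩, ⟨L, fun u hu w hw => ?_⟩⟩
  · rw [weighted_zero]; exact (eLpNorm_le_norm21 _).trans (hC u hu)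
  · rw [weighted_zero]; exact (eLpNorm_le_norm21 _).trans (hL u hu w hw)

theorem add (hp : 1 ≤ p) (h₁ : LipBdd s p D d Φ) (h₂ : LipBdd s p D d Ψ) :
    LipBdd s p D d (fun u x => Φ u x + Ψ u x) := by
  obtain ⟨C, hC⟩ := h₁.bdd
  obtain ⟨L, hL⟩ := h₁.lip
  obtain ⟨C', hC'⟩ := h₂.bdd
  obtain ⟨L', hL'⟩ := h₂.lip
  refine ⟨fun u hu => (h₁.meas u hu).add (h₂.meas u hu), ⟨C + C', fun u hu => ?_⟩,
    ⟨L + L', fun u hu w hw => ?_⟩⟩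
  · rw [ENNReal.coe_add]
    exact (eLpNorm_weighted_add_le s hp (h₁.meas u hu) (h₂.meas u hu)).trans
      (add_le_add (hC u hu) (hC' u hu))
  · have e : (fun x => Φ u x + Ψ u x - (Φ w x + Ψ w x)) =
        fun x => (Φ u x - Φ w x) + (Ψ u x - Ψ w x) := by funext x; ring
    rw [e, ENNReal.coe_add, add_mul]
    exact (eLpNorm_weighted_add_le s hp ((h₁.meas u hu).sub (h₁.meas w hw))
      ((h₂.meas u hu).sub (h₂.meas w hw))).trans (add_le_add (hL u hu w hw) (hL' u hu w hw))

theorem mul (hp : 1 ≤ p) (h₁ : LipBdd 0 ⊤ D d Φ) (h₂ : LipBdd s p D d Ψ) :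
    LipBdd s p D d (fun u x => Φ u x * Ψ u x) := by
  obtain ⟨C, hC⟩ := h₁.bdd
  obtain ⟨L, hL⟩ := h₁.lip
  obtain ⟨C', hC'⟩ := h₂.bdd
  obtain ⟨L', hL'⟩ := h₂.lip
  refine ⟨fun u hu => (h₁.meas u hu).mul (h₂.meas u hu), ⟨C * C', fun u hu => ?_⟩,
    ⟨C * L' + L * C', fun u hu w hw => ?_⟩⟩
  · rw [ENNReal.coe_mul]
    exact (eLpNorm_weighted_mul_le s p (h₂.meas u hu)).trans (mul_le_mul' (hC u hu) (hC' u hu))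
  · have e : (fun x => Φ u x * Ψ u x - Φ w x * Ψ w x) =
        fun x => Φ u x * (Ψ u x - Ψ w x) + (Φ u x - Φ w x) * Ψ w x := by funext x; ring
    rw [e]
    calc _ ≤ C * (L' * d u w) + L * d u w * C' :=
          (eLpNorm_weighted_add_le s hp ((h₁.meas u hu).mul ((h₂.meas u hu).sub (h₂.meas w hw)))
            (((h₁.meas u hu).sub (h₁.meas w hw)).mul (h₂.meas w hw))).trans
          (add_le_add
            ((eLpNorm_weighted_mul_le s p ((h₂.meas u hu).sub (h₂.meas w hw))).trans
              (mul_le_mul' (hC u hu) (hL' u hu w hw)))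
            ((eLpNorm_weighted_mul_le s p (h₂.meas w hw)).trans
              (mul_le_mul' (hL u hu w hw) (hC' w hw))))
      _ = _ := by push_cast; ring

theorem const_mul (c : ℂ) (h : LipBdd s p D d Φ) : LipBdd s p D d (fun u x => c * Φ u x) := by
  obtain ⟨C, hC⟩ := h.bdd
  obtain ⟨L, hL⟩ := h.lip
  have e : ∀ f : ℝ → ℂ, eLpNorm (weighted s fun x => c * f x) p =
      ‖c‖₊ * eLpNorm (weighted s f) p := fun f => by
    have : (weighted s fun x => c * f x) = c • weighted s f := by
      funext x
      rw [weighted, Pi.smul_apply, weighted, smul_eq_mul, mul_smul_comm]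
    rw [this, eLpNorm_const_smul]
    rfl
  refine ⟨fun u hu => (h.meas u hu).const_mul c, ⟨‖c‖₊ * C, fun u hu => ?_⟩,
    ⟨‖c‖₊ * L, fun u hu w hw => ?_⟩⟩
  · rw [e, ENNReal.coe_mul]
    exact mul_le_mul_right (hC u hu) _
  · simp only [← mul_sub]
    rw [e, ENNReal.coe_mul, mul_assoc]
    exact mul_le_mul_right (hL u hu w hw) _

theorem sub (hp : 1 ≤ p) (h₁ : LipBdd s p D d Φ) (h₂ : LipBdd s p D d Ψ) :
    LipBdd s p D d (fun u x => Φ u x - Ψ u x) := by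
  have := h₁.add hp (h₂.const_mul (-1))
  simpa only [neg_one_mul, ← sub_eq_add_neg] using this

theorem congr_ae (h : LipBdd s p D d Φ) (hm : ∀ u ∈ D, Measurable (Ψ u))
    (he : ∀ u ∈ D, Ψ u =ᵐ[volume] Φ u) : LipBdd s p D d Ψ := by
  obtain ⟨C, hC⟩ := h.bdd
  obtain ⟨L, hL⟩ := h.lip
  refine ⟨hm, ⟨C, fun u hu => ?_⟩, ⟨L, fun u hu w hw => ?_⟩⟩
  · refine (eLpNorm_congr_ae ?_).trans_le (hC u hu)
    filter_upwards [he u hu] with x hx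
    rw [weighted, weighted, hx]
  · refine (eLpNorm_congr_ae ?_).trans_le (hL u hu w hw)
    filter_upwards [he u hu, he w hw] with x hx hx'
    rw [weighted, weighted, hx, hx']

theorem norm21_ne_top (h : LipBdd 1 2 D d Φ) {u : ι} (hu : u ∈ D) : norm21 (Φ u) ≠ ⊤ := by
  obtain ⟨C, hC⟩ := h.bdd
  exact ne_top_of_le_ne_top ENNReal.coe_ne_top (hC u hu)

theorem integrable (h : LipBdd 1 2 D d Φ) {u : ι} (hu : u ∈ D) : Integrable (Φ u) :=
  integrable_of_norm21 (h.meas u hu).aestronglyMeasurable (h.norm21_ne_top hu)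

theorem memLp (h : LipBdd 0 2 D d Φ) {u : ι} (hu : u ∈ D) : MemLp (Φ u) 2 := by
  obtain ⟨C, hC⟩ := h.bdd
  have := hC u hu
  rw [weighted_zero] at this
  exact ⟨(h.meas u hu).aestronglyMeasurable, this.trans_lt ENNReal.coe_lt_top⟩

theorem lintegral (h : LipBdd 1 2 D d Φ) : (∃ C : ℝ≥0, ∀ u ∈ D, ∫⁻ x, ‖Φ u x‖ₑ ≤ C) ∧
    ∃ C : ℝ≥0, ∀ u ∈ D, ∀ w ∈ D, ∫⁻ x, ‖Φ u x - Φ w x‖ₑ ≤ C * d u w := by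
  obtain ⟨C, hC⟩ := h.bdd
  obtain ⟨L, hL⟩ := h.lip
  have hr : (rhoNorm.toNNReal : ℝ≥0∞) = rhoNorm := ENNReal.coe_toNNReal rhoNorm_ne_top
  refine ⟨⟨rhoNorm.toNNReal * C, fun u hu => ?_⟩, ⟨rhoNorm.toNNReal * L, fun u hu w hw => ?_⟩⟩
  · rw [ENNReal.coe_mul, hr]
    exact (lintegral_enorm_le_norm21 (h.meas u hu).aestronglyMeasurable).trans
      (mul_le_mul_right (hC u hu) _)
  · rw [ENNReal.coe_mul, hr, mul_assoc]
    exact (lintegral_enorm_le_norm21 ((h.meas u hu).sub (h.meas w hw)).aestronglyMeasurable).trans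
      (mul_le_mul_right (hL u hu w hw) _)

theorem primitive (h : LipBdd 1 2 D d Φ) : LipBdd 0 ⊤ D d (fun u x => ∫ y in Iic x, Φ u y) := by
  obtain ⟨⟨C, hC⟩, ⟨L, hL⟩⟩ := h.lintegral
  refine ⟨fun u hu => (continuous_setIntegral_Iic (h.integrable hu)).measurable,
    ⟨C, fun u hu => ?_⟩, ⟨L, fun u hu w hw => ?_⟩⟩
  · rw [weighted_zero, eLpNorm_exponent_top]
    exact eLpNormEssSup_le_of_ae_enorm_bound (Filter.Eventually.of_forall fun x =>
      (enorm_integral_le_lintegral_enorm _).trans ((setLIntegral_le_lintegral _ _).trans (hC u hu)))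
  · rw [weighted_zero, eLpNorm_exponent_top]
    refine eLpNormEssSup_le_of_ae_enorm_bound (Filter.Eventually.of_forall fun x => ?_)
    rw [← integral_sub (h.integrable hu).restrict (h.integrable hw).restrict]
    exact (enorm_integral_le_lintegral_enorm _).trans
      ((setLIntegral_le_lintegral _ _).trans (hL u hu w hw))

theorem ae_norm_le (h : LipBdd 0 ⊤ D d Φ) : ∃ C : ℝ≥0, ∀ u ∈ D, ∀ᵐ x, ‖Φ u x‖ ≤ C := by
  obtain ⟨C, hC⟩ := h.bdd
  refine ⟨C, fun u hu => ?_⟩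
  have := hC u hu
  rw [weighted_zero, eLpNorm_exponent_top] at this
  filter_upwards [ae_le_eLpNormEssSup (f := Φ u) (μ := volume)] with x hx
  have := hx.trans this
  rwa [← ofReal_norm, ENNReal.ofReal_le_coe] at this

/-- Write e^a - e^b = e^b (e^w - 1) with w = a - b and |w| ≤ 2C. The factor e^b costs e^C and |e^w -
1| ≤ |w| e^{|w|} costs e^{2C}, whence 3C. -/
theorem _root_.Complex.norm_exp_sub_exp_le_of_norm_le {a b : ℂ} {C : ℝ} (ha : ‖a‖ ≤ C)
    (hb : ‖b‖ ≤ C) : ‖Complex.exp a - Complex.exp b‖ ≤ Real.exp (3 * C) * ‖a - b‖ := by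
  have e : Complex.exp a - Complex.exp b = Complex.exp b * (Complex.exp (a - b) - 1) := by
    rw [mul_sub, mul_one, ← Complex.exp_add]; congr 2; ring
  have h1 := Complex.norm_exp_sub_sum_le_norm_mul_exp (a - b) 1
  simp only [Finset.range_one, Finset.sum_singleton, pow_zero, Nat.factorial_zero, Nat.cast_one,
    div_one, pow_one] at h1
  rw [e, norm_mul]
  have h2 : ‖Complex.exp b‖ ≤ Real.exp C := by
    rw [Complex.norm_exp]
    exact Real.exp_le_exp.2 ((Complex.re_le_norm b).trans hb)
  have h3 : Real.exp ‖a - b‖ ≤ Real.exp (2 * C) := by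
    refine Real.exp_le_exp.2 ((norm_sub_le a b).trans ?_)
    linarith
  calc _ ≤ Real.exp C * (‖a - b‖ * Real.exp (2 * C)) :=
        mul_le_mul h2 (h1.trans (mul_le_mul_of_nonneg_left h3 (norm_nonneg _))) (norm_nonneg _)
          (Real.exp_pos _).le
    _ = _ := by
        rw [show 3 * C = C + 2 * C by ring, Real.exp_add]; ring

theorem cexp (h : LipBdd 0 ⊤ D d Φ) : LipBdd 0 ⊤ D d (fun u x => Complex.exp (Φ u x)) := by
  obtain ⟨C, hC⟩ := h.ae_norm_le
  obtain ⟨L, hL⟩ := h.lip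
  refine ⟨fun u hu => (h.meas u hu).cexp, ⟨(Real.exp C).toNNReal, fun u hu => ?_⟩,
    ⟨(Real.exp (3 * C)).toNNReal * L, fun u hu w hw => ?_⟩⟩
  · rw [weighted_zero, eLpNorm_exponent_top]
    refine eLpNormEssSup_le_of_ae_enorm_bound ?_
    filter_upwards [hC u hu] with x hx
    rw [← ofReal_norm, Complex.norm_exp]
    exact ENNReal.ofReal_le_ofReal (Real.exp_le_exp.2 ((Complex.re_le_norm _).trans hx))
  · have hl := hL u hu w hw
    rw [weighted_zero] at hl ⊢
    have hae : ∀ᵐ x, ‖Complex.exp (Φ u x) - Complex.exp (Φ w x)‖ ≤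
        Real.exp (3 * C) * ‖Φ u x - Φ w x‖ := by
      filter_upwards [hC u hu, hC w hw] with x hx hx'
      exact Complex.norm_exp_sub_exp_le_of_norm_le hx hx'
    refine (eLpNorm_le_mul_eLpNorm_of_ae_le_mul hae ⊤).trans ?_
    rw [ENNReal.coe_mul, mul_assoc]
    exact mul_le_mul_right hl _

/-- The Sobolev embedding into L^∞: the function is almost everywhere the primitive of its
derivative, and that derivative is integrable thanks to the weight. -/
theorem of_hasWeakDeriv (h : LipBdd 1 2 D d Φ) (h' : LipBdd 1 2 D d Ψ)
    (hw : ∀ u ∈ D, HasWeakDeriv (Φ u) (Ψ u)) : LipBdd 0 ⊤ D d Φ :=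
  h'.primitive.congr_ae h.meas fun u hu =>
    (hw u hu).ae_eq_setIntegral_Iic (h.to_L2.memLp hu) (h'.integrable hu)

end LipBdd

end

/-! ### Potentials, coefficients and the system of the remainder -/

section

open Complex (I)

/-- The data of a scattering problem: two potentials with their first and second derivatives. -/
structure Pot where
  /-- the first potential -/
  q : ℝ → ℂ
  /-- its first derivative -/
  q' : ℝ → ℂ
  /-- its second derivative -/
  q'' : ℝ → ℂ
  /-- the second potential -/
  r : ℝ → ℂ
  /-- its first derivative -/
  r' : ℝ → ℂ
  /-- its second derivative -/
  r'' : ℝ → ℂ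

namespace Pot

/-- The data bounded by `γ` in `H^{1,1}`. -/
structure Mem11 (γ : ℝ≥0) (P : Pot) : Prop where
  mq : Measurable P.q
  mq' : Measurable P.q'
  mr : Measurable P.r
  mr' : Measurable P.r'
  dq : HasWeakDeriv P.q P.q'
  dr : HasWeakDeriv P.r P.r'
  nq : norm21 P.q ≤ γ
  nq' : norm21 P.q' ≤ γ
  nr : norm21 P.r ≤ γ
  nr' : norm21 P.r' ≤ γ

/-- The data bounded by `γ` in `H² ∩ H^{1,1}`. -/
structure Mem2 (γ : ℝ≥0) (P : Pot) : Prop extends P.Mem11 γ where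
  mq'' : Measurable P.q''
  mr'' : Measurable P.r''
  dq' : HasWeakDeriv P.q' P.q''
  dr' : HasWeakDeriv P.r' P.r''
  nq'' : eLpNorm P.q'' 2 ≤ γ
  nr'' : eLpNorm P.r'' 2 ≤ γ

/-- The distance of `H^{1,1}`. -/
def dist11 (P W : Pot) : ℝ≥0∞ := norm21 (P.q - W.q) + norm21 (P.q' - W.q') +
  norm21 (P.r - W.r) + norm21 (P.r' - W.r')

/-- The distance of `H² ∩ H^{1,1}`. -/
def dist2 (P W : Pot) : ℝ≥0∞ :=
  dist11 P W + eLpNorm (P.q'' - W.q'') 2 + eLpNorm (P.r'' - W.r'') 2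

theorem dist11_le_dist2 (P W : Pot) : dist11 P W ≤ dist2 P W := by
  rw [dist2, add_assoc]; exact le_self_add

/-- The set of the data bounded by `γ` in `H^{1,1}`. -/
def ball11 (γ : ℝ≥0) : Set Pot := {P | P.Mem11 γ}

/-- The set of the data bounded by `γ` in `H² ∩ H^{1,1}`. -/
def ball2 (γ : ℝ≥0) : Set Pot := {P | P.Mem2 γ}

theorem ball2_subset (γ : ℝ≥0) : ball2 γ ⊆ ball11 γ := fun _ h => h.toMem11

theorem lipBdd_of_le {s : ℝ} {p : ℝ≥0∞} {D : Set Pot} {d : Pot → Pot → ℝ≥0∞} {Φ : Pot → ℝ → ℂ}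
    {γ : ℝ≥0} (hm : ∀ P ∈ D, Measurable (Φ P)) (hb : ∀ P ∈ D, eLpNorm (weighted s (Φ P)) p ≤ γ)
    (hl : ∀ P W, eLpNorm (weighted s (Φ P - Φ W)) p ≤ d P W) : LipBdd s p D d Φ :=
  ⟨hm, ⟨γ, hb⟩, ⟨1, fun P _ W _ => by rw [ENNReal.coe_one, one_mul]; exact hl P W⟩⟩

section

variable (γ : ℝ≥0)

theorem lip_q : LipBdd 1 2 (ball11 γ) dist11 q :=
  lipBdd_of_le (fun _ h => h.mq) (fun _ h => h.nq) fun _ _ =>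
    le_self_add.trans (le_self_add.trans le_self_add)

theorem lip_q' : LipBdd 1 2 (ball11 γ) dist11 q' :=
  lipBdd_of_le (fun _ h => h.mq') (fun _ h => h.nq') fun _ _ =>
    le_add_self.trans (le_self_add.trans le_self_add)

theorem lip_r : LipBdd 1 2 (ball11 γ) dist11 r :=
  lipBdd_of_le (fun _ h => h.mr) (fun _ h => h.nr) fun _ _ => le_add_self.trans le_self_add

theorem lip_r' : LipBdd 1 2 (ball11 γ) dist11 r' :=
  lipBdd_of_le (fun _ h => h.mr') (fun _ h => h.nr') fun _ _ => le_add_self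

theorem sup_q : LipBdd 0 ⊤ (ball11 γ) dist11 q :=
  (lip_q γ).of_hasWeakDeriv (lip_q' γ) fun _ h => h.dq

theorem sup_r : LipBdd 0 ⊤ (ball11 γ) dist11 r :=
  (lip_r γ).of_hasWeakDeriv (lip_r' γ) fun _ h => h.dr

theorem lip_r'' : LipBdd 0 2 (ball2 γ) dist2 r'' :=
  lipBdd_of_le (fun _ h => h.mr'') (fun _ h => by rw [weighted_zero]; exact h.nr'') fun _ _ => by
    rw [weighted_zero]; exact le_add_self

end

/-- The upper left entry of the matrix of the system. -/
def cA (P : Pot) (x : ℝ) : ℂ := -(1 / (2 * I)) * (P.q x * P.r x)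

/-- The upper right entry of the matrix of the system. -/
def cB (P : Pot) (x : ℝ) : ℂ := 1 / (2 * I) * P.q x

/-- The lower left entry of the matrix of the system. -/
def cC (P : Pot) (x : ℝ) : ℂ := P.r' x - 1 / (2 * I) * (P.q x * (P.r x * P.r x))

/-- The lower right entry of the matrix of the system. -/
def cD (P : Pot) (x : ℝ) : ℂ := 1 / (2 * I) * (P.q x * P.r x)

/-- The limit of the first component of the Jost function for large spectral parameters. -/
def mInf (P : Pot) (x : ℝ) : ℂ := Complex.exp (∫ y in Iic x, P.cA y)

/-- The density of the leading oscillatory integral. -/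
def force (P : Pot) (x : ℝ) : ℂ := P.mInf x * P.cC x

section

variable (γ : ℝ≥0)

theorem lip_qr : LipBdd 1 2 (ball11 γ) dist11 (fun P x => P.q x * P.r x) :=
  (sup_q γ).mul one_le_two (lip_r γ)

theorem lip_cA : LipBdd 1 2 (ball11 γ) dist11 cA := (lip_qr γ).const_mul _

theorem lip_cB : LipBdd 1 2 (ball11 γ) dist11 cB := (lip_q γ).const_mul _

theorem lip_cC : LipBdd 1 2 (ball11 γ) dist11 cC :=
  (lip_r' γ).sub one_le_two
    (((sup_q γ).mul one_le_two ((sup_r γ).mul one_le_two (lip_r γ))).const_mul _)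

theorem lip_cD : LipBdd 1 2 (ball11 γ) dist11 cD := (lip_qr γ).const_mul _

theorem sup_mInf : LipBdd 0 ⊤ (ball11 γ) dist11 mInf := (lip_cA γ).primitive.cexp

theorem lip_force : LipBdd 1 2 (ball11 γ) dist11 force := (sup_mInf γ).mul one_le_two (lip_cC γ)

end

theorem Mem11.isCoeff {γ : ℝ≥0} {P : Pot} (h : P.Mem11 γ) : IsCoeff P.cA P.cB P.cC P.cD :=
  ⟨(lip_cA γ).meas P h, (lip_cB γ).meas P h, (lip_cC γ).meas P h, (lip_cD γ).meas P h,
    (lip_cA γ).integrable h, (lip_cB γ).integrable h, (lip_cC γ).integrable h,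
    (lip_cD γ).integrable h⟩

theorem lintegral_kern_le {ι : Type*} {D : Set ι} {d : ι → ι → ℝ≥0∞} {a b c e : ι → ℝ → ℂ}
    (ha : LipBdd 1 2 D d a) (hb : LipBdd 1 2 D d b) (hc : LipBdd 1 2 D d c)
    (he : LipBdd 1 2 D d e) :
    (∃ C : ℝ≥0, ∀ u ∈ D, ∫⁻ y, ENNReal.ofReal (kern (a u) (b u) (c u) (e u) y) ≤ C) ∧
    ∃ C : ℝ≥0, ∀ u ∈ D, ∀ w ∈ D, ∫⁻ y, ENNReal.ofReal (kern (fun x => a u x - a w x)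
      (fun x => b u x - b w x) (fun x => c u x - c w x) (fun x => e u x - e w x) y) ≤ C * d u w := by
  have key : ∀ {f g h k : ℝ → ℂ}, Measurable f → Measurable g → Measurable h →
      ∫⁻ y, ENNReal.ofReal (kern f g h k y) =
      (∫⁻ y, ‖f y‖ₑ) + (∫⁻ y, ‖g y‖ₑ) + (∫⁻ y, ‖h y‖ₑ) + ∫⁻ y, ‖k y‖ₑ := fun hf hg hh => by
    simp only [ofReal_kern]
    rw [lintegral_add_left, lintegral_add_left, lintegral_add_left] <;> fun_prop
  obtain ⟨⟨A, hA⟩, ⟨A', hA'⟩⟩ := ha.lintegral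
  obtain ⟨⟨B, hB⟩, ⟨B', hB'⟩⟩ := hb.lintegral
  obtain ⟨⟨C, hC⟩, ⟨C', hC'⟩⟩ := hc.lintegral
  obtain ⟨⟨E, hE⟩, ⟨E', hE'⟩⟩ := he.lintegral
  refine ⟨⟨A + B + C + E, fun u hu => ?_⟩, ⟨A' + B' + C' + E', fun u hu w hw => ?_⟩⟩
  · rw [key (ha.meas u hu) (hb.meas u hu) (hc.meas u hu)]
    push_cast
    exact add_le_add (add_le_add (add_le_add (hA u hu) (hB u hu)) (hC u hu)) (hE u hu)
  · rw [key (f := fun x => a u x - a w x) (g := fun x => b u x - b w x)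
      (h := fun x => c u x - c w x) ((ha.meas u hu).sub (ha.meas w hw))
      ((hb.meas u hu).sub (hb.meas w hw)) ((hc.meas u hu).sub (hc.meas w hw))]
    push_cast
    rw [add_mul, add_mul, add_mul]
    exact add_le_add (add_le_add (add_le_add (hA' u hu w hw) (hB' u hu w hw)) (hC' u hu w hw))
      (hE' u hu w hw)

/-- The integral of the size of the coefficients is bounded on bounded sets of data. -/
theorem exists_kern_bound (γ : ℝ≥0) : ∃ κ : ℝ, 0 ≤ κ ∧ ∀ P ∈ ball11 γ,
    ∫ y, kern P.cA P.cB P.cC P.cD y ≤ κ := by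
  obtain ⟨⟨C, hC⟩, -⟩ := lintegral_kern_le (lip_cA γ) (lip_cB γ) (lip_cC γ) (lip_cD γ)
  refine ⟨C, C.2, fun P hP => ?_⟩
  have h0 := kern_nonneg P.cA P.cB P.cC P.cD
  rw [integral_eq_lintegral_of_nonneg_ae (Filter.Eventually.of_forall h0)
    (IsCoeff.measurable_kern (Mem11.isCoeff hP)).aestronglyMeasurable]
  exact ENNReal.toReal_le_coe_of_le_coe (hC P hP)

/-- `mInf` solves the first equation with second component zero. Subtracting it removes the constant
1 and leaves c · mInf as the only forcing, in the second equation. -/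
theorem mInf_eq {γ : ℝ≥0} {P : Pot} (h : P.Mem11 γ) (x : ℝ) :
    P.mInf x = 1 + ∫ y in Iic x, P.cA y * P.mInf y := by
  simp only [mInf]
  rw [setIntegral_Iic_mul_exp h.isCoeff.ia]
  ring

theorem mInf_continuous {γ : ℝ≥0} {P : Pot} (h : P.Mem11 γ) : Continuous P.mInf :=
  (continuous_setIntegral_Iic h.isCoeff.ia).cexp

theorem integrable_cA_mul_mInf {γ : ℝ≥0} {P : Pot} (h : P.Mem11 γ) :
    Integrable fun y => P.cA y * P.mInf y := by
  have := ((sup_mInf γ).mul one_le_two (lip_cA γ)).integrable h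
  simpa only [mul_comm] using this

/-- The solution `(m₁, m₂)` of the Volterra system, as a function of `x` and `z`. -/
def IsSol (P : Pot) (m₁ m₂ : ℝ → ℝ → ℂ) : Prop :=
  Continuous (Function.uncurry m₁) ∧ Continuous (Function.uncurry m₂) ∧
    (∃ M, ∀ x z, ‖m₁ x z‖ ≤ M ∧ ‖m₂ x z‖ ≤ M) ∧
    (∀ x z, m₁ x z = 1 + ∫ y in Iic x, (P.cA y * m₁ y z + P.cB y * m₂ y z)) ∧
    ∀ x z, m₂ x z = ∫ y in Iic x, Complex.exp (2 * I * z * (x - y)) *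
      (P.cC y * m₁ y z + P.cD y * m₂ y z)

theorem Mem11.exists_isSol {γ : ℝ≥0} {P : Pot} (h : P.Mem11 γ) :
    ∃ m : (ℝ → ℝ → ℂ) × (ℝ → ℝ → ℂ), P.IsSol m.1 m.2 := by
  obtain ⟨m₁, m₂, hm⟩ := exists_volterra_solution h.isCoeff
  exact ⟨(m₁, m₂), hm⟩

open Classical in
/-- The Jost solution of the Volterra system. -/
def sol (P : Pot) : (ℝ → ℝ → ℂ) × (ℝ → ℝ → ℂ) :=
  if h : ∃ m : (ℝ → ℝ → ℂ) × (ℝ → ℝ → ℂ), P.IsSol m.1 m.2 then h.choose else 0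

theorem Mem11.isSol {γ : ℝ≥0} {P : Pot} (h : P.Mem11 γ) : P.IsSol P.sol.1 P.sol.2 := by
  rw [sol, dif_pos h.exists_isSol]
  exact h.exists_isSol.choose_spec

/-- The first component of the remainder of the Jost solution. -/
def rem₁ (P : Pot) (x z : ℝ) : ℂ := P.sol.1 x z - P.mInf x

/-- The second component of the remainder of the Jost solution. -/
def rem₂ (P : Pot) (x z : ℝ) : ℂ := P.sol.2 x z

theorem Mem11.exists_rem_bound {γ : ℝ≥0} {P : Pot} (h : P.Mem11 γ) :
    ∃ M, ∀ᵐ x, ∀ z, ‖P.rem₁ x z‖ ≤ M ∧ ‖P.rem₂ x z‖ ≤ M := by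
  obtain ⟨-, -, ⟨M, hM⟩, -, -⟩ := h.isSol
  obtain ⟨C, hC⟩ := (sup_mInf γ).ae_norm_le
  refine ⟨M + C, ?_⟩
  filter_upwards [hC P h] with x hx z
  have h0 : (0 : ℝ) ≤ C := C.2
  refine ⟨(norm_sub_le _ _).trans (add_le_add (hM x z).1 hx), ?_⟩
  exact (hM x z).2.trans (by linarith)

theorem integrable_kern_mul {a b c d : ℝ → ℂ} (hc : IsCoeff a b c d) {p : ℝ → ℂ} (hp : Measurable p)
    {M : ℝ} (hM : ∀ᵐ x, ‖p x‖ ≤ M) : Integrable fun y => kern a b c d y * ‖p y‖ := by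
  have := hc.integrable_kern.bdd_mul (c := M) hp.norm.aestronglyMeasurable
    (by simpa only [norm_norm] using hM)
  simpa only [mul_comm] using this

theorem Mem11.measurable_rem₁ {γ : ℝ≥0} {P : Pot} (h : P.Mem11 γ) :
    Measurable (Function.uncurry P.rem₁) :=
  h.isSol.1.measurable.sub ((mInf_continuous h).measurable.comp measurable_fst)

theorem Mem11.measurable_rem₂ {γ : ℝ≥0} {P : Pot} (h : P.Mem11 γ) :
    Measurable (Function.uncurry P.rem₂) := h.isSol.2.1.measurable

theorem Mem11.integrable_kern_rem {γ : ℝ≥0} {P : Pot} (h : P.Mem11 γ) {a b c d : ℝ → ℂ}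
    (hc : IsCoeff a b c d) (z : ℝ) : (Integrable fun y => kern a b c d y * ‖P.rem₁ y z‖) ∧
      Integrable fun y => kern a b c d y * ‖P.rem₂ y z‖ := by
  obtain ⟨M, hM⟩ := h.exists_rem_bound
  exact ⟨integrable_kern_mul hc h.measurable_rem₁.of_uncurry_right (hM.mono fun x hx => (hx z).1),
    integrable_kern_mul hc h.measurable_rem₂.of_uncurry_right (hM.mono fun x hx => (hx z).2)⟩

/-- The Volterra system of the remainder of the Jost solution. -/
theorem Mem11.isSystem {γ : ℝ≥0} {P : Pot} (h : P.Mem11 γ) :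
    IsSystem P.cA P.cB P.cC P.cD (oscInt P.force) (fun _ _ => 0) (fun _ _ => 0) P.rem₁ P.rem₂ := by
  have hc := h.isCoeff
  have k := norm_le_kern P.cA P.cB P.cC P.cD
  have m1 := h.measurable_rem₁
  have m2 := h.measurable_rem₂
  have i := h.integrable_kern_rem hc
  refine ⟨measurable_oscInt ((lip_force γ).integrable h) ((lip_force γ).meas P h),
    measurable_const, measurable_const, m1, m2, fun z => (i z).1, fun z => (i z).2,
    fun z => integrable_zero _ _ _, fun z => integrable_zero _ _ _, fun x z => ?_, fun x z => ?_⟩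
  · have i1 := integrable_mul_of_kern hc.ma m1.of_uncurry_right (fun y => (k y).1) (i z).1
    have i2 := integrable_mul_of_kern hc.mb m2.of_uncurry_right (fun y => (k y).2.1) (i z).2
    have i12 : Integrable fun y => P.cA y * P.rem₁ y z + P.cB y * P.rem₂ y z := i1.add i2
    have i3 := integrable_cA_mul_mInf h
    have e : ∫ y in Iic x, (P.cA y * P.sol.1 y z + P.cB y * P.sol.2 y z) =
        (∫ y in Iic x, (P.cA y * P.rem₁ y z + P.cB y * P.rem₂ y z + 0)) +
          ∫ y in Iic x, P.cA y * P.mInf y := by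
      simp only [add_zero]
      rw [← integral_add i12.restrict i3.restrict]
      congr 1; funext y; simp only [rem₁, rem₂]; ring
    rw [rem₁, h.isSol.2.2.2.1 x z, e, mInf_eq h]
    ring
  · have i1 := integrable_mul_of_kern hc.mc m1.of_uncurry_right (fun y => (k y).2.2.1) (i z).1
    have i2 := integrable_mul_of_kern hc.md m2.of_uncurry_right (fun y => (k y).2.2.2) (i z).2
    have i3 := (lip_force γ).integrable h
    have i12 : Integrable fun y => P.cC y * P.rem₁ y z + P.cD y * P.rem₂ y z := i1.add i2
    simp only [add_zero]
    rw [rem₂, h.isSol.2.2.2.2 x z, oscInt, ← integral_add (integrable_exp_mul i3 x z).restrict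
      (integrable_exp_mul i12 x z).restrict]
    congr 1; funext y; simp only [rem₁, rem₂, force]; ring

end Pot

end

/-! ### Bounds and Lipschitz estimates for the remainder -/

theorem vsum_coeff_le (a b c d : ℝ → ℂ) (p₁ p₂ : ℝ → ℝ → ℂ) (y z : ℝ) :
    vsum (fun y z => a y * p₁ y z + b y * p₂ y z) (fun y z => c y * p₁ y z + d y * p₂ y z) y z ≤
      ENNReal.ofReal (kern a b c d y) * vsum p₁ p₂ y z := by
  rw [ofReal_kern]
  calc _ ≤ (‖a y‖ₑ * ‖p₁ y z‖ₑ + ‖b y‖ₑ * ‖p₂ y z‖ₑ) +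
        (‖c y‖ₑ * ‖p₁ y z‖ₑ + ‖d y‖ₑ * ‖p₂ y z‖ₑ) := by
        simp only [vsum, ← enorm_mul]
        exact add_le_add (enorm_add_le _ _) (enorm_add_le _ _)
    _ ≤ ((‖a y‖ₑ * ‖p₁ y z‖ₑ + ‖b y‖ₑ * ‖p₂ y z‖ₑ) +
        (‖c y‖ₑ * ‖p₁ y z‖ₑ + ‖d y‖ₑ * ‖p₂ y z‖ₑ)) +
        ((‖a y‖ₑ + ‖c y‖ₑ) * ‖p₂ y z‖ₑ + (‖b y‖ₑ + ‖d y‖ₑ) * ‖p₁ y z‖ₑ) := le_self_add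
    _ = _ := by simp only [vsum]; ring

theorem eLpNorm_vsum_coeff_le (a b c d : ℝ → ℂ) {p₁ p₂ : ℝ → ℝ → ℂ} (y : ℝ)
    (h₁ : Measurable (Function.uncurry p₁)) (h₂ : Measurable (Function.uncurry p₂)) :
    eLpNorm (vsum (fun y z => a y * p₁ y z + b y * p₂ y z)
      (fun y z => c y * p₁ y z + d y * p₂ y z) y) 2 ≤
      ENNReal.ofReal (kern a b c d y) * eLpNorm (vsum p₁ p₂ y) 2 := by
  rw [← eLpNorm_two_const_mul _ _ (measurable_vsum h₁ h₂).of_uncurry_left]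
  refine eLpNorm_mono_enorm fun z => ?_
  rw [enorm_eq_self, enorm_eq_self]
  exact vsum_coeff_le a b c d p₁ p₂ y z

theorem incr_coeff (a b : ℝ → ℂ) (p₁ p₂ : ℝ → ℝ → ℂ) (δ : ℝ) :
    incr δ (fun y z => a y * p₁ y z + b y * p₂ y z) =
      fun y z => a y * incr δ p₁ y z + b y * incr δ p₂ y z := by
  funext y z; simp only [incr]; ring

theorem vsum_zero (y : ℝ) : vsum (fun _ _ => 0) (fun _ _ => 0) y = fun _ => 0 := by
  funext z; simp [vsum]

theorem incr_zero (δ : ℝ) : incr δ (fun _ _ => 0) = fun _ _ => 0 := by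
  funext y z; simp [incr]

theorem oscInt_sub {f g : ℝ → ℂ} (hf : Integrable f) (hg : Integrable g) :
    (fun x z => oscInt f x z - oscInt g x z) = oscInt fun y => f y - g y := by
  funext x z
  rw [oscInt, oscInt, oscInt, ← integral_sub (integrable_exp_mul hf x z).restrict
    (integrable_exp_mul hg x z).restrict]
  simp only [mul_sub]

theorem LipBdd.norm21_sub_ne_top {ι : Type*} {D : Set ι} {d : ι → ι → ℝ≥0∞} {Φ : ι → ℝ → ℂ}
    (h : LipBdd 1 2 D d Φ) {u w : ι} (hu : u ∈ D) (hw : w ∈ D) :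
    norm21 (fun x => Φ u x - Φ w x) ≠ ⊤ := by
  have h1 := eLpNorm_weighted_add_le 1 one_le_two (h.meas u hu) ((h.meas w hw).const_mul (-1))
  have h2 := (h.const_mul (-1)).norm21_ne_top hw
  simp only [neg_one_mul, ← sub_eq_add_neg] at h1 h2
  exact ne_top_of_le_ne_top (ENNReal.add_ne_top.2 ⟨h.norm21_ne_top hu, h2⟩) h1

namespace Pot

theorem exists_rem_bound (γ : ℝ≥0) : ∃ C : ℝ≥0, ∀ P ∈ ball11 γ, ∀ x ≤ 0,
    eLpNorm (vsum P.rem₁ P.rem₂ x) 2 ≤ C * rho x ∧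
    ∀ δ, eLpNorm (vsum (incr δ P.rem₁) (incr δ P.rem₂) x) 2 ≤ C * ‖δ‖ₑ := by
  obtain ⟨κ, -, hκ⟩ := exists_kern_bound γ
  obtain ⟨F, hF⟩ := (lip_force γ).bdd
  obtain ⟨K, hK⟩ : ∃ K : ℝ≥0, (K : ℝ≥0∞) = gconst κ :=
    ⟨_, ENNReal.coe_toNNReal (gconst_ne_top κ)⟩
  have h0 : ∀ y ≤ (0 : ℝ), eLpNorm (vsum (fun _ _ => 0) (fun _ _ => 0) y) 2 ≤ 0 * rho y :=
    fun y _ => by rw [vsum_zero]; simp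
  have h0' : ∀ δ : ℝ, ∀ y ≤ (0 : ℝ), eLpNorm (vsum (incr δ fun _ _ => 0)
      (incr δ fun _ _ => 0) y) 2 ≤ 0 * ‖δ‖ₑ := fun δ y _ => by
    rw [incr_zero, vsum_zero]; simp
  have hz : ∫⁻ _ : ℝ, (0 : ℝ≥0∞) ≤ (0 : ℝ≥0∞) := by simp
  -- The two summands are the constants of `eLpNorm_le_rho` and `eLpNorm_incr_le_rho` without
  -- integral forcing, that is with Γ = 0.
  refine ⟨K * (2 * F) + K * (4 * F + 2 * (κ.toNNReal * (K * (2 * F)))), fun P hP x hx =>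
    ⟨?_, fun δ => ?_⟩⟩
  · refine ((Mem11.isSystem hP).eLpNorm_le_rho (Mem11.isCoeff hP) (hκ P hP)
      ((lip_force γ).meas P hP) ((lip_force γ).norm21_ne_top hP) (hF P hP)
      (γ := fun _ => 0) measurable_const hz h0 hx).trans (mul_le_mul_left ?_ _)
    rw [← hK, add_zero]
    push_cast
    exact le_self_add
  · refine ((Mem11.isSystem hP).eLpNorm_incr_le_rho (Mem11.isCoeff hP) (hκ P hP)
      ((lip_force γ).meas P hP) ((lip_force γ).norm21_ne_top hP) (hF P hP)
      (γ := fun _ => 0) measurable_const hz h0 h0' hx δ).trans (mul_le_mul_left ?_ _)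
    rw [← hK, mul_zero, zero_add, add_zero]
    push_cast
    exact le_add_self

/-- The Volterra system of the difference of two remainders. -/
theorem Mem11.isSystem_sub {γ : ℝ≥0} {P W : Pot} (hP : P.Mem11 γ) (hW : W.Mem11 γ) :
    IsSystem P.cA P.cB P.cC P.cD (oscInt fun x => P.force x - W.force x)
      (fun y z => (P.cA y - W.cA y) * W.rem₁ y z + (P.cB y - W.cB y) * W.rem₂ y z)
      (fun y z => (P.cC y - W.cC y) * W.rem₁ y z + (P.cD y - W.cD y) * W.rem₂ y z)
      (fun x z => P.rem₁ x z - W.rem₁ x z) (fun x z => P.rem₂ x z - W.rem₂ x z) := by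
  have i := hW.integrable_kern_rem hP.isCoeff
  have h := hP.isSystem.sub hP.isCoeff hW.isSystem hW.isCoeff (fun z => (i z).1) fun z => (i z).2
  rw [oscInt_sub ((lip_force γ).integrable hP) ((lip_force γ).integrable hW)] at h
  simpa only [sub_zero, zero_add] using h

theorem measurable_kern_sub {γ : ℝ≥0} {P W : Pot} (hP : P.Mem11 γ) (hW : W.Mem11 γ) :
    Measurable (kern (fun x => P.cA x - W.cA x) (fun x => P.cB x - W.cB x)
      (fun x => P.cC x - W.cC x) (fun x => P.cD x - W.cD x)) := by
  have h1 := hP.isCoeff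
  have h2 := hW.isCoeff
  exact ((((h1.ma.sub h2.ma).norm).add ((h1.mb.sub h2.mb).norm)).add
    ((h1.mc.sub h2.mc).norm)).add ((h1.md.sub h2.md).norm)

/-- The difference of the remainders has forcing built from the differences of the coefficients
times the remainder of W. The two bounds of `exists_rem_bound` for W, decay in x and increments in
z, are exactly what the half-line estimates require of such a forcing. -/
theorem exists_rem_lip (γ : ℝ≥0) : ∃ C : ℝ≥0, ∀ P ∈ ball11 γ, ∀ W ∈ ball11 γ, ∀ x ≤ 0,
    eLpNorm (vsum (fun x z => P.rem₁ x z - W.rem₁ x z) (fun x z => P.rem₂ x z - W.rem₂ x z) x) 2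
      ≤ C * dist11 P W ∧
    ∀ δ, eLpNorm (vsum (incr δ fun x z => P.rem₁ x z - W.rem₁ x z)
      (incr δ fun x z => P.rem₂ x z - W.rem₂ x z) x) 2 ≤ C * dist11 P W * ‖δ‖ₑ := by
  obtain ⟨κ, -, hκ⟩ := exists_kern_bound γ
  obtain ⟨L, hL⟩ := (lip_force γ).lip
  obtain ⟨C, hC⟩ := exists_rem_bound γ
  obtain ⟨-, ⟨N, hN⟩⟩ := lintegral_kern_le (lip_cA γ) (lip_cB γ) (lip_cC γ) (lip_cD γ)
  obtain ⟨K, hK⟩ : ∃ K : ℝ≥0, (K : ℝ≥0∞) = gconst κ :=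
    ⟨_, ENNReal.coe_toNNReal (gconst_ne_top κ)⟩
  -- The constants of the two half-line estimates with F = L · dist and Γ = N · C · dist, the
  -- distance factored out.
  refine ⟨K * (2 * L + N * C) + K * (4 * L + (3 * (N * C) +
    2 * (κ.toNNReal * (K * (2 * L + N * C))))), fun P hP W hW => ?_⟩
  have hs := Mem11.isSystem_sub hP hW
  have mk := (measurable_kern_sub hP hW).ennreal_ofReal
  have m1 := Mem11.measurable_rem₁ hW
  have m2 := Mem11.measurable_rem₂ hW
  obtain ⟨k, hk⟩ : ∃ k : ℝ → ℝ≥0∞, k = fun y => ENNReal.ofReal (kern (fun x => P.cA x - W.cA x)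
    (fun x => P.cB x - W.cB x) (fun x => P.cC x - W.cC x) (fun x => P.cD x - W.cD x) y) :=
    ⟨_, rfl⟩
  rw [← hk] at mk
  have hγ : ∫⁻ y, k y * C ≤ N * C * dist11 P W := by
    rw [lintegral_mul_const _ mk, mul_right_comm]
    exact mul_le_mul_left (by rw [hk]; exact hN P hP W hW) _
  have hg : ∀ y ≤ (0 : ℝ), eLpNorm (vsum
      (fun y z => (P.cA y - W.cA y) * W.rem₁ y z + (P.cB y - W.cB y) * W.rem₂ y z)
      (fun y z => (P.cC y - W.cC y) * W.rem₁ y z + (P.cD y - W.cD y) * W.rem₂ y z) y) 2 ≤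
      k y * C * rho y := fun y hy => by
    rw [mul_assoc, hk]
    exact (eLpNorm_vsum_coeff_le (fun x => P.cA x - W.cA x) (fun x => P.cB x - W.cB x)
      (fun x => P.cC x - W.cC x) (fun x => P.cD x - W.cD x) y m1 m2).trans
      (mul_le_mul_right (hC W hW y hy).1 _)
  have hgi : ∀ δ : ℝ, ∀ y ≤ (0 : ℝ), eLpNorm (vsum
      (incr δ fun y z => (P.cA y - W.cA y) * W.rem₁ y z + (P.cB y - W.cB y) * W.rem₂ y z)
      (incr δ fun y z => (P.cC y - W.cC y) * W.rem₁ y z + (P.cD y - W.cD y) * W.rem₂ y z) y) 2 ≤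
      k y * C * ‖δ‖ₑ := fun δ y hy => by
    rw [mul_assoc, hk, incr_coeff (fun y => P.cA y - W.cA y) fun y => P.cB y - W.cB y,
      incr_coeff (fun y => P.cC y - W.cC y) fun y => P.cD y - W.cD y]
    exact (eLpNorm_vsum_coeff_le (fun x => P.cA x - W.cA x) (fun x => P.cB x - W.cB x)
      (fun x => P.cC x - W.cC x) (fun x => P.cD x - W.cD x) y (measurable_incr m1 δ)
      (measurable_incr m2 δ)).trans (mul_le_mul_right ((hC W hW y hy).2 δ) _)
  have hfm : Measurable fun x => P.force x - W.force x :=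
    ((lip_force γ).meas P hP).sub ((lip_force γ).meas W hW)
  have hft := (lip_force γ).norm21_sub_ne_top hP hW
  refine fun x hx => ⟨?_, fun δ => ?_⟩
  · refine (hs.eLpNorm_le_rho (Mem11.isCoeff hP) (hκ P hP) hfm hft (hL P hP W hW)
      (mk.mul_const _) hγ hg hx).trans ((mul_le_of_le_one_right' (rho_le_one x)).trans ?_)
    rw [← hK]
    calc _ = (↑(K * (2 * L + N * C)) : ℝ≥0∞) * dist11 P W := by push_cast; ring
      _ ≤ _ := mul_le_mul_left (ENNReal.coe_le_coe.2 le_self_add) _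
  · refine (hs.eLpNorm_incr_le_rho (Mem11.isCoeff hP) (hκ P hP) hfm hft (hL P hP W hW)
      (mk.mul_const _) hγ hg hgi hx δ).trans (mul_le_mul_left ?_ _)
    rw [← hK, ENNReal.ofReal]
    calc _ = (↑(K * (4 * L + (3 * (N * C) + 2 * (κ.toNNReal * (K * (2 * L + N * C)))))) : ℝ≥0∞) *
          dist11 P W := by push_cast; ring
      _ ≤ _ := mul_le_mul_left (ENNReal.coe_le_coe.2 le_add_self) _

end Pot

/-! ### Integration by parts in oscillatory integrals -/

section

open Filter Topology

/-- A square integrable function need not vanish at -∞, but it cannot stay above 1/(n+1) on a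
half-line. A sequence is all that the boundary terms require. -/
theorem exists_seq_atBot_tendsto_zero {f G : ℝ → ℂ} (hf : MemLp f 2) (hG : f =ᵐ[volume] G) :
    ∃ t : ℕ → ℝ, Tendsto t atTop atBot ∧ Tendsto (fun n => G (t n)) atTop (𝓝 0) := by
  have h : ∀ n : ℕ, ∃ t : ℝ, t ≤ -n ∧ ‖G t‖ < 1 / ((n : ℝ) + 1) := fun n => by
    by_contra! hc
    refine not_memLp_two_of_le_norm hf (a := -n) (Nat.one_div_pos_of_nat (n := n)) ?_
    filter_upwards [hG] with x hx hxn
    rw [hx]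
    exact hc x hxn
  choose t ht ht' using h
  refine ⟨t, tendsto_atBot_mono ht (tendsto_neg_atTop_atBot.comp tendsto_natCast_atTop_atTop),
    squeeze_zero_norm (fun n => (ht' n).le) tendsto_one_div_add_atTop_nhds_zero_nat⟩

theorem exp_eq_add_intervalIntegral (z x y : ℝ) :
    Complex.exp (2 * Complex.I * z * (x - y)) = Complex.exp (2 * Complex.I * z * (x - (0 : ℝ))) +
      ∫ t in (0 : ℝ)..y, -(2 * Complex.I * z) * Complex.exp (2 * Complex.I * z * (x - t)) := by
  have hd : ∀ t : ℝ, HasDerivAt (fun y : ℝ => Complex.exp (2 * Complex.I * z * (x - y)))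
      (-(2 * Complex.I * z) * Complex.exp (2 * Complex.I * z * (x - t))) t := fun t => by
    have h1 : HasDerivAt (fun w : ℂ => Complex.exp (2 * Complex.I * z * (x - w)))
        (Complex.exp (2 * Complex.I * z * (x - t)) * (2 * Complex.I * z * (-1))) (t : ℂ) :=
      (((hasDerivAt_id (t : ℂ)).const_sub (x : ℂ)).const_mul (2 * Complex.I * z)).cexp
    convert h1.comp_ofReal using 1
    ring
  rw [intervalIntegral.integral_eq_sub_of_hasDerivAt (fun t _ => hd t)
    ((by fun_prop : Continuous fun t : ℝ => -(2 * Complex.I * z) *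
      Complex.exp (2 * Complex.I * z * (x - t))).intervalIntegrable _ _)]
  ring

theorem intervalIntegral_exp_mul_deriv {f' G : ℝ → ℂ} (h' : LocallyIntegrable f')
    (hG : ∀ x, G x = G 0 + ∫ t in (0 : ℝ)..x, f' t) {t x : ℝ} (htx : t ≤ x) (z : ℝ) :
    ∫ y in t..x, Complex.exp (2 * Complex.I * z * (x - y)) * f' y =
      G x - Complex.exp (2 * Complex.I * z * (x - t)) * G t +
        2 * Complex.I * z * ∫ y in t..x, Complex.exp (2 * Complex.I * z * (x - y)) * G y := by
  have hGc : Continuous G := by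
    rw [show G = fun x => G 0 + ∫ t in (0 : ℝ)..x, f' t from funext hG]
    exact continuous_const.add
      (intervalIntegral.continuous_primitive (intervalIntegrable_of_locallyIntegrable h') 0)
  have hE : Continuous fun y : ℝ => Complex.exp (2 * Complex.I * z * (x - y)) := by fun_prop
  have key := intervalIntegral_mul_add_mul
    (f := fun t : ℝ => -(2 * Complex.I * z) * Complex.exp (2 * Complex.I * z * (x - t)))
    (F := fun y : ℝ => Complex.exp (2 * Complex.I * z * (x - y)))
    (hE.const_mul _).locallyIntegrable h' (exp_eq_add_intervalIntegral z x) hG htx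
  have i1 : IntervalIntegrable (fun y : ℝ => -(2 * Complex.I * z) *
      Complex.exp (2 * Complex.I * z * (x - y)) * G y) volume t x :=
    ((hE.const_mul _).mul hGc).intervalIntegrable _ _
  rw [intervalIntegral.integral_add i1
    ((intervalIntegrable_of_locallyIntegrable h' t x).continuousOn_mul hE.continuousOn)] at key
  simp only [mul_assoc (-(2 * Complex.I * (z : ℂ)))] at key
  rw [intervalIntegral.integral_const_mul, sub_self, mul_zero, Complex.exp_zero, one_mul] at key
  linear_combination -key

/-- Integration by parts in an oscillatory integral gains a power of the frequency, up to the
boundary term. -/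
theorem eLpNorm_mul_oscInt_add_le {f f' : ℝ → ℂ} (h : HasWeakDeriv f f') (h1 : Integrable f)
    (h2 : MemLp f 2) (h' : MemLp f' 2) : ∀ᵐ x, eLpNorm (fun z : ℝ =>
      2 * Complex.I * z * oscInt f x z + f x) 2 ≤ 2 * eLpNorm f' 2 := by
  obtain ⟨c, hc⟩ := h.exists_primitive
  obtain ⟨G, hG⟩ : ∃ G : ℝ → ℂ, G = fun x => c + ∫ t in (0 : ℝ)..x, f' t := ⟨_, rfl⟩
  rw [← hG] at hc
  have hG0 : ∀ x, G x = G 0 + ∫ t in (0 : ℝ)..x, f' t := fun x => by simp [hG]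
  -- The derivative f' is only square integrable, so its oscillatory integral over (-∞, x] may fail
  -- to converge absolutely. The integrals `D n` over (t n, x] are used instead, and the boundary
  -- terms at t n disappear in the limit.
  obtain ⟨t, ht, hGt⟩ := exists_seq_atBot_tendsto_zero h2 hc
  filter_upwards [hc] with x hx
  have hgL : ∀ n, MemLp ((Ioc (t n) x).indicator f') 2 := fun n => h'.indicator measurableSet_Ioc
  have hgi : ∀ n, Integrable ((Ioc (t n) x).indicator f') := fun n => by
    rw [integrable_indicator_iff measurableSet_Ioc]
    exact (h'.restrict (Ioc (t n) x)).integrable one_le_two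
  obtain ⟨D, hD⟩ : ∃ D : ℕ → ℝ → ℂ, ∀ n z, D n z = ∫ y : ℝ,
      Complex.exp (2 * Complex.I * z * (x - y)) * (Ioc (t n) x).indicator f' y :=
    ⟨_, fun _ _ => rfl⟩
  have hDc : ∀ n, Continuous (D n) := fun n => by
    rw [funext (hD n)]
    refine continuous_of_dominated (fun z => (integrable_exp_mul (hgi n) x z).1)
      (fun z => Eventually.of_forall fun y => ?_) (hgi n).norm
      (Eventually.of_forall fun y => by fun_prop)
    rw [norm_mul, ← Complex.ofReal_sub, norm_exp_two_I_mul, one_mul]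
  have hDn : ∀ n, eLpNorm (D n) 2 ≤ 2 * eLpNorm f' 2 := fun n => by
    rw [funext (hD n)]
    exact (eLpNorm_oscillatory_le (hgi n) (hgL n) x).trans
      (mul_le_mul_right (eLpNorm_indicator_le _) _)
  have hlim : ∀ z, Tendsto (fun n => D n z) atTop
      (𝓝 (2 * Complex.I * z * oscInt f x z + f x)) := fun z => by
    rw [hx]
    have e : ∀ᶠ n in atTop, D n z = G x - Complex.exp (2 * Complex.I * z * (x - t n)) * G (t n) +
        2 * Complex.I * z * ∫ y in (t n)..x, Complex.exp (2 * Complex.I * z * (x - y)) * f y := by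
      filter_upwards [ht.eventually_le_atBot x] with n hn
      have e1 : ∫ y in (t n)..x, Complex.exp (2 * Complex.I * z * (x - y)) * f y =
          ∫ y in (t n)..x, Complex.exp (2 * Complex.I * z * (x - y)) * G y :=
        intervalIntegral.integral_congr_ae (hc.mono fun y hy _ => by rw [hy])
      rw [e1, ← intervalIntegral_exp_mul_deriv h.2.1 hG0 hn z, hD,
        intervalIntegral.integral_of_le hn, ← integral_indicator measurableSet_Ioc]
      congr 1
      funext y
      by_cases hy : y ∈ Ioc (t n) x
      · rw [indicator_of_mem hy, indicator_of_mem hy]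
      · rw [indicator_of_notMem hy, indicator_of_notMem hy, mul_zero]
    refine Tendsto.congr' (EventuallyEq.symm e) ?_
    have l1 : Tendsto (fun n => Complex.exp (2 * Complex.I * z * (x - t n)) * G (t n)) atTop
        (𝓝 0) := by
      refine squeeze_zero_norm (fun n => le_of_eq ?_) (tendsto_zero_iff_norm_tendsto_zero.1 hGt)
      rw [norm_mul, ← Complex.ofReal_sub, norm_exp_two_I_mul, one_mul]
    have l2 : Tendsto (fun n => ∫ y in (t n)..x, Complex.exp (2 * Complex.I * z * (x - y)) * f y)
        atTop (𝓝 (oscInt f x z)) :=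
      intervalIntegral_tendsto_integral_Iic x (integrable_exp_mul h1 x z).integrableOn ht
    have l3 := (l1.const_sub (G x)).add (l2.const_mul (2 * Complex.I * z))
    rwa [sub_zero, add_comm (G x)] at l3
  -- Fatou: the convergence is pointwise in z, and the bounds `hDn` are uniform in n.
  refine (Lp.eLpNorm_lim_le_liminf_eLpNorm (fun n => (hDc n).aestronglyMeasurable) _
    (Eventually.of_forall hlim)).trans ?_
  exact liminf_le_of_le (by isBoundedDefault) fun b hb =>
    let ⟨n, hn⟩ := hb.exists
    hn.trans (hDn n)

end

/-! ### The remainder of order 1/z -/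

section

open Complex (I)

/-- The forcing term in the system of the first order remainder. -/
def oscForce (f g : ℝ → ℂ) (x z : ℝ) : ℂ :=
  1 / (2 * I) * (2 * I * z * oscInt f x z + f x) + oscInt g x z

theorem measurable_mul_oscInt_add {f : ℝ → ℂ} (hm : Measurable f) (hi : Integrable f) :
    Measurable (Function.uncurry fun x z : ℝ => 2 * I * z * oscInt f x z + f x) :=
  (((Complex.measurable_ofReal.comp measurable_snd).const_mul (2 * I)).mul
    (measurable_oscInt hi hm)).add (hm.comp measurable_fst)

theorem measurable_oscForce {f g : ℝ → ℂ} (hf : Measurable f) (hfi : Integrable f)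
    (hg : Measurable g) (hgi : Integrable g) : Measurable (Function.uncurry (oscForce f g)) :=
  ((measurable_mul_oscInt_add hf hfi).const_mul _).add (measurable_oscInt hgi hg)

theorem oscForce_sub {f g f' g' : ℝ → ℂ} (hf : Integrable f) (hg : Integrable g)
    (hf' : Integrable f') (hg' : Integrable g') :
    (fun x z => oscForce f g x z - oscForce f' g' x z) =
      oscForce (fun x => f x - f' x) fun x => g x - g' x := by
  funext x z
  simp only [oscForce]
  rw [← oscInt_sub hf hf', ← oscInt_sub hg hg']
  ring

theorem enorm_one_div_two_I_le : ‖1 / (2 * I)‖ₑ ≤ 1 := by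
  rw [← ofReal_norm, ← ENNReal.ofReal_one]
  refine ENNReal.ofReal_le_ofReal ?_
  norm_num

/-- Integration by parts handles the first part and Plancherel the second. Neither needs decay in x,
so almost every x on the whole line is covered. -/
theorem eLpNorm_oscForce_le {f f' g : ℝ → ℂ} (h : HasWeakDeriv f f') (hf : Measurable f)
    (hf21 : norm21 f ≠ ⊤) (hf' : MemLp f' 2) (hg : Measurable g) (hg21 : norm21 g ≠ ⊤) :
    ∀ᵐ x, eLpNorm (oscForce f g x) 2 ≤ 2 * eLpNorm f' 2 + 2 * norm21 g := by
  have hfi := integrable_of_norm21 hf.aestronglyMeasurable hf21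
  have hgi := integrable_of_norm21 hg.aestronglyMeasurable hg21
  filter_upwards [eLpNorm_mul_oscInt_add_le h hfi (memLp_of_norm21 hf.aestronglyMeasurable hf21)
    hf'] with x hx
  have m1 : Measurable fun z : ℝ => 2 * I * z * oscInt f x z + f x :=
    (measurable_mul_oscInt_add hf hfi).of_uncurry_left
  have m2 : Measurable (oscInt g x) := (measurable_oscInt hgi hg).of_uncurry_left
  have e : oscForce f g x = (1 / (2 * I)) • (fun z : ℝ => 2 * I * z * oscInt f x z + f x) +
      oscInt g x := by
    funext z
    simp only [oscForce, Pi.add_apply, Pi.smul_apply, smul_eq_mul]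
  rw [e]
  refine (eLpNorm_add_le (m1.const_smul _).aestronglyMeasurable m2.aestronglyMeasurable
    one_le_two).trans (add_le_add ?_ ?_)
  · rw [eLpNorm_const_smul]
    exact (mul_le_of_le_one_left' enorm_one_div_two_I_le).trans hx
  · refine (eLpNorm_oscInt_le hgi (memLp_of_norm21 hg.aestronglyMeasurable hg21) x).trans
      (mul_le_mul_right ?_ 2)
    exact (eLpNorm_mono_measure _ Measure.restrict_le_self).trans (eLpNorm_le_norm21 g)

/-- Needed because `lead₂` contains r', which is square integrable but not bounded under the H^{1,1}
assumptions: Cauchy–Schwarz replaces the sup bound. -/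
theorem integrable_kern_mul_of_memLp {a b c d p : ℝ → ℂ} (ha : MemLp a 2) (hb : MemLp b 2)
    (hc : MemLp c 2) (hd : MemLp d 2) (hp : MemLp p 2) :
    Integrable fun y => kern a b c d y * ‖p y‖ := by
  have h := ((ha.norm.add hb.norm).add hc.norm).add hd.norm
  have e : (((fun y => ‖a y‖) + fun y => ‖b y‖) + fun y => ‖c y‖) + (fun y => ‖d y‖) =
    kern a b c d := rfl
  rw [e] at h
  exact h.integrable_mul hp.norm

theorem LipBdd.memLp_of_one {ι : Type*} {D : Set ι} {d : ι → ι → ℝ≥0∞} {Φ : ι → ℝ → ℂ}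
    (h : LipBdd 1 2 D d Φ) {u : ι} (hu : u ∈ D) : MemLp (Φ u) 2 := h.to_L2.memLp hu

namespace Pot

/-- The density in the first component of the coefficient of order one. -/
def leadDensity (P : Pot) (x : ℝ) : ℂ :=
  P.q x * P.r' x - 1 / (2 * I) * (P.q x * (P.q x * (P.r x * P.r x)))

/-- The first component of the coefficient of order one at large spectral parameters. -/
def lead₁ (P : Pot) (x : ℝ) : ℂ := 1 / 4 * (P.mInf x * ∫ y in Iic x, P.leadDensity y)

/-- The second component of the coefficient of order one at large spectral parameters. -/
def lead₂ (P : Pot) (x : ℝ) : ℂ := -(1 / (2 * I)) * P.force x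

/-- The derivative of the lower left entry of the matrix of the system. -/
def cC' (P : Pot) (x : ℝ) : ℂ := P.r'' x - 1 / (2 * I) *
  (P.q' x * (P.r x * P.r x) + P.q x * (P.r' x * P.r x + P.r x * P.r' x))

/-- The derivative of the density of the leading oscillatory integral. -/
def force' (P : Pot) (x : ℝ) : ℂ := P.cA x * P.mInf x * P.cC x + P.mInf x * P.cC' x

/-- The density of the oscillatory integral of order one. -/
def leadForce (P : Pot) (x : ℝ) : ℂ := P.lead₁ x * P.cC x + P.cD x * P.lead₂ x

section

variable (γ : ℝ≥0)

theorem sup_qr : LipBdd 0 ⊤ (ball11 γ) dist11 (fun P x => P.q x * P.r x) :=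
  (sup_q γ).mul le_top (sup_r γ)

theorem lip_leadDensity : LipBdd 1 2 (ball11 γ) dist11 leadDensity :=
  ((sup_q γ).mul one_le_two (lip_r' γ)).sub one_le_two
    (((sup_q γ).mul one_le_two ((sup_q γ).mul one_le_two ((sup_r γ).mul one_le_two
      (lip_r γ)))).const_mul _)

theorem sup_lead₁ : LipBdd 0 ⊤ (ball11 γ) dist11 lead₁ :=
  ((sup_mInf γ).mul le_top (lip_leadDensity γ).primitive).const_mul _

theorem lip_lead₂ : LipBdd 1 2 (ball11 γ) dist11 lead₂ := (lip_force γ).const_mul _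

theorem lip_leadForce : LipBdd 1 2 (ball11 γ) dist11 leadForce :=
  ((sup_lead₁ γ).mul one_le_two (lip_cC γ)).add one_le_two
    (((sup_qr γ).const_mul _).mul one_le_two (lip_lead₂ γ))

theorem lip_cC' : LipBdd 0 2 (ball2 γ) dist2 cC' := by
  have h1 := ((sup_r γ).mul le_top (sup_r γ)).mul one_le_two (lip_q' γ)
  have h2 := (sup_r γ).mul one_le_two (lip_r' γ)
  have h3 := (sup_q γ).mul one_le_two (h2.add one_le_two h2)
  have h4 := ((((h1.add one_le_two h3).const_mul (1 / (2 * I))).to_L2).mono (ball2_subset γ)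
    dist11_le_dist2)
  have h5 := (lip_r'' γ).sub one_le_two h4
  have e : cC' = fun P x => P.r'' x - 1 / (2 * I) * (P.r x * P.r x * P.q' x +
      P.q x * (P.r x * P.r' x + P.r x * P.r' x)) := by
    funext P x; simp only [cC']; ring
  rw [e]
  exact h5

theorem lip_force' : LipBdd 0 2 (ball2 γ) dist2 force' := by
  have h1 := ((((sup_qr γ).const_mul (-(1 / (2 * I)))).mul le_top (sup_mInf γ)).mul one_le_two
    (lip_cC γ)).to_L2.mono (ball2_subset γ) dist11_le_dist2
  exact h1.add one_le_two (((sup_mInf γ).mono (ball2_subset γ) dist11_le_dist2).mul one_le_two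
    (lip_cC' γ))

end

variable {γ : ℝ≥0} {P W : Pot}

theorem Mem11.hasWeakDeriv_mInf (h : P.Mem11 γ) :
    HasWeakDeriv P.mInf fun x => P.cA x * P.mInf x := by
  have hi := integrable_cA_mul_mInf h
  refine hasWeakDeriv_of_primitive hi.locallyIntegrable fun x => ?_
  rw [← intervalIntegral.integral_Iic_sub_Iic hi.integrableOn hi.integrableOn, mInf_eq h x,
    mInf_eq h 0]
  ring

theorem Mem2.hasWeakDeriv_cC (h : P.Mem2 γ) : HasWeakDeriv P.cC P.cC' :=
  h.dr'.sub ((h.dq.mul (h.dr.mul h.dr)).const_mul (1 / (2 * I)))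

theorem Mem2.hasWeakDeriv_force (h : P.Mem2 γ) : HasWeakDeriv P.force P.force' :=
  h.hasWeakDeriv_mInf.mul h.hasWeakDeriv_cC

/-- This equation dictates `lead₁`. As `leadDensity` is q c and (1/2i)² = -1/4, the product b ·
lead₂ equals (1/4) mInf · leadDensity, so variation of constants gives mInf times the primitive of
(1/4) leadDensity. -/
theorem Mem11.lead₁_eq (h : P.Mem11 γ) (x : ℝ) :
    P.lead₁ x = ∫ y in Iic x, (P.cA y * P.lead₁ y + P.cB y * P.lead₂ y) := by
  have hi := integrable_cA_mul_mInf h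
  have hs := (lip_leadDensity γ).integrable h
  have i2 : Integrable fun y => P.mInf y * P.leadDensity y :=
    ((sup_mInf γ).mul one_le_two (lip_leadDensity γ)).integrable h
  have i1 : Integrable fun y => P.cA y * P.mInf y * (∫ t in Iic y, P.leadDensity t) +
      (P.mInf y - 1) * P.leadDensity y := by
    have h1 := (((lip_leadDensity γ).primitive.mul le_top (sup_mInf γ)).mul one_le_two
      (lip_cA γ)).integrable h
    refine (h1.add (i2.sub hs)).congr (Filter.Eventually.of_forall fun y => ?_)
    simp only [Pi.add_apply, Pi.sub_apply]
    ring
  -- The factor that is a primitive from -∞ is mInf - 1, not mInf, since mInf tends to 1 there; the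
  -- missing term is added back in `e2`.
  have key := setIntegral_Iic_mul_setIntegral_Iic hi hs x
  have e : ∀ y, ∫ t in Iic y, P.cA t * P.mInf t = P.mInf y - 1 := fun y => by
    rw [mInf_eq h y]; ring
  simp only [e] at key
  have e2 : P.mInf x * ∫ y in Iic x, P.leadDensity y =
      ∫ y in Iic x, (P.cA y * P.mInf y * (∫ t in Iic y, P.leadDensity t) +
        P.mInf y * P.leadDensity y) := by
    calc _ = (P.mInf x - 1) * (∫ y in Iic x, P.leadDensity y) +
          ∫ y in Iic x, P.leadDensity y := by ring
      _ = _ := by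
          rw [key, ← integral_add i1.restrict hs.restrict]
          congr 1; funext y; ring
  rw [lead₁, e2, ← integral_const_mul]
  congr 1
  funext y
  have hI : (1 / (2 * I)) * (1 / (2 * I)) = -(1 / 4 : ℂ) := by
    field_simp
    rw [Complex.I_sq]; norm_num
  simp only [lead₁, lead₂, force, cB, cC, leadDensity]
  linear_combination (P.q y * P.mInf y * (P.r' y - 1 / (2 * I) * (P.q y * (P.r y * P.r y)))) * hI

/-- The first component of the first order remainder. -/
def rem'₁ (P : Pot) (x z : ℝ) : ℂ := z * P.rem₁ x z - P.lead₁ x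

/-- The second component of the first order remainder. -/
def rem'₂ (P : Pot) (x z : ℝ) : ℂ := z * P.rem₂ x z - P.lead₂ x

theorem Mem11.measurable_rem'₁ (h : P.Mem11 γ) : Measurable (Function.uncurry P.rem'₁) :=
  ((Complex.measurable_ofReal.comp measurable_snd).mul h.measurable_rem₁).sub
    (((sup_lead₁ γ).meas P h).comp measurable_fst)

theorem Mem11.measurable_rem'₂ (h : P.Mem11 γ) : Measurable (Function.uncurry P.rem'₂) :=
  ((Complex.measurable_ofReal.comp measurable_snd).mul h.measurable_rem₂).sub
    (((lip_lead₂ γ).meas P h).comp measurable_fst)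

theorem Mem11.integrable_kern_rem' (h : P.Mem11 γ) (hW : W.Mem11 γ) (z : ℝ) :
    (Integrable fun y => kern W.cA W.cB W.cC W.cD y * ‖P.rem'₁ y z‖) ∧
      Integrable fun y => kern W.cA W.cB W.cC W.cD y * ‖P.rem'₂ y z‖ := by
  have hc := hW.isCoeff
  have i := h.integrable_kern_rem hc z
  obtain ⟨C, hC⟩ := (sup_lead₁ γ).ae_norm_le
  have j1 := integrable_kern_mul hc ((sup_lead₁ γ).meas P h) (hC P h)
  have j2 := integrable_kern_mul_of_memLp ((lip_cA γ).memLp_of_one hW)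
    ((lip_cB γ).memLp_of_one hW) ((lip_cC γ).memLp_of_one hW) ((lip_cD γ).memLp_of_one hW)
    ((lip_lead₂ γ).memLp_of_one h)
  have key : ∀ {p l : ℝ → ℂ}, Measurable (fun y => (z : ℂ) * p y - l y) →
      (Integrable fun y => kern W.cA W.cB W.cC W.cD y * ‖p y‖) →
      (Integrable fun y => kern W.cA W.cB W.cC W.cD y * ‖l y‖) →
      Integrable fun y => kern W.cA W.cB W.cC W.cD y * ‖(z : ℂ) * p y - l y‖ := by
    intro p l hm hp hl
    refine ((hp.const_mul ‖(z : ℂ)‖).add hl).mono'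
      (hc.measurable_kern.mul hm.norm).aestronglyMeasurable
      (Filter.Eventually.of_forall fun y => ?_)
    have h0 := kern_nonneg W.cA W.cB W.cC W.cD y
    rw [Real.norm_of_nonneg (by positivity), Pi.add_apply]
    calc _ ≤ kern W.cA W.cB W.cC W.cD y * (‖(z : ℂ)‖ * ‖p y‖ + ‖l y‖) := by
          refine mul_le_mul_of_nonneg_left ((norm_sub_le _ _).trans ?_) h0
          rw [norm_mul]
      _ = _ := by ring
  exact ⟨key h.measurable_rem'₁.of_uncurry_right i.1 j1,
    key h.measurable_rem'₂.of_uncurry_right i.2 j2⟩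

/-- The Volterra system of the first order remainder. -/
theorem Mem11.isSystem' (h : P.Mem11 γ) : IsSystem P.cA P.cB P.cC P.cD
    (oscForce P.force P.leadForce) (fun _ _ => 0) (fun _ _ => 0) P.rem'₁ P.rem'₂ := by
  have hs := h.isSystem
  have hc := h.isCoeff
  have fi := (lip_force γ).integrable h
  have gi := (lip_leadForce γ).integrable h
  have i := h.integrable_kern_rem' h
  have k := norm_le_kern P.cA P.cB P.cC P.cD
  refine ⟨measurable_oscForce ((lip_force γ).meas P h) fi ((lip_leadForce γ).meas P h) gi,
    measurable_const, measurable_const, h.measurable_rem'₁, h.measurable_rem'₂,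
    fun z => (i z).1, fun z => (i z).2,
    fun z => integrable_zero _ _ _, fun z => integrable_zero _ _ _, fun x z => ?_, fun x z => ?_⟩
  · have i1 : Integrable fun y => P.cA y * P.lead₁ y + P.cB y * P.lead₂ y := by
      have h1 := ((sup_lead₁ γ).mul one_le_two (lip_cA γ)).integrable h
      have h2 : Integrable fun y => P.cB y * P.lead₂ y :=
        (((sup_q γ).const_mul (1 / (2 * I))).mul one_le_two (lip_lead₂ γ)).integrable h
      refine (h1.add h2).congr (Filter.Eventually.of_forall fun y => ?_)
      simp only [Pi.add_apply]; ring
    rw [rem'₁, hs.eq₁ x z, h.lead₁_eq x, ← integral_const_mul,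
      ← integral_sub ((hs.integrable₁ hc z).const_mul _).restrict i1.restrict]
    congr 1; funext y; simp only [rem'₁, rem'₂]; ring
  · have i2 : Integrable fun y => P.cC y * P.rem'₁ y z + P.cD y * P.rem'₂ y z + 0 := by
      refine (((hs.integrable₂ hc z).const_mul (z : ℂ)).sub gi).congr
        (Filter.Eventually.of_forall fun y => ?_)
      simp only [Pi.sub_apply, rem'₁, rem'₂, leadForce]; ring
    -- Under the integral z · rem = rem' + lead, and c lead₁ + d lead₂ is the density `leadForce`.
    have e : (z : ℂ) * ∫ y in Iic x, Complex.exp (2 * Complex.I * z * (x - y)) *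
        (P.cC y * P.rem₁ y z + P.cD y * P.rem₂ y z + 0) = oscInt P.leadForce x z +
        ∫ y in Iic x, Complex.exp (2 * Complex.I * z * (x - y)) *
          (P.cC y * P.rem'₁ y z + P.cD y * P.rem'₂ y z + 0) := by
      rw [oscInt, ← integral_const_mul, ← integral_add (integrable_exp_mul gi x z).restrict
        (integrable_exp_mul i2 x z).restrict]
      congr 1; funext y; simp only [rem'₁, rem'₂, leadForce]; ring
    -- With lead₂ = -(1/2i) force, the terms z · oscInt force - lead₂ combine into (1/2i)(2iz ·
    -- oscInt force + force), the form suited to integration by parts.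
    have hI : 1 / (2 * I) * (2 * I) = 1 := by
      field_simp
    rw [rem'₂, hs.eq₂ x z, mul_add, e, oscForce, lead₂]
    linear_combination -(z * oscInt P.force x z) * hI

theorem exists_oscForce_bound (γ : ℝ≥0) : ∃ C : ℝ≥0, ∀ P ∈ ball2 γ,
    ∀ᵐ x, eLpNorm (oscForce P.force P.leadForce x) 2 ≤ C := by
  obtain ⟨F, hF⟩ := (lip_force' γ).bdd
  obtain ⟨G, hG⟩ := (lip_leadForce γ).bdd
  refine ⟨2 * F + 2 * G, fun P hP => ?_⟩
  have h1 := ball2_subset γ hP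
  have hF' := hF P hP
  rw [weighted_zero] at hF'
  filter_upwards [eLpNorm_oscForce_le (Mem2.hasWeakDeriv_force hP) ((lip_force γ).meas P h1)
    ((lip_force γ).norm21_ne_top h1) ((lip_force' γ).memLp hP) ((lip_leadForce γ).meas P h1)
    ((lip_leadForce γ).norm21_ne_top h1)] with x hx
  refine hx.trans ?_
  push_cast
  exact add_le_add (mul_le_mul_right hF' 2) (mul_le_mul_right (hG P h1) 2)

theorem exists_oscForce_lip (γ : ℝ≥0) : ∃ C : ℝ≥0, ∀ P ∈ ball2 γ, ∀ W ∈ ball2 γ,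
    ∀ᵐ x, eLpNorm (oscForce (fun x => P.force x - W.force x)
      (fun x => P.leadForce x - W.leadForce x) x) 2 ≤ C * dist2 P W := by
  obtain ⟨F, hF⟩ := (lip_force' γ).lip
  obtain ⟨G, hG⟩ := (lip_leadForce γ).lip
  refine ⟨2 * F + 2 * G, fun P hP W hW => ?_⟩
  have h1 := ball2_subset γ hP
  have h2 := ball2_subset γ hW
  have hF' := hF P hP W hW
  rw [weighted_zero] at hF'
  filter_upwards [eLpNorm_oscForce_le
    ((Mem2.hasWeakDeriv_force hP).sub (Mem2.hasWeakDeriv_force hW))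
    (((lip_force γ).meas P h1).sub ((lip_force γ).meas W h2))
    ((lip_force γ).norm21_sub_ne_top h1 h2)
    (((lip_force' γ).memLp hP).sub ((lip_force' γ).memLp hW))
    (((lip_leadForce γ).meas P h1).sub ((lip_leadForce γ).meas W h2))
    ((lip_leadForce γ).norm21_sub_ne_top h1 h2)] with x hx
  refine hx.trans ?_
  calc _ ≤ 2 * (F * dist2 P W) + 2 * (G * dist2 P W) :=
        add_le_add (mul_le_mul_right hF' 2) (mul_le_mul_right ((hG P h1 W h2).trans
          (mul_le_mul_right (dist11_le_dist2 P W) _)) 2)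
    _ = _ := by push_cast; ring

theorem exists_rem'_bound (γ : ℝ≥0) : ∃ C : ℝ≥0, ∀ P ∈ ball2 γ,
    ∀ᵐ x, eLpNorm (vsum P.rem'₁ P.rem'₂ x) 2 ≤ C := by
  obtain ⟨κ, -, hκ⟩ := exists_kern_bound γ
  obtain ⟨H, hH⟩ := exists_oscForce_bound γ
  obtain ⟨K, hK⟩ : ∃ K : ℝ≥0, (K : ℝ≥0∞) = gconst κ :=
    ⟨_, ENNReal.coe_toNNReal (gconst_ne_top κ)⟩
  refine ⟨K * H, fun P hP => ?_⟩
  have h1 := ball2_subset γ hP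
  filter_upwards [hH P hP] with x hx
  refine ((Mem11.isSystem' h1).eLpNorm_le (Mem11.isCoeff h1) (hκ P h1) hx
    ((hH P hP).mono fun y hy _ => hy) (B := 0) ?_).trans ?_
  · simp [vsum_zero]
  · rw [← hK, add_zero, ENNReal.coe_mul]

theorem Mem11.isSystem'_sub (hP : P.Mem11 γ) (hW : W.Mem11 γ) :
    IsSystem P.cA P.cB P.cC P.cD (oscForce (fun x => P.force x - W.force x)
        fun x => P.leadForce x - W.leadForce x)
      (fun y z => (P.cA y - W.cA y) * W.rem'₁ y z + (P.cB y - W.cB y) * W.rem'₂ y z)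
      (fun y z => (P.cC y - W.cC y) * W.rem'₁ y z + (P.cD y - W.cD y) * W.rem'₂ y z)
      (fun x z => P.rem'₁ x z - W.rem'₁ x z) (fun x z => P.rem'₂ x z - W.rem'₂ x z) := by
  have i := hW.integrable_kern_rem' hP
  have h := hP.isSystem'.sub hP.isCoeff hW.isSystem' hW.isCoeff (fun z => (i z).1)
    fun z => (i z).2
  rw [oscForce_sub ((lip_force γ).integrable hP) ((lip_leadForce γ).integrable hP)
    ((lip_force γ).integrable hW) ((lip_leadForce γ).integrable hW)] at h
  simpa only [sub_zero, zero_add] using h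

theorem exists_rem'_lip (γ : ℝ≥0) : ∃ C : ℝ≥0, ∀ P ∈ ball2 γ, ∀ W ∈ ball2 γ,
    ∀ᵐ x, eLpNorm (vsum (fun x z => P.rem'₁ x z - W.rem'₁ x z)
      (fun x z => P.rem'₂ x z - W.rem'₂ x z) x) 2 ≤ C * dist2 P W := by
  obtain ⟨κ, -, hκ⟩ := exists_kern_bound γ
  obtain ⟨L, hL⟩ := exists_oscForce_lip γ
  obtain ⟨C, hC⟩ := exists_rem'_bound γ
  obtain ⟨-, ⟨N, hN⟩⟩ := lintegral_kern_le (lip_cA γ) (lip_cB γ) (lip_cC γ) (lip_cD γ)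
  obtain ⟨K, hK⟩ : ∃ K : ℝ≥0, (K : ℝ≥0∞) = gconst κ :=
    ⟨_, ENNReal.coe_toNNReal (gconst_ne_top κ)⟩
  refine ⟨K * (L + N * C), fun P hP W hW => ?_⟩
  have h1 := ball2_subset γ hP
  have h2 := ball2_subset γ hW
  have hs := Mem11.isSystem'_sub h1 h2
  have mk := (measurable_kern_sub h1 h2).ennreal_ofReal
  have hg : ∀ᵐ y, eLpNorm (vsum
      (fun y z => (P.cA y - W.cA y) * W.rem'₁ y z + (P.cB y - W.cB y) * W.rem'₂ y z)
      (fun y z => (P.cC y - W.cC y) * W.rem'₁ y z + (P.cD y - W.cD y) * W.rem'₂ y z) y) 2 ≤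
      ENNReal.ofReal (kern (fun x => P.cA x - W.cA x) (fun x => P.cB x - W.cB x)
        (fun x => P.cC x - W.cC x) (fun x => P.cD x - W.cD x) y) * C := by
    filter_upwards [hC W hW] with y hy
    exact (eLpNorm_vsum_coeff_le (fun x => P.cA x - W.cA x) (fun x => P.cB x - W.cB x)
      (fun x => P.cC x - W.cC x) (fun x => P.cD x - W.cD x) y (Mem11.measurable_rem'₁ h2)
      (Mem11.measurable_rem'₂ h2)).trans (mul_le_mul_right hy _)
  have hB := lintegral_mono_ae hg
  rw [lintegral_mul_const _ mk] at hB
  filter_upwards [hL P hP W hW] with x hx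
  refine (hs.eLpNorm_le (Mem11.isCoeff h1) (hκ P h1) hx ((hL P hP W hW).mono fun y hy _ => hy)
    ((setLIntegral_le_lintegral _ _).trans (hB.trans (mul_le_mul_left
      ((hN P h1 W h2).trans (mul_le_mul_right (dist11_le_dist2 P W) _)) _)))).trans ?_
  rw [← hK]
  exact le_of_eq (by push_cast; ring)

end Pot

end

/-! ### Symmetries: reflection, exchange of components, and the passage from u to the pair of
potentials -/

section

open Complex (I)

/-- The sign of the reflection which turns the two half-lines into the negative one. -/
def Side.sgn : Side → ℝ
  | .plus => -1
  | .minus => 1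

namespace Side

theorem sgn_mul_sgn (s : Side) : s.sgn * s.sgn = 1 := by cases s <;> simp [sgn]

theorem sgn_mul_sgn_mul (s : Side) (x : ℝ) : s.sgn * (s.sgn * x) = x := by
  rw [← mul_assoc, sgn_mul_sgn, one_mul]

theorem ofReal_sgn_mul_sgn (s : Side) : (s.sgn : ℂ) * s.sgn = 1 := by
  rw [← Complex.ofReal_mul, sgn_mul_sgn, Complex.ofReal_one]

theorem enorm_sgn (s : Side) : ‖(s.sgn : ℂ)‖ₑ = 1 := by cases s <;> simp [sgn]

theorem measurePreserving (s : Side) :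
    MeasurePreserving (fun x : ℝ => s.sgn * x) volume volume := by
  cases s
  · simpa only [sgn, neg_one_mul] using Measure.measurePreserving_neg (volume : Measure ℝ)
  · simp only [sgn, one_mul]
    exact MeasurePreserving.id _

/-- Substituting y ↦ s.sgn * y makes every integral start at -∞; the sign in front is the minus of
the integral from +∞. -/
theorem integral_eq {E : Type*} [NormedAddCommGroup E] [NormedSpace ℝ E] (s : Side) (x : ℝ)
    (f : ℝ → E) : s.integral x f = s.sgn • ∫ y in Iic (s.sgn * x), f (s.sgn * y) := by
  cases s
  · simp only [Side.integral, sgn, neg_one_mul, neg_smul, one_smul]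
    rw [integral_comp_neg_Iic, neg_neg]
  · simp only [Side.integral, sgn, one_mul, one_smul]

theorem integral_congr_ae {E : Type*} [NormedAddCommGroup E] [NormedSpace ℝ E] (s : Side) (x : ℝ)
    {f g : ℝ → E} (h : f =ᵐ[volume] g) : s.integral x f = s.integral x g := by
  cases s
  · simp only [Side.integral]
    rw [MeasureTheory.integral_congr_ae (ae_restrict_of_ae h)]
  · simp only [Side.integral]
    rw [MeasureTheory.integral_congr_ae (ae_restrict_of_ae h)]

theorem integral_apply (s : Side) (x : ℝ) {f : ℝ → Fin 2 → ℂ}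
    (h : ∀ i, Integrable fun y => f y i) (i : Fin 2) :
    s.integral x f i = s.integral x fun y => f y i := by
  cases s
  · simp only [Side.integral, Pi.neg_apply]
    rw [eval_integral fun j => (h j).restrict]
  · simp only [Side.integral]
    rw [eval_integral fun j => (h j).restrict]

end Side

theorem HasWeakDeriv.comp_sgn {f g : ℝ → ℂ} (h : HasWeakDeriv f g) (s : Side) :
    HasWeakDeriv (fun x => f (s.sgn * x)) fun x => s.sgn * g (s.sgn * x) := by
  cases s
  · simpa [Side.sgn] using h.comp_neg
  · simpa [Side.sgn] using h

theorem norm21_comp_sgn {f : ℝ → ℂ} (hf : AEStronglyMeasurable f) (s : Side) :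
    norm21 (fun x => f (s.sgn * x)) = norm21 f := by
  have e : weighted 1 (fun x => f (s.sgn * x)) = weighted 1 f ∘ fun x => s.sgn * x := by
    funext x
    simp only [weighted, Function.comp_apply, mul_pow, pow_two s.sgn, Side.sgn_mul_sgn, one_mul]
  rw [norm21, e, eLpNorm_comp_measurePreserving (aestronglyMeasurable_weighted 1 hf)
    s.measurePreserving, norm21]

theorem eLpNorm_comp_sgn {f : ℝ → ℂ} (hf : AEStronglyMeasurable f) (s : Side) :
    eLpNorm (fun x => f (s.sgn * x)) 2 = eLpNorm f 2 :=
  eLpNorm_comp_measurePreserving hf s.measurePreserving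

theorem norm21_const_mul (c : ℂ) (f : ℝ → ℂ) : norm21 (fun x => c * f x) = ‖c‖ₑ * norm21 f := by
  have e : weighted 1 (fun x => c * f x) = c • weighted 1 f := by
    funext x
    rw [weighted, Pi.smul_apply, weighted, smul_eq_mul, mul_smul_comm]
  rw [norm21, e, eLpNorm_const_smul, norm21]

theorem eLpNorm_const_mul (c : ℂ) (f : ℝ → ℂ) :
    eLpNorm (fun x => c * f x) 2 = ‖c‖ₑ * eLpNorm f 2 :=
  eLpNorm_const_smul c f 2 volume

theorem norm21_congr {f g : ℝ → ℂ} (h : f =ᵐ[volume] g) : norm21 f = norm21 g :=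
  eLpNorm_congr_ae (h.mono fun x hx => by rw [weighted, weighted, hx])

theorem norm21_neg (f : ℝ → ℂ) : norm21 (-f) = norm21 f := by
  have := norm21_const_mul (-1) f
  rw [enorm_neg, enorm_one, one_mul] at this
  rw [← this]
  congr 1; funext x; simp

section vOf

variable {σ : ℝ} (hσ : σ = 1 ∨ σ = -1)

theorem vOf_sub (σ : ℝ) (f g : ℝ → ℂ) : vOf σ f - vOf σ g = vOf σ (f - g) := by
  funext x
  simp only [vOf, Pi.sub_apply, map_sub]
  ring

theorem vOf_congr (σ : ℝ) {f g : ℝ → ℂ} (h : f =ᵐ[volume] g) : vOf σ f =ᵐ[volume] vOf σ g := by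
  have := (Measure.measurePreserving_neg (volume : Measure ℝ)).quasiMeasurePreserving.ae_eq h
  filter_upwards [this] with x hx
  simp only [Function.comp_apply] at hx
  rw [vOf, vOf, hx]

theorem measurable_vOf (σ : ℝ) {f : ℝ → ℂ} (hf : Measurable f) : Measurable (vOf σ f) :=
  (Complex.continuous_conj.measurable.comp (hf.comp measurable_neg)).const_mul _

theorem HasWeakDeriv.vOf {f g : ℝ → ℂ} (h : HasWeakDeriv f g) (σ : ℝ) :
    HasWeakDeriv (vOf σ f) (-vOf σ g) := by
  have h1 := (h.comp_neg.clm_comp (Complex.conjCLE : ℂ →L[ℝ] ℂ)).const_mul (I * σ)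
  refine h1.congr (Filter.Eventually.of_forall fun x => rfl)
    (Filter.Eventually.of_forall fun x => ?_)
  simp [NDNLS.vOf]

include hσ

theorem enorm_vOf (f : ℝ → ℂ) (x : ℝ) : ‖vOf σ f x‖ₑ = ‖f (-x)‖ₑ := by
  have h1 : ‖vOf σ f x‖ = ‖f (-x)‖ := by
    rcases hσ with rfl | rfl <;> simp [vOf]
  rw [← ofReal_norm, h1, ofReal_norm]

theorem norm21_vOf {f : ℝ → ℂ} (hf : AEStronglyMeasurable f) : norm21 (vOf σ f) = norm21 f := by
  rw [← norm21_comp_sgn hf Side.plus]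
  refine eLpNorm_congr_enorm_ae (Filter.Eventually.of_forall fun x => ?_)
  rw [enorm_weighted_one, enorm_weighted_one, enorm_vOf hσ, Side.sgn, neg_one_mul]

theorem eLpNorm_vOf {f : ℝ → ℂ} (hf : AEStronglyMeasurable f) :
    eLpNorm (vOf σ f) 2 = eLpNorm f 2 := by
  rw [← eLpNorm_comp_sgn hf Side.plus]
  refine eLpNorm_congr_enorm_ae (Filter.Eventually.of_forall fun x => ?_)
  rw [enorm_vOf hσ, Side.sgn, neg_one_mul]

end vOf

open Classical in
/-- A measurable representative. -/
def rep (f : ℝ → ℂ) : ℝ → ℂ := if h : AEMeasurable f then h.mk f else 0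

theorem measurable_rep (f : ℝ → ℂ) : Measurable (rep f) := by
  rw [rep]
  split_ifs with h
  · exact h.measurable_mk
  · exact measurable_const

theorem rep_ae_eq {f : ℝ → ℂ} (h : AEStronglyMeasurable f) : rep f =ᵐ[volume] f := by
  rw [rep, dif_pos h.aemeasurable]
  exact h.aemeasurable.ae_eq_mk.symm

namespace Pot

/-- The data of the system for the Jost functions `ν`. -/
def swapNeg (P : Pot) : Pot where
  q := P.r
  q' := P.r'
  q'' := P.r''
  r := -P.q
  r' := -P.q'
  r'' := -P.q''

/-- The data of the system after the reflection to the negative half-line. -/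
def side (s : Side) (P : Pot) : Pot where
  q x := s.sgn * P.q (s.sgn * x)
  q' x := P.q' (s.sgn * x)
  q'' x := s.sgn * P.q'' (s.sgn * x)
  r x := P.r (s.sgn * x)
  r' x := s.sgn * P.r' (s.sgn * x)
  r'' x := P.r'' (s.sgn * x)

/-- The data of the system for the Jost functions `μ`. -/
def ofFun (σ : ℝ) (u : ℝ → ℂ) : Pot where
  q := rep u
  q' := rep (weakDeriv u)
  q'' := rep (weakDeriv (weakDeriv u))
  r := vOf σ (rep u)
  r' := -vOf σ (rep (weakDeriv u))
  r'' := vOf σ (rep (weakDeriv (weakDeriv u)))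

variable {γ : ℝ≥0} {P W : Pot}

theorem Mem11.swapNeg (h : P.Mem11 γ) : P.swapNeg.Mem11 γ :=
  ⟨h.mr, h.mr', h.mq.neg, h.mq'.neg, h.dr, h.dq.neg, h.nr, h.nr', (norm21_neg _).trans_le h.nq,
    (norm21_neg _).trans_le h.nq'⟩

theorem Mem2.swapNeg (h : P.Mem2 γ) : P.swapNeg.Mem2 γ :=
  { h.toMem11.swapNeg with
    mq'' := h.mr''
    mr'' := h.mq''.neg
    dq' := h.dr'
    dr' := h.dq'.neg
    nq'' := h.nr''
    nr'' := (eLpNorm_neg _ _ _).trans_le h.nq'' }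

theorem dist11_swapNeg (P W : Pot) : dist11 P.swapNeg W.swapNeg = dist11 P W := by
  have e : ∀ f g : ℝ → ℂ, -f - -g = -(f - g) := fun f g => by ring
  simp only [dist11, Pot.swapNeg, e, norm21_neg]
  ring

theorem dist2_swapNeg (P W : Pot) : dist2 P.swapNeg W.swapNeg = dist2 P W := by
  have e : ∀ f g : ℝ → ℂ, -f - -g = -(f - g) := fun f g => by ring
  rw [dist2, dist11_swapNeg, dist2]
  simp only [Pot.swapNeg, e, eLpNorm_neg]
  ring

theorem norm21_sgn_mul {f : ℝ → ℂ} (hf : Measurable f) (s : Side) :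
    norm21 (fun x => s.sgn * f (s.sgn * x)) = norm21 f := by
  rw [norm21_const_mul, s.enorm_sgn, one_mul, norm21_comp_sgn hf.aestronglyMeasurable]

theorem eLpNorm_sgn_mul {f : ℝ → ℂ} (hf : Measurable f) (s : Side) :
    eLpNorm (fun x => s.sgn * f (s.sgn * x)) 2 = eLpNorm f 2 := by
  rw [eLpNorm_const_mul, s.enorm_sgn, one_mul, eLpNorm_comp_sgn hf.aestronglyMeasurable]

theorem measurable_comp_sgn {f : ℝ → ℂ} (hf : Measurable f) (s : Side) :
    Measurable fun x => f (s.sgn * x) := hf.comp (measurable_const_mul _)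

theorem hasWeakDeriv_sgn {f g : ℝ → ℂ} (h : HasWeakDeriv f g) (s : Side) :
    HasWeakDeriv (fun x => s.sgn * f (s.sgn * x)) fun x => g (s.sgn * x) := by
  have := (h.comp_sgn s).const_mul s.sgn
  simpa only [← mul_assoc, s.ofReal_sgn_mul_sgn, one_mul] using this

theorem Mem11.side (h : P.Mem11 γ) (s : Side) : (P.side s).Mem11 γ :=
  ⟨(measurable_comp_sgn h.mq s).const_mul _, measurable_comp_sgn h.mq' s,
    measurable_comp_sgn h.mr s, (measurable_comp_sgn h.mr' s).const_mul _, hasWeakDeriv_sgn h.dq s,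
    h.dr.comp_sgn s, (norm21_sgn_mul h.mq s).trans_le h.nq,
    (norm21_comp_sgn h.mq'.aestronglyMeasurable s).trans_le h.nq',
    (norm21_comp_sgn h.mr.aestronglyMeasurable s).trans_le h.nr,
    (norm21_sgn_mul h.mr' s).trans_le h.nr'⟩

theorem Mem2.side (h : P.Mem2 γ) (s : Side) : (P.side s).Mem2 γ :=
  { h.toMem11.side s with
    mq'' := (measurable_comp_sgn h.mq'' s).const_mul _
    mr'' := measurable_comp_sgn h.mr'' s
    dq' := h.dq'.comp_sgn s
    dr' := hasWeakDeriv_sgn h.dr' s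
    nq'' := (eLpNorm_sgn_mul h.mq'' s).trans_le h.nq''
    nr'' := (eLpNorm_comp_sgn h.mr''.aestronglyMeasurable s).trans_le h.nr'' }

theorem dist11_side (hP : P.Mem11 γ) (hW : W.Mem11 γ) (s : Side) :
    dist11 (P.side s) (W.side s) = dist11 P W := by
  have e : ∀ f g : ℝ → ℂ, ((fun x => (s.sgn : ℂ) * f (s.sgn * x)) - fun x => s.sgn * g (s.sgn * x))
      = fun x => s.sgn * (f - g) (s.sgn * x) := fun f g => by
    funext x; simp only [Pi.sub_apply]; ring
  have e' : ∀ f g : ℝ → ℂ, ((fun x => f (s.sgn * x)) - fun x => g (s.sgn * x))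
      = fun x => (f - g) (s.sgn * x) := fun f g => rfl
  simp only [dist11, Pot.side, e, e']
  rw [norm21_sgn_mul (hP.mq.sub hW.mq), norm21_comp_sgn (hP.mq'.sub hW.mq').aestronglyMeasurable,
    norm21_comp_sgn (hP.mr.sub hW.mr).aestronglyMeasurable, norm21_sgn_mul (hP.mr'.sub hW.mr')]

theorem dist2_side (hP : P.Mem2 γ) (hW : W.Mem2 γ) (s : Side) :
    dist2 (P.side s) (W.side s) = dist2 P W := by
  have e : ∀ f g : ℝ → ℂ, ((fun x => (s.sgn : ℂ) * f (s.sgn * x)) - fun x => s.sgn * g (s.sgn * x))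
      = fun x => s.sgn * (f - g) (s.sgn * x) := fun f g => by
    funext x; simp only [Pi.sub_apply]; ring
  have e' : ∀ f g : ℝ → ℂ, ((fun x => f (s.sgn * x)) - fun x => g (s.sgn * x))
      = fun x => (f - g) (s.sgn * x) := fun f g => rfl
  rw [dist2, dist11_side hP.toMem11 hW.toMem11, dist2]
  simp only [Pot.side, e, e']
  rw [eLpNorm_sgn_mul (hP.mq''.sub hW.mq''),
    eLpNorm_comp_sgn (hP.mr''.sub hW.mr'').aestronglyMeasurable]

section OfFun

variable {σ : ℝ} {u w : ℝ → ℂ}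

theorem normH11_eq (u : ℝ → ℂ) : normH11 u = norm21 u + norm21 (weakDeriv u) := by
  simp [normH11, sobolevNorm, norm21, Finset.sum_range_succ]

theorem aestronglyMeasurable_of_weighted {s : ℝ} {f : ℝ → ℂ}
    (h : AEStronglyMeasurable (weighted s f)) : AEStronglyMeasurable f := by
  have h1 : AEStronglyMeasurable (weighted (-s) (weighted s f)) :=
    aestronglyMeasurable_weighted _ h
  have e : weighted (-s) (weighted s f) = f := by
    funext x
    have h0 : 0 < √(1 + x ^ 2) := zero_lt_one.trans_le (one_le_sqrt_one_add_sq x)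
    rw [weighted, weighted, smul_smul, ← Real.rpow_add h0, neg_add_cancel, Real.rpow_zero, one_smul]
  rwa [e] at h1

theorem memH11_spec (u : ℝ → ℂ) (h : MemH11 u) : AEStronglyMeasurable u ∧
    HasWeakDeriv u (weakDeriv u) ∧ AEStronglyMeasurable (weakDeriv u) := by
  obtain ⟨h1, g, h2, h3⟩ := h
  have h4 := hasWeakDeriv_weakDeriv h2
  exact ⟨aestronglyMeasurable_of_weighted h1.1, h4,
    (aestronglyMeasurable_of_weighted (MemLp.aestronglyMeasurable h3)).congr (h2.ae_unique h4)⟩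

theorem memH2H11_spec (u : ℝ → ℂ) (h : MemH2H11 u) :
    HasWeakDeriv (weakDeriv u) (weakDeriv (weakDeriv u)) ∧
      AEStronglyMeasurable (weakDeriv (weakDeriv u)) := by
  obtain ⟨⟨h1, g, h2, h3, k, h4, h5⟩, -⟩ := h
  have h6 := weakDeriv_ae_eq h2
  have h7 := h4.congr h6.symm (Filter.EventuallyEq.refl _ _)
  have h8 := hasWeakDeriv_weakDeriv h7
  exact ⟨h8, (aestronglyMeasurable_of_weighted (MemLp.aestronglyMeasurable h5)).congr
    (h7.ae_unique h8)⟩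

theorem sub_rep_ae_eq (hu : AEStronglyMeasurable u) (hw : AEStronglyMeasurable w) :
    rep u - rep w =ᵐ[volume] u - w := (rep_ae_eq hu).sub (rep_ae_eq hw)

theorem weakDeriv_sub_ae_eq {u w u' w' : ℝ → ℂ} (hu : HasWeakDeriv u u') (hw : HasWeakDeriv w w') :
    u' - w' =ᵐ[volume] weakDeriv (u - w) := (weakDeriv_ae_eq (hu.sub hw)).symm

variable (hσ : σ = 1 ∨ σ = -1)
include hσ

theorem mem11_ofFun (hu : MemH11 u) (hγ : normH11 u ≤ γ) : (ofFun σ u).Mem11 γ := by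
  obtain ⟨h1, h2, h3⟩ := memH11_spec u hu
  rw [normH11_eq] at hγ
  have m1 := (measurable_rep u).aestronglyMeasurable (μ := volume)
  have m2 := (measurable_rep (weakDeriv u)).aestronglyMeasurable (μ := volume)
  have hd : HasWeakDeriv (rep u) (rep (weakDeriv u)) :=
    h2.congr (rep_ae_eq h1).symm (rep_ae_eq h3).symm
  have n1 : norm21 (rep u) ≤ γ := (norm21_congr (rep_ae_eq h1)).trans_le (le_self_add.trans hγ)
  have n2 : norm21 (rep (weakDeriv u)) ≤ γ :=
    (norm21_congr (rep_ae_eq h3)).trans_le (le_add_self.trans hγ)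
  exact ⟨measurable_rep _, measurable_rep _, measurable_vOf σ (measurable_rep _),
    (measurable_vOf σ (measurable_rep _)).neg, hd, hd.vOf σ, n1, n2, (norm21_vOf hσ m1).trans_le n1,
    (norm21_neg _).trans_le ((norm21_vOf hσ m2).trans_le n2)⟩

/-- The second potential depends on u by a real-linear isometry, so it doubles the distance. -/
theorem dist11_ofFun_le (hu : MemH11 u) (hw : MemH11 w) :
    dist11 (ofFun σ u) (ofFun σ w) ≤ 2 * normH11 (u - w) := by
  obtain ⟨h1, h2, h3⟩ := memH11_spec u hu
  obtain ⟨k1, k2, k3⟩ := memH11_spec w hw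
  have e : ∀ f g : ℝ → ℂ, -f - -g = -(f - g) := fun f g => by ring
  have m1 := ((measurable_rep u).sub (measurable_rep w)).aestronglyMeasurable (μ := volume)
  have m2 := ((measurable_rep (weakDeriv u)).sub
    (measurable_rep (weakDeriv w))).aestronglyMeasurable (μ := volume)
  have n1 := norm21_congr (sub_rep_ae_eq h1 k1)
  have n2 := norm21_congr ((sub_rep_ae_eq h3 k3).trans (weakDeriv_sub_ae_eq h2 k2))
  simp only [dist11, ofFun, e, norm21_neg, vOf_sub]
  rw [norm21_vOf hσ m1, norm21_vOf hσ m2, normH11_eq, n1, n2]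
  exact le_of_eq (by ring)

theorem mem2_ofFun (hu : MemH2H11 u) (hγ : normH2H11 u ≤ γ) : (ofFun σ u).Mem2 γ := by
  obtain ⟨h1, h2, h3⟩ := memH11_spec u hu.2
  obtain ⟨h4, h5⟩ := memH2H11_spec u hu
  have hd : HasWeakDeriv (rep (weakDeriv u)) (rep (weakDeriv (weakDeriv u))) :=
    h4.congr (rep_ae_eq h3).symm (rep_ae_eq h5).symm
  have m1 := (measurable_rep (weakDeriv (weakDeriv u))).aestronglyMeasurable (μ := volume)
  have n1 : eLpNorm (rep (weakDeriv (weakDeriv u))) 2 ≤ γ := by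
    rw [eLpNorm_congr_ae (rep_ae_eq h5)]
    refine le_trans ?_ (le_self_add.trans hγ)
    simp only [sobolevNorm, Finset.sum_range_succ, weighted_zero, Function.iterate_succ,
      Function.comp_apply, Function.iterate_zero, id_eq]
    exact le_add_self
  exact { mem11_ofFun hσ hu.2 (le_add_self.trans hγ) with
    mq'' := measurable_rep _
    mr'' := measurable_vOf σ (measurable_rep _)
    dq' := hd
    dr' := by
      have := (hd.vOf σ).neg
      rwa [neg_neg] at this
    nq'' := n1
    nr'' := (eLpNorm_vOf hσ m1).trans_le n1 }

theorem dist2_ofFun_le (hu : MemH2H11 u) (hw : MemH2H11 w) :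
    dist2 (ofFun σ u) (ofFun σ w) ≤ 2 * normH2H11 (u - w) := by
  obtain ⟨h1, h2, h3⟩ := memH11_spec u hu.2
  obtain ⟨k1, k2, k3⟩ := memH11_spec w hw.2
  obtain ⟨h4, h5⟩ := memH2H11_spec u hu
  obtain ⟨k4, k5⟩ := memH2H11_spec w hw
  have m := ((measurable_rep (weakDeriv (weakDeriv u))).sub
    (measurable_rep (weakDeriv (weakDeriv w)))).aestronglyMeasurable (μ := volume)
  have e : weakDeriv (weakDeriv u) - weakDeriv (weakDeriv w) =ᵐ[volume]
      weakDeriv (weakDeriv (u - w)) :=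
    (h4.sub k4).ae_unique (hasWeakDeriv_weakDeriv
      ((h4.sub k4).congr (weakDeriv_sub_ae_eq h2 k2) (Filter.EventuallyEq.refl _ _)) |>.congr
      (weakDeriv_sub_ae_eq h2 k2).symm (Filter.EventuallyEq.refl _ _))
  have n := eLpNorm_congr_ae (p := 2) ((sub_rep_ae_eq h5 k5).trans e)
  have hle : eLpNorm (weakDeriv (weakDeriv (u - w))) 2 ≤ sobolevNorm 0 2 (u - w) := by
    simp only [sobolevNorm, Finset.sum_range_succ, weighted_zero, Function.iterate_succ,
      Function.comp_apply, Function.iterate_zero, id_eq]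
    exact le_add_self
  rw [dist2]
  simp only [ofFun, vOf_sub]
  rw [eLpNorm_vOf hσ m, n, add_assoc, normH2H11, mul_add, add_comm, ← two_mul]
  exact add_le_add (mul_le_mul_right hle 2) (dist11_ofFun_le hσ hu.2 hw.2)

end OfFun

end Pot

end

/-! ### Reflection of the system and uniqueness of bounded solutions -/

section

open Complex (I)

namespace Pot

variable {γ : ℝ≥0} {P : Pot} {s : Side} {z : ℝ} {n₁ n₂ : ℝ → ℂ}

/-- This and the next three identities explain the signs in `Pot.side`: every coefficient must pick
up the factor s.sgn of the substitution. That forces the sign on q once r is merely reflected, r'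
acquiring its sign from the chain rule. -/
theorem cA_side (s : Side) (P : Pot) (x : ℝ) : (P.side s).cA x = s.sgn * P.cA (s.sgn * x) := by
  simp only [cA, side]; ring

theorem cB_side (s : Side) (P : Pot) (x : ℝ) : (P.side s).cB x = s.sgn * P.cB (s.sgn * x) := by
  simp only [cB, side]; ring

theorem cC_side (s : Side) (P : Pot) (x : ℝ) : (P.side s).cC x = s.sgn * P.cC (s.sgn * x) := by
  simp only [cC, side]; ring

theorem cD_side (s : Side) (P : Pot) (x : ℝ) : (P.side s).cD x = s.sgn * P.cD (s.sgn * x) := by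
  simp only [cD, side]; ring

/-- `(n₁, n₂)` is a bounded solution of the Volterra system on the given side. -/
structure IsJost (P : Pot) (s : Side) (z : ℝ) (n₁ n₂ : ℝ → ℂ) : Prop where
  m₁ : AEStronglyMeasurable n₁
  m₂ : AEStronglyMeasurable n₂
  bdd : ∃ M, ∀ᵐ x, ‖n₁ x‖ ≤ M ∧ ‖n₂ x‖ ≤ M
  eq₁ : ∀ x, n₁ x = 1 + s.integral x fun y => P.cA y * n₁ y + P.cB y * n₂ y
  eq₂ : ∀ x, n₂ x = s.integral x fun y => Complex.exp (2 * I * z * (x - y)) *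
    (P.cC y * n₁ y + P.cD y * n₂ y)

theorem Mem11.isJost_sol (h : P.Mem11 γ) (s : Side) (z : ℝ) :
    P.IsJost s z (fun x => (P.side s).sol.1 (s.sgn * x) (s.sgn * z))
      fun x => (P.side s).sol.2 (s.sgn * x) (s.sgn * z) := by
  obtain ⟨h1, h2, ⟨M, hM⟩, h3, h4⟩ := (h.side s).isSol
  have hc : Continuous fun x : ℝ => (s.sgn * x, s.sgn * z) := by fun_prop
  refine ⟨(h1.comp hc).aestronglyMeasurable, (h2.comp hc).aestronglyMeasurable,
    ⟨M, Filter.Eventually.of_forall fun x => hM _ _⟩, fun x => ?_, fun x => ?_⟩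
  · rw [h3, s.integral_eq, ← integral_smul]
    congr 2
    funext y
    rw [cA_side, cB_side, Side.sgn_mul_sgn_mul, Complex.real_smul]
    ring
  · rw [h4, s.integral_eq, ← integral_smul]
    congr 1
    funext y
    rw [cC_side, cD_side, Side.sgn_mul_sgn_mul, Complex.real_smul]
    have e : 2 * I * ((s.sgn * z : ℝ) : ℂ) * (((s.sgn * x : ℝ) : ℂ) - y) =
        2 * I * z * (x - ((s.sgn * y : ℝ) : ℂ)) := by
      push_cast
      linear_combination (2 * I * z * x) * s.ofReal_sgn_mul_sgn
    rw [e]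
    ring

/-- Uniqueness after reflection to (-∞, x]. It identifies whichever bounded solution is selected in
the definition of the Jost functions with the jointly continuous one, at every x and z. -/
theorem IsJost.eq_sol (hn : P.IsJost s z n₁ n₂) (h : P.Mem11 γ) (x : ℝ) :
    n₁ x = (P.side s).sol.1 (s.sgn * x) (s.sgn * z) ∧
      n₂ x = (P.side s).sol.2 (s.sgn * x) (s.sgn * z) := by
  have hs := h.side s
  obtain ⟨h1, h2, ⟨M, hM⟩, h3, h4⟩ := hs.isSol
  obtain ⟨M', hM'⟩ := hn.bdd
  have mp := s.measurePreserving
  have hc : Continuous fun x : ℝ => (x, s.sgn * z) := by fun_prop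
  have key := volterra_solution_unique hs.isCoeff (z := s.sgn * z) (M := max M M')
    (m₁ := fun y => n₁ (s.sgn * y)) (m₂ := fun y => n₂ (s.sgn * y))
    (n₁ := fun y => (P.side s).sol.1 y (s.sgn * z)) (n₂ := fun y => (P.side s).sol.2 y (s.sgn * z))
    (hn.m₁.comp_measurePreserving mp) (hn.m₂.comp_measurePreserving mp)
    (h1.comp hc).aestronglyMeasurable (h2.comp hc).aestronglyMeasurable
    ((mp.quasiMeasurePreserving.ae hM').mono fun y hy =>
      ⟨hy.1.trans (le_max_right _ _), hy.2.trans (le_max_right _ _)⟩)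
    (Filter.Eventually.of_forall fun y =>
      ⟨(hM _ _).1.trans (le_max_left _ _), (hM _ _).2.trans (le_max_left _ _)⟩)
    (fun x => ?_) (fun x => ?_) (fun x => h3 _ _) (fun x => h4 _ _) (s.sgn * x)
  · simpa only [Side.sgn_mul_sgn_mul] using key
  · rw [hn.eq₁, s.integral_eq, ← integral_smul, Side.sgn_mul_sgn_mul]
    congr 2
    funext y
    rw [cA_side, cB_side, Complex.real_smul]
    ring
  · rw [hn.eq₂, s.integral_eq, ← integral_smul, Side.sgn_mul_sgn_mul]
    congr 1
    funext y
    rw [cC_side, cD_side, Complex.real_smul]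
    have e : 2 * I * ((s.sgn * z : ℝ) : ℂ) * ((x : ℂ) - y) =
        2 * I * z * (((s.sgn * x : ℝ) : ℂ) - ((s.sgn * y : ℝ) : ℂ)) := by
      push_cast; ring
    rw [e]
    ring

theorem mInf_side (s : Side) (P : Pot) (x : ℝ) :
    (P.side s).mInf (s.sgn * x) = Complex.exp (s.integral x P.cA) := by
  rw [mInf, s.integral_eq, ← integral_smul]
  congr 2
  funext y
  rw [cA_side, Complex.real_smul]

theorem leadDensity_side (s : Side) (P : Pot) (x : ℝ) :
    (P.side s).leadDensity x = P.leadDensity (s.sgn * x) := by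
  simp only [leadDensity, side]
  linear_combination (P.q (s.sgn * x) * P.r' (s.sgn * x) - 1 / (2 * I) * (P.q (s.sgn * x) *
    (P.q (s.sgn * x) * (P.r (s.sgn * x) * P.r (s.sgn * x))))) * s.ofReal_sgn_mul_sgn

/-- The reflection replaces z by s.sgn * z, so a coefficient of 1/z acquires the sign. -/
theorem lead₁_side (s : Side) (P : Pot) (x : ℝ) : s.sgn * (P.side s).lead₁ (s.sgn * x) =
    1 / 4 * Complex.exp (s.integral x P.cA) * s.integral x P.leadDensity := by
  rw [lead₁, mInf_side, s.integral_eq x P.leadDensity, Complex.real_smul]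
  simp only [leadDensity_side]
  ring

theorem lead₂_side (s : Side) (P : Pot) (x : ℝ) : s.sgn * (P.side s).lead₂ (s.sgn * x) =
    -(1 / (2 * I)) * (Complex.exp (s.integral x P.cA) * P.cC x) := by
  rw [lead₂, force, mInf_side, cC_side, Side.sgn_mul_sgn_mul]
  linear_combination (-(1 / (2 * I)) * (Complex.exp (s.integral x P.cA) * P.cC x)) *
    s.ofReal_sgn_mul_sgn

/-- The derivative of r · mInf is mInf (r' + a r), and a r = -(1/2i) q r² completes r' to c. This
matches the derivative in the stated coefficients with the density `force`. -/
theorem Mem11.hasWeakDeriv_r_mul_exp (h : P.Mem11 γ) (s : Side) :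
    HasWeakDeriv (fun x => P.r x * Complex.exp (s.integral x P.cA))
      fun x => Complex.exp (s.integral x P.cA) * P.cC x := by
  have h1 := (h.side s).hasWeakDeriv_mInf.comp_sgn s
  have h2 := h.dr.mul h1
  simp only [mInf_side, cA_side, Side.sgn_mul_sgn_mul] at h2
  refine h2.congr (Filter.EventuallyEq.refl _ _) (Filter.Eventually.of_forall fun x => ?_)
  beta_reduce
  generalize Complex.exp (s.integral x P.cA) = E
  simp only [cA, cC]
  linear_combination (P.r x * (-(1 / (2 * I)) * (P.q x * P.r x) * E)) * s.ofReal_sgn_mul_sgn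

end Pot

end

/-! ### Identification of the Jost functions and of their expansion coefficients -/

section

open Complex (I)

namespace Pot

variable {γ : ℝ≥0} {P : Pot} {s : Side} {z : ℝ}

theorem aestronglyMeasurable_pi {f : ℝ → Fin 2 → ℂ}
    (h : ∀ i, AEStronglyMeasurable fun x => f x i) : AEStronglyMeasurable f :=
  (aemeasurable_pi_iff.2 fun i => (h i).aemeasurable).aestronglyMeasurable

/-- The vector form of the Volterra system. -/
theorem isJost_iff (hP : P.Mem11 γ) {m : ℝ → Fin 2 → ℂ} {e : Fin 2 → ℂ} {f : ℝ → ℝ → Fin 2 → ℂ}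
    {i j : Fin 2} (hij : ∀ k, k = i ∨ k = j) (hi : e i = 1) (hj : e j = 0)
    (hfi : ∀ x, ∀ᵐ y, f x y i = P.cA y * m y i + P.cB y * m y j)
    (hfj : ∀ x, ∀ᵐ y, f x y j = Complex.exp (2 * I * z * (x - y)) *
      (P.cC y * m y i + P.cD y * m y j)) :
    (MemLp m ⊤ ∧ ∀ x, m x = e + s.integral x (f x)) ↔
      P.IsJost s z (fun x => m x i) fun x => m x j := by
  have hc := hP.isCoeff
  have key : (∃ M, ∀ᵐ x, ‖m x i‖ ≤ M ∧ ‖m x j‖ ≤ M) → (AEStronglyMeasurable fun x => m x i) →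
      (AEStronglyMeasurable fun x => m x j) → ∀ x, ∀ k, Integrable fun y => f x y k := by
    rintro ⟨M, hM⟩ h1 h2 x k
    have b1 := hM.mono fun x hx => hx.1
    have b2 := hM.mono fun x hx => hx.2
    rcases hij k with rfl | rfl
    · exact ((hc.ia.mul_bdd h1 b1).add (hc.ib.mul_bdd h2 b2)).congr
        ((hfi x).mono fun y hy => hy.symm)
    · exact (integrable_exp_mul ((hc.ic.mul_bdd h1 b1).add (hc.id.mul_bdd h2 b2)) x z).congr
        ((hfj x).mono fun y hy => hy.symm)
  constructor
  · rintro ⟨hm, h⟩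
    have hk : ∀ k, AEStronglyMeasurable fun x => m x k := fun k =>
      (continuous_apply k).comp_aestronglyMeasurable hm.1
    have hb : ∀ᵐ x, ‖m x‖ ≤ (eLpNorm m ⊤).toReal := by
      filter_upwards [ae_le_eLpNormEssSup (f := m) (μ := volume)] with x hx
      rw [← eLpNorm_exponent_top] at hx
      rw [← toReal_enorm]
      exact ENNReal.toReal_mono hm.2.ne hx
    have hM : ∃ M, ∀ᵐ x, ‖m x i‖ ≤ M ∧ ‖m x j‖ ≤ M :=
      ⟨_, hb.mono fun x hx => ⟨(norm_le_pi_norm _ _).trans hx, (norm_le_pi_norm _ _).trans hx⟩⟩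
    have hint := key hM (hk i) (hk j)
    refine ⟨hk i, hk j, hM, fun x => ?_, fun x => ?_⟩
    · rw [h x, Pi.add_apply, hi, s.integral_apply x (hint x), s.integral_congr_ae x (hfi x)]
    · rw [h x, Pi.add_apply, hj, zero_add, s.integral_apply x (hint x),
        s.integral_congr_ae x (hfj x)]
  · intro h
    have hint := key h.bdd h.m₁ h.m₂
    obtain ⟨M, hM⟩ := h.bdd
    refine ⟨memLp_top_of_bound (aestronglyMeasurable_pi fun k => ?_) M (hM.mono fun x hx => ?_),
      fun x => funext fun k => ?_⟩
    · rcases hij k with rfl | rfl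
      · exact h.m₁
      · exact h.m₂
    · refine (pi_norm_le_iff_of_nonneg ((norm_nonneg _).trans hx.1)).2 fun k => ?_
      rcases hij k with rfl | rfl
      · exact hx.1
      · exact hx.2
    · rcases hij k with rfl | rfl
      · rw [Pi.add_apply, hi, s.integral_apply x (hint x), s.integral_congr_ae x (hfi x)]
        exact h.eq₁ x
      · rw [Pi.add_apply, hj, zero_add, s.integral_apply x (hint x),
          s.integral_congr_ae x (hfj x)]
        exact h.eq₂ x

variable {σ : ℝ} {u : ℝ → ℂ}

theorem ae_ofFun (σ : ℝ) (hu : MemH11 u) : ∀ᵐ x, (ofFun σ u).q x = u x ∧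
    (ofFun σ u).q' x = weakDeriv u x ∧ (ofFun σ u).r x = vOf σ u x ∧
    (ofFun σ u).r' x = weakDeriv (vOf σ u) x := by
  obtain ⟨h1, h2, h3⟩ := memH11_spec u hu
  have e1 := rep_ae_eq h1
  have e2 := rep_ae_eq h3
  have e3 := (vOf_congr σ e2).neg.trans (weakDeriv_ae_eq (h2.vOf σ)).symm
  filter_upwards [e1, e2, vOf_congr σ e1, e3] with x h1 h2 h3 h4
  exact ⟨h1, h2, h3, h4⟩

theorem isJostMu_iff (hu : MemH11 u) (hP : (ofFun σ u).Mem11 γ) {m : ℝ → Fin 2 → ℂ} :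
    IsJostMu σ u s z m ↔ (ofFun σ u).IsJost s z (fun x => m x 0) fun x => m x 1 := by
  refine isJost_iff hP (i := 0) (j := 1) (fun k => ?_) (by simp [e1]) (by simp [e1])
    (fun x => ?_) fun x => ?_
  · fin_cases k <;> simp
  · filter_upwards [ae_ofFun σ hu] with y ⟨h1, _, h3, h4⟩
    simp only [cA, cB, h1, h3, Matrix.mulVec, dotProduct, Fin.sum_univ_two, Matrix.mul_apply, Q1,
      Matrix.smul_apply, Matrix.of_apply, Matrix.cons_val', Matrix.cons_val_zero,
      Matrix.cons_val_one, Matrix.cons_val_fin_one, smul_eq_mul]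
    ring
  · filter_upwards [ae_ofFun σ hu] with y ⟨h1, _, h3, h4⟩
    have hI : 1 / (2 * I) * (2 * I) = 1 := by field_simp
    simp only [cC, cD, h1, h3, h4, Matrix.mulVec, dotProduct, Fin.sum_univ_two, Matrix.mul_apply,
      Q1, Matrix.smul_apply, Matrix.of_apply, Matrix.cons_val', Matrix.cons_val_zero,
      Matrix.cons_val_one, Matrix.cons_val_fin_one, smul_eq_mul]
    linear_combination (Complex.exp (2 * I * z * (x - y)) * weakDeriv (vOf σ u) y * m y 0) * hI

/-- With its components exchanged, the second Volterra equation is the first one for (q, r) = (v,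
-u): then -u' - (1/2i) v u² is the upper right entry of `Q2`. The phase e^{-2iz(x-y)} is the
standard one at -z. -/
theorem isJostNu_iff (hu : MemH11 u) (hP : (ofFun σ u).Mem11 γ) {m : ℝ → Fin 2 → ℂ} :
    IsJostNu σ u s z m ↔
      (ofFun σ u).swapNeg.IsJost s (-z) (fun x => m x 1) fun x => m x 0 := by
  refine isJost_iff hP.swapNeg (i := 1) (j := 0) (fun k => ?_) (by simp [e2]) (by simp [e2])
    (fun x => ?_) fun x => ?_
  · fin_cases k <;> simp
  · filter_upwards [ae_ofFun σ hu] with y ⟨h1, _, h3, _⟩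
    simp only [cA, cB, swapNeg, Pi.neg_apply, h1, h3, Matrix.mulVec, dotProduct, Fin.sum_univ_two,
      Matrix.mul_apply, Q2, Matrix.smul_apply, Matrix.of_apply, Matrix.cons_val',
      Matrix.cons_val_zero, Matrix.cons_val_one, Matrix.cons_val_fin_one, smul_eq_mul]
    ring
  · filter_upwards [ae_ofFun σ hu] with y ⟨h1, h2, h3, _⟩
    have hI : 1 / (2 * I) * (2 * I) = 1 := by field_simp
    have hE : Complex.exp (2 * I * ((-z : ℝ) : ℂ) * (x - y)) =
        Complex.exp (-(2 * I * z * (x - y))) := by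
      congr 1; push_cast; ring
    rw [hE]
    simp only [cC, cD, swapNeg, Pi.neg_apply, h1, h2, h3, Matrix.mulVec, dotProduct,
      Fin.sum_univ_two, Matrix.mul_apply, Q2, Matrix.smul_apply, Matrix.of_apply, Matrix.cons_val',
      Matrix.cons_val_zero, Matrix.cons_val_one, Matrix.cons_val_fin_one, smul_eq_mul]
    linear_combination (-Complex.exp (-(2 * I * z * (x - y))) * weakDeriv u y * m y 1) * hI

theorem jostMu_eq (hu : MemH11 u) (hP : (ofFun σ u).Mem11 γ) (s : Side) (x z : ℝ) :
    jostMu σ u s x z = ![((ofFun σ u).side s).sol.1 (s.sgn * x) (s.sgn * z),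
      ((ofFun σ u).side s).sol.2 (s.sgn * x) (s.sgn * z)] := by
  have h : ∃ m, IsJostMu σ u s z m :=
    ⟨fun x => ![((ofFun σ u).side s).sol.1 (s.sgn * x) (s.sgn * z),
      ((ofFun σ u).side s).sol.2 (s.sgn * x) (s.sgn * z)],
      (isJostMu_iff hu hP).2 (hP.isJost_sol s z)⟩
  rw [jostMu, dif_pos h]
  have := ((isJostMu_iff hu hP).1 h.choose_spec).eq_sol hP x
  funext k
  fin_cases k
  · exact this.1
  · exact this.2

theorem jostNu_eq (hu : MemH11 u) (hP : (ofFun σ u).Mem11 γ) (s : Side) (x z : ℝ) :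
    jostNu σ u s x z = ![((ofFun σ u).swapNeg.side s).sol.2 (s.sgn * x) (s.sgn * -z),
      ((ofFun σ u).swapNeg.side s).sol.1 (s.sgn * x) (s.sgn * -z)] := by
  have h : ∃ m, IsJostNu σ u s z m :=
    ⟨fun x => ![((ofFun σ u).swapNeg.side s).sol.2 (s.sgn * x) (s.sgn * -z),
      ((ofFun σ u).swapNeg.side s).sol.1 (s.sgn * x) (s.sgn * -z)],
      (isJostNu_iff hu hP).2 (hP.swapNeg.isJost_sol s (-z))⟩
  rw [jostNu, dif_pos h]
  have := ((isJostNu_iff hu hP).1 h.choose_spec).eq_sol hP.swapNeg x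
  funext k
  fin_cases k
  · exact this.2
  · exact this.1

theorem integral_const_mul' (s : Side) (x : ℝ) (c : ℂ) (f : ℝ → ℂ) :
    s.integral x (fun y => c * f y) = c * s.integral x f := by
  cases s
  · simp only [Side.integral, integral_const_mul, mul_neg]
  · simp only [Side.integral, integral_const_mul]

theorem muInf_eq (hu : MemH11 u) (s : Side) (x : ℝ) :
    muInf σ u s x = Complex.exp (s.integral x (ofFun σ u).cA) := by
  rw [muInf, ← integral_const_mul']
  congr 1
  refine s.integral_congr_ae x ((ae_ofFun σ hu).mono fun y ⟨h1, _, h3, _⟩ => ?_)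
  simp only [cA, h1, h3]

theorem nuInf_eq (hu : MemH11 u) (s : Side) (x : ℝ) :
    nuInf σ u s x = Complex.exp (s.integral x (ofFun σ u).swapNeg.cA) := by
  rw [nuInf, ← integral_const_mul']
  congr 1
  refine s.integral_congr_ae x ((ae_ofFun σ hu).mono fun y ⟨h1, _, h3, _⟩ => ?_)
  simp only [cA, swapNeg, Pi.neg_apply, h1, h3]
  ring

theorem muRem_eq (hu : MemH11 u) (hP : (ofFun σ u).Mem11 γ) (s : Side) (x z : ℝ) :
    muRem σ u s x z = ![((ofFun σ u).side s).rem₁ (s.sgn * x) (s.sgn * z),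
      ((ofFun σ u).side s).rem₂ (s.sgn * x) (s.sgn * z)] := by
  rw [muRem, jostMu_eq hu hP, muInf_eq hu, ← mInf_side]
  funext k
  fin_cases k <;> simp [rem₁, rem₂, e1]

theorem nuRem_eq (hu : MemH11 u) (hP : (ofFun σ u).Mem11 γ) (s : Side) (x z : ℝ) :
    nuRem σ u s x z = ![((ofFun σ u).swapNeg.side s).rem₂ (s.sgn * x) (s.sgn * -z),
      ((ofFun σ u).swapNeg.side s).rem₁ (s.sgn * x) (s.sgn * -z)] := by
  rw [nuRem, jostNu_eq hu hP, nuInf_eq hu, ← mInf_side]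
  funext k
  fin_cases k <;> simp [rem₁, rem₂, e2]

theorem alpha_eq (hu : MemH11 u) (hP : (ofFun σ u).Mem11 γ) (s : Side) : ∀ᵐ x, alpha σ u s x =
    ![s.sgn * ((ofFun σ u).side s).lead₁ (s.sgn * x),
      s.sgn * ((ofFun σ u).side s).lead₂ (s.sgn * x)] := by
  have hd : HasWeakDeriv (fun y => vOf σ u y * muInf σ u s y)
      fun x => Complex.exp (s.integral x (ofFun σ u).cA) * (ofFun σ u).cC x := by
    refine (hP.hasWeakDeriv_r_mul_exp s).congr ((ae_ofFun σ hu).mono fun y ⟨_, _, h3, _⟩ => ?_)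
      (Filter.EventuallyEq.refl _ _)
    simp only [h3, muInf_eq hu]
  filter_upwards [weakDeriv_ae_eq hd] with x hx
  rw [lead₁_side, lead₂_side, alpha, hx, muInf_eq hu]
  congr 2
  refine s.integral_congr_ae x ((ae_ofFun σ hu).mono fun y ⟨h1, _, h3, h4⟩ => ?_)
  simp only [leadDensity, h1, h3, h4]
  ring

/-- The extra minus, compared with `alpha_eq`, is that of the parameter -z in the system for ν. -/
theorem beta_eq (hu : MemH11 u) (hP : (ofFun σ u).Mem11 γ) (s : Side) : ∀ᵐ x, beta σ u s x =
    ![-(s.sgn * ((ofFun σ u).swapNeg.side s).lead₂ (s.sgn * x)),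
      -(s.sgn * ((ofFun σ u).swapNeg.side s).lead₁ (s.sgn * x))] := by
  have hd : HasWeakDeriv (fun y => u y * nuInf σ u s y)
      fun x => -1 * (Complex.exp (s.integral x (ofFun σ u).swapNeg.cA) *
        (ofFun σ u).swapNeg.cC x) := by
    refine ((hP.swapNeg.hasWeakDeriv_r_mul_exp s).const_mul (-1)).congr
      ((ae_ofFun σ hu).mono fun y ⟨h1, _, _, _⟩ => ?_) (Filter.EventuallyEq.refl _ _)
    simp only [swapNeg, Pi.neg_apply, h1, nuInf_eq hu]
    ring
  have hl : ∀ x, s.integral x (fun y => weakDeriv u y * vOf σ u y +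
      1 / (2 * I) * u y ^ 2 * vOf σ u y ^ 2) =
      -1 * s.integral x (ofFun σ u).swapNeg.leadDensity := fun x => by
    rw [← integral_const_mul']
    refine s.integral_congr_ae x ((ae_ofFun σ hu).mono fun y ⟨h1, h2, h3, _⟩ => ?_)
    simp only [leadDensity, swapNeg, Pi.neg_apply, h1, h2, h3]
    ring
  filter_upwards [weakDeriv_ae_eq hd] with x hx
  rw [lead₁_side, lead₂_side, beta, hx, nuInf_eq hu]
  simp only [hl]
  congr 1
  · ring
  · congr 1
    ring

theorem muRem'_eq (hu : MemH11 u) (hP : (ofFun σ u).Mem11 γ) (s : Side) : ∀ᵐ x, ∀ z,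
    muRem' σ u s x z = ![s.sgn * ((ofFun σ u).side s).rem'₁ (s.sgn * x) (s.sgn * z),
      s.sgn * ((ofFun σ u).side s).rem'₂ (s.sgn * x) (s.sgn * z)] := by
  filter_upwards [alpha_eq hu hP s] with x hx z
  rw [muRem', hx, muRem_eq hu hP]
  funext k
  fin_cases k
  · simp only [rem'₁, Complex.ofReal_mul, Pi.sub_apply, Pi.smul_apply, Matrix.cons_val_zero,
      Fin.zero_eta, smul_eq_mul]
    linear_combination (-(z * ((ofFun σ u).side s).rem₁ (s.sgn * x) (s.sgn * z))) *
      s.ofReal_sgn_mul_sgn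
  · simp only [rem'₂, Complex.ofReal_mul, Pi.sub_apply, Pi.smul_apply, Matrix.cons_val_one,
      Matrix.cons_val_fin_one, Fin.mk_one, smul_eq_mul]
    linear_combination (-(z * ((ofFun σ u).side s).rem₂ (s.sgn * x) (s.sgn * z))) *
      s.ofReal_sgn_mul_sgn

theorem nuRem'_eq (hu : MemH11 u) (hP : (ofFun σ u).Mem11 γ) (s : Side) : ∀ᵐ x, ∀ z,
    nuRem' σ u s x z = ![-s.sgn * ((ofFun σ u).swapNeg.side s).rem'₂ (s.sgn * x) (s.sgn * -z),
      -s.sgn * ((ofFun σ u).swapNeg.side s).rem'₁ (s.sgn * x) (s.sgn * -z)] := by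
  filter_upwards [beta_eq hu hP s] with x hx z
  rw [nuRem', hx, nuRem_eq hu hP]
  funext k
  fin_cases k
  · simp only [rem'₂, Complex.ofReal_mul, Complex.ofReal_neg, Pi.sub_apply, Pi.smul_apply,
      Matrix.cons_val_zero, Fin.zero_eta, smul_eq_mul]
    linear_combination (-(z * ((ofFun σ u).swapNeg.side s).rem₂ (s.sgn * x) (s.sgn * -z))) *
      s.ofReal_sgn_mul_sgn
  · simp only [rem'₁, Complex.ofReal_mul, Complex.ofReal_neg, Pi.sub_apply, Pi.smul_apply,
      Matrix.cons_val_one, Matrix.cons_val_fin_one, Fin.mk_one, smul_eq_mul]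
    linear_combination (-(z * ((ofFun σ u).swapNeg.side s).rem₁ (s.sgn * x) (s.sgn * -z))) *
      s.ofReal_sgn_mul_sgn

end Pot

end

/-! ### From components to vectors, and the conclusion -/

section

open Complex (I)

theorem enorm_pi_le {i j : Fin 2} (hij : ∀ k, k = i ∨ k = j) (v : Fin 2 → ℂ) :
    ‖v‖ₑ ≤ ‖v i‖ₑ + ‖v j‖ₑ := by
  have h : ‖v‖ ≤ ‖v i‖ + ‖v j‖ := by
    refine (pi_norm_le_iff_of_nonneg (by positivity)).2 fun k => ?_
    rcases hij k with rfl | rfl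
    · exact le_add_of_nonneg_right (norm_nonneg _)
    · exact le_add_of_nonneg_left (norm_nonneg _)
  rw [← ofReal_norm, ← ofReal_norm, ← ofReal_norm, ← ENNReal.ofReal_add (norm_nonneg _)
    (norm_nonneg _)]
  exact ENNReal.ofReal_le_ofReal h

theorem eLpNorm_pi_le {i j : Fin 2} (hij : ∀ k, k = i ∨ k = j) {p₁ p₂ : ℝ → ℂ}
    (h₁ : Measurable p₁) (h₂ : Measurable p₂) (t : Side) {F : ℝ → Fin 2 → ℂ}
    (hi : ∀ z, ‖F z i‖ₑ = ‖p₁ (t.sgn * z)‖ₑ) (hj : ∀ z, ‖F z j‖ₑ = ‖p₂ (t.sgn * z)‖ₑ) :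
    eLpNorm F 2 ≤ eLpNorm (fun z => ‖p₁ z‖ₑ + ‖p₂ z‖ₑ) 2 := by
  have m : AEStronglyMeasurable (fun z => ‖p₁ z‖ₑ + ‖p₂ z‖ₑ) :=
    (h₁.enorm.add h₂.enorm).aestronglyMeasurable
  rw [← eLpNorm_comp_measurePreserving m t.measurePreserving]
  refine eLpNorm_mono_enorm fun z => ?_
  rw [Function.comp_apply, enorm_eq_self, ← hi, ← hj]
  exact enorm_pi_le hij _

theorem eLpNorm_pi_le_add {i j : Fin 2} (hij : ∀ k, k = i ∨ k = j) {G : ℝ → Fin 2 → ℂ}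
    (hi : MemLp (fun z => G z i) 2) (hj : MemLp (fun z => G z j) 2) :
    eLpNorm G 2 ≤ eLpNorm (fun z => G z i) 2 + eLpNorm (fun z => G z j) 2 := by
  rw [← eLpNorm_enorm fun z => G z i, ← eLpNorm_enorm fun z => G z j]
  refine le_trans (eLpNorm_mono_enorm fun z => ?_) (eLpNorm_add_le
    hi.1.enorm.aestronglyMeasurable hj.1.enorm.aestronglyMeasurable one_le_two)
  rw [Pi.add_apply, enorm_eq_self]
  exact enorm_pi_le hij _

/-- Difference quotient bounds for the components give a weak derivative of a vector function. -/
theorem exists_hasWeakDeriv_pi {i j : Fin 2} (hij : ∀ k, k = i ∨ k = j) (hne : i ≠ j)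
    {p₁ p₂ : ℝ → ℂ} (h₁ : Measurable p₁) (h₂ : Measurable p₂) (t : Side) {F : ℝ → Fin 2 → ℂ}
    (hi : ∀ z, F z i = p₁ (t.sgn * z)) (hj : ∀ z, F z j = p₂ (t.sgn * z)) {C : ℝ≥0}
    (hC : eLpNorm (fun z => ‖p₁ z‖ₑ + ‖p₂ z‖ₑ) 2 ≤ C)
    (hδ : ∀ δ : ℝ, eLpNorm (fun z => ‖p₁ (z + δ) - p₁ z‖ₑ + ‖p₂ (z + δ) - p₂ z‖ₑ) 2 ≤ C * ‖δ‖ₑ) :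
    ∃ G, HasWeakDeriv F G ∧ MemLp G 2 ∧ eLpNorm G 2 ≤ (2 * C : ℝ≥0) := by
  have key : ∀ p : ℝ → ℂ, Measurable p → (∀ z, ‖p z‖ₑ ≤ ‖p₁ z‖ₑ + ‖p₂ z‖ₑ) →
      (∀ δ z, ‖p (z + δ) - p z‖ₑ ≤ ‖p₁ (z + δ) - p₁ z‖ₑ + ‖p₂ (z + δ) - p₂ z‖ₑ) →
      ∃ g, HasWeakDeriv (fun z => p (t.sgn * z)) g ∧ MemLp g 2 ∧ eLpNorm g 2 ≤ C := by
    intro p hp hle hle'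
    have hL : MemLp p 2 := ⟨hp.aestronglyMeasurable, ((eLpNorm_mono_enorm fun z => by
      rw [enorm_eq_self]; exact hle z).trans hC).trans_lt ENNReal.coe_lt_top⟩
    obtain ⟨g, hg, hg2, hgC⟩ := exists_hasWeakDeriv_of_eLpNorm_translate_sub_le hL (C := C)
      fun δ => (eLpNorm_mono_enorm fun z => by rw [enorm_eq_self]; exact hle' δ z).trans (hδ δ)
    have hg3 := (hg2.comp_measurePreserving t.measurePreserving).const_mul (t.sgn : ℂ)
    refine ⟨_, hg.comp_sgn t, hg3, ?_⟩
    rw [eLpNorm_const_mul, t.enorm_sgn, one_mul, eLpNorm_comp_sgn hg2.1]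
    exact hgC
  obtain ⟨g₁, d₁, m₁, n₁⟩ := key p₁ h₁ (fun z => le_self_add) fun δ z => le_self_add
  obtain ⟨g₂, d₂, m₂, n₂⟩ := key p₂ h₂ (fun z => le_add_self) fun δ z => le_add_self
  obtain ⟨G, hGi, hGj⟩ : ∃ G : ℝ → Fin 2 → ℂ, (∀ z, G z i = g₁ z) ∧ ∀ z, G z j = g₂ z :=
    ⟨fun z k => if k = i then g₁ z else g₂ z, fun z => if_pos rfl, fun z => if_neg hne.symm⟩
  have e1 : (fun z => G z i) = g₁ := funext hGi
  have e2 : (fun z => G z j) = g₂ := funext hGj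
  have hn : eLpNorm G 2 ≤ (2 * C : ℝ≥0) := by
    refine (eLpNorm_pi_le_add hij (by rwa [e1]) (by rwa [e2])).trans ?_
    rw [e1, e2, ENNReal.coe_mul, ENNReal.coe_ofNat, two_mul]
    exact add_le_add n₁ n₂
  have hcomp : ∀ k, HasWeakDeriv (fun z => F z k) (fun z => G z k) ∧
      AEStronglyMeasurable fun z => G z k := fun k => by
    rcases hij k with rfl | rfl
    · rw [e1, funext hi]; exact ⟨d₁, m₁.1⟩
    · rw [e2, funext hj]; exact ⟨d₂, m₂.1⟩
  exact ⟨G, hasWeakDeriv_pi fun k => (hcomp k).1,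
    ⟨Pot.aestronglyMeasurable_pi fun k => (hcomp k).2, hn.trans_lt ENNReal.coe_lt_top⟩, hn⟩

theorem sobolevNorm_zero_one_le {F : ℝ → Fin 2 → ℂ} {C C' : ℝ≥0∞} (h : eLpNorm F 2 ≤ C)
    {G : ℝ → Fin 2 → ℂ} (hG : HasWeakDeriv F G) (hG' : eLpNorm G 2 ≤ C') :
    sobolevNorm 0 1 F ≤ C + C' := by
  simp only [sobolevNorm, Finset.sum_range_succ, Finset.range_zero, Finset.sum_empty, zero_add,
    weighted_zero, Function.iterate_zero, id_eq, Function.iterate_one]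
  exact add_le_add h ((eLpNorm_congr_ae (weakDeriv_ae_eq hG)).trans_le hG')

theorem Side.sgn_mul_nonpos {s : Side} {x : ℝ} (hx : x ∈ s.halfLine) : s.sgn * x ≤ 0 := by
  cases s
  · have : 0 < x := hx
    simp only [Side.sgn]; linarith
  · have : x < 0 := hx
    simp only [Side.sgn]; linarith

theorem Side.measurableSet_halfLine (s : Side) : MeasurableSet s.halfLine := by
  cases s
  · exact measurableSet_Ioi
  · exact measurableSet_Iio

theorem measurable_comp_sgn_sgn {p : ℝ → ℝ → ℂ} (hp : Measurable (Function.uncurry p))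
    (s t : Side) : Measurable fun q : ℝ × ℝ => p (s.sgn * q.1) (t.sgn * q.2) :=
  hp.comp ((measurable_fst.const_mul s.sgn).prodMk (measurable_snd.const_mul t.sgn))

namespace Pot

theorem dist11_ne_top {γ : ℝ≥0} {P W : Pot} (hP : P.Mem11 γ) (hW : W.Mem11 γ) :
    dist11 P W ≠ ⊤ := by
  have h1 := (lip_q γ).norm21_sub_ne_top hP hW
  have h2 := (lip_q' γ).norm21_sub_ne_top hP hW
  have h3 := (lip_r γ).norm21_sub_ne_top hP hW
  have h4 := (lip_r' γ).norm21_sub_ne_top hP hW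
  exact ENNReal.add_ne_top.2 ⟨ENNReal.add_ne_top.2 ⟨ENNReal.add_ne_top.2 ⟨h1, h2⟩, h3⟩, h4⟩

/-- The remainder of the Jost solution belongs to `L^∞_x H¹_z` on the half-line. -/
theorem Mem11.memLinftyH1 {γ : ℝ≥0} {P : Pot} (hP : P.Mem11 γ) (s t : Side) {i j : Fin 2}
    (hij : ∀ k, k = i ∨ k = j) (hne : i ≠ j) {F : ℝ → ℝ → Fin 2 → ℂ}
    (hi : ∀ x z, F x z i = P.rem₁ (s.sgn * x) (t.sgn * z))
    (hj : ∀ x z, F x z j = P.rem₂ (s.sgn * x) (t.sgn * z)) : MemLinftyH1 s.halfLine F := by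
  obtain ⟨C, hC⟩ := Pot.exists_rem_bound γ
  have m1 := hP.measurable_rem₁
  have m2 := hP.measurable_rem₂
  have hF : Measurable (Function.uncurry F) := measurable_pi_iff.2 fun k => by
    rcases hij k with rfl | rfl
    · simp only [Function.uncurry_def, hi]
      exact measurable_comp_sgn_sgn m1 s t
    · simp only [Function.uncurry_def, hj]
      exact measurable_comp_sgn_sgn m2 s t
  have hb : ∀ x ∈ s.halfLine, eLpNorm (vsum P.rem₁ P.rem₂ (s.sgn * x)) 2 ≤ C := fun x hx =>
    (hC P hP _ (Side.sgn_mul_nonpos hx)).1.trans (mul_le_of_le_one_right' (rho_le_one _))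
  refine memLinftyH1_of_bound hF (C := C) (C' := 2 * C)
    ((ae_restrict_iff' s.measurableSet_halfLine).2 (Filter.Eventually.of_forall fun x hx => ?_))
    ((ae_restrict_iff' s.measurableSet_halfLine).2 (Filter.Eventually.of_forall fun x hx => ?_))
    (Filter.Eventually.of_forall fun x => rfl)
  · exact (eLpNorm_pi_le hij m1.of_uncurry_left m2.of_uncurry_left t (fun z => by rw [hi])
      (fun z => by rw [hj])).trans (hb x hx)
  · exact exists_hasWeakDeriv_pi hij hne m1.of_uncurry_left m2.of_uncurry_left t (hi x) (hj x)
      (hb x hx) (hC P hP _ (Side.sgn_mul_nonpos hx)).2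

/-- The remainder of the Jost solution is Lipschitz continuous with values in `L^∞_x H¹_z`. -/
theorem exists_linftyH1Norm_le (γ : ℝ≥0) : ∃ C : ℝ≥0, ∀ P ∈ ball11 γ, ∀ W ∈ ball11 γ,
    ∀ (s t : Side) (i j : Fin 2), (∀ k, k = i ∨ k = j) → i ≠ j → ∀ F G : ℝ → ℝ → Fin 2 → ℂ,
    (∀ x z, F x z i = P.rem₁ (s.sgn * x) (t.sgn * z)) →
    (∀ x z, F x z j = P.rem₂ (s.sgn * x) (t.sgn * z)) →
    (∀ x z, G x z i = W.rem₁ (s.sgn * x) (t.sgn * z)) →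
    (∀ x z, G x z j = W.rem₂ (s.sgn * x) (t.sgn * z)) →
    linftyH1Norm s.halfLine (fun x z => F x z - G x z) ≤ C * dist11 P W := by
  obtain ⟨C, hC⟩ := exists_rem_lip γ
  -- One C for the function, and one for the derivative of each of its two components.
  refine ⟨3 * C, fun P hP W hW s t i j hij hne F G hFi hFj hGi hGj => ?_⟩
  -- The difference quotient criterion asks for a finite constant, so finiteness of the distance is
  -- used here.
  obtain ⟨D, hD⟩ : ∃ D : ℝ≥0, (D : ℝ≥0∞) = C * dist11 P W :=
    ⟨_, ENNReal.coe_toNNReal (ENNReal.mul_ne_top ENNReal.coe_ne_top (dist11_ne_top hP hW))⟩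
  have m1 : ∀ x, Measurable fun z => P.rem₁ x z - W.rem₁ x z := fun x =>
    (Mem11.measurable_rem₁ hP).of_uncurry_left.sub (Mem11.measurable_rem₁ hW).of_uncurry_left
  have m2 : ∀ x, Measurable fun z => P.rem₂ x z - W.rem₂ x z := fun x =>
    (Mem11.measurable_rem₂ hP).of_uncurry_left.sub (Mem11.measurable_rem₂ hW).of_uncurry_left
  refine essSup_le_of_ae_le _ ((ae_restrict_iff' s.measurableSet_halfLine).2
    (Filter.Eventually.of_forall fun x hx => ?_))
  obtain ⟨h1, h2⟩ := hC P hP W hW _ (Side.sgn_mul_nonpos hx)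
  rw [← hD] at h1 h2
  have hi : ∀ z, F x z i - G x z i =
      P.rem₁ (s.sgn * x) (t.sgn * z) - W.rem₁ (s.sgn * x) (t.sgn * z) := fun z => by
    rw [hFi, hGi]
  have hj : ∀ z, F x z j - G x z j =
      P.rem₂ (s.sgn * x) (t.sgn * z) - W.rem₂ (s.sgn * x) (t.sgn * z) := fun z => by
    rw [hFj, hGj]
  obtain ⟨g, hg, -, hgn⟩ := exists_hasWeakDeriv_pi hij hne (m1 _) (m2 _) t
    (F := fun z => F x z - G x z) hi hj h1 h2
  have h3 := eLpNorm_pi_le hij (m1 _) (m2 _) t (F := fun z => F x z - G x z)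
    (fun z => congrArg enorm (hi z)) (fun z => congrArg enorm (hj z))
  refine (sobolevNorm_zero_one_le (h3.trans h1) hg hgn).trans (le_of_eq ?_)
  rw [ENNReal.coe_mul, ENNReal.coe_mul, mul_assoc, ← hD, ENNReal.coe_ofNat, ENNReal.coe_ofNat]
  ring

/-- The first order remainder of the Jost solution belongs to `L^∞_x L²_z`. -/
theorem Mem2.memLinftyL2 {γ : ℝ≥0} {P : Pot} (hP : P.Mem2 γ) (s t : Side) {c : ℂ} (hc : ‖c‖ₑ = 1)
    {i j : Fin 2} (hij : ∀ k, k = i ∨ k = j) (hne : i ≠ j) {F : ℝ → ℝ → Fin 2 → ℂ}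
    (hF : ∀ᵐ x, ∀ z, F x z i = c * P.rem'₁ (s.sgn * x) (t.sgn * z) ∧
      F x z j = c * P.rem'₂ (s.sgn * x) (t.sgn * z)) : MemLinftyL2 univ F := by
  obtain ⟨C, hC⟩ := Pot.exists_rem'_bound γ
  have m1 := hP.toMem11.measurable_rem'₁
  have m2 := hP.toMem11.measurable_rem'₂
  -- The formula for F holds only for almost every x. Imposing it everywhere gives the jointly
  -- measurable version that `memLinftyL2_of_bound` asks for.
  obtain ⟨f, hfi, hfj⟩ : ∃ f : ℝ → ℝ → Fin 2 → ℂ,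
      (∀ x z, f x z i = c * P.rem'₁ (s.sgn * x) (t.sgn * z)) ∧
      ∀ x z, f x z j = c * P.rem'₂ (s.sgn * x) (t.sgn * z) :=
    ⟨fun x z k => if k = i then c * P.rem'₁ (s.sgn * x) (t.sgn * z) else
      c * P.rem'₂ (s.sgn * x) (t.sgn * z), fun x z => if_pos rfl, fun x z => if_neg hne.symm⟩
  have hf : Measurable (Function.uncurry f) := measurable_pi_iff.2 fun k => by
    rcases hij k with rfl | rfl
    · simp only [Function.uncurry_def, hfi]
      exact (measurable_comp_sgn_sgn m1 s t).const_mul c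
    · simp only [Function.uncurry_def, hfj]
      exact (measurable_comp_sgn_sgn m2 s t).const_mul c
  have h := memLinftyL2_of_bound (S := univ) (f' := F) hf (C := C) ?_ ?_
  · exact ⟨toL2 f, h.1, h.2⟩
  · rw [Measure.restrict_univ]
    filter_upwards [s.measurePreserving.quasiMeasurePreserving.ae (hC P hP)] with x hx
    exact (eLpNorm_pi_le hij m1.of_uncurry_left m2.of_uncurry_left t
      (fun z => by rw [hfi, enorm_mul, hc, one_mul])
      (fun z => by rw [hfj, enorm_mul, hc, one_mul])).trans hx
  · rw [Measure.restrict_univ]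
    filter_upwards [hF] with x hx
    funext z k
    rcases hij k with rfl | rfl
    · rw [hfi, (hx z).1]
    · rw [hfj, (hx z).2]

/-- The first order remainder is Lipschitz continuous with values in `L^∞_x L²_z`. -/
theorem exists_linftyL2Norm_le (γ : ℝ≥0) : ∃ C : ℝ≥0, ∀ P ∈ ball2 γ, ∀ W ∈ ball2 γ,
    ∀ (s t : Side) (c : ℂ), ‖c‖ₑ = 1 → ∀ (i j : Fin 2), (∀ k, k = i ∨ k = j) →
    ∀ F G : ℝ → ℝ → Fin 2 → ℂ,
    (∀ᵐ x, ∀ z, F x z i = c * P.rem'₁ (s.sgn * x) (t.sgn * z) ∧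
      F x z j = c * P.rem'₂ (s.sgn * x) (t.sgn * z)) →
    (∀ᵐ x, ∀ z, G x z i = c * W.rem'₁ (s.sgn * x) (t.sgn * z) ∧
      G x z j = c * W.rem'₂ (s.sgn * x) (t.sgn * z)) →
    linftyL2Norm univ (fun x z => F x z - G x z) ≤ C * dist2 P W := by
  obtain ⟨C, hC⟩ := exists_rem'_lip γ
  refine ⟨C, fun P hP W hW s t c hc i j hij F G hF hG => essSup_le_of_ae_le _ ?_⟩
  have hP' := ball2_subset γ hP
  have hW' := ball2_subset γ hW
  rw [Measure.restrict_univ]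
  filter_upwards [s.measurePreserving.quasiMeasurePreserving.ae (hC P hP W hW), hF, hG]
    with x hx hFx hGx
  refine (eLpNorm_pi_le hij
    ((Mem11.measurable_rem'₁ hP').of_uncurry_left.sub (Mem11.measurable_rem'₁ hW').of_uncurry_left)
    ((Mem11.measurable_rem'₂ hP').of_uncurry_left.sub (Mem11.measurable_rem'₂ hW').of_uncurry_left)
    t (fun z => ?_) fun z => ?_).trans hx
  · rw [Pi.sub_apply, (hFx z).1, (hGx z).1, ← mul_sub, enorm_mul, hc, one_mul]
    rfl
  · rw [Pi.sub_apply, (hFx z).2, (hGx z).2, ← mul_sub, enorm_mul, hc, one_mul]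
    rfl

/-- For ν the sign on z is opposite to the sign on x, which is why the estimates above carry two
independent sides s and t. -/
theorem exists_sgn_mul_neg (s : Side) : ∃ t : Side, ∀ z, s.sgn * -z = t.sgn * z := by
  cases s
  · exact ⟨Side.minus, fun z => by simp [Side.sgn]⟩
  · exact ⟨Side.plus, fun z => by simp [Side.sgn]⟩

theorem eq_zero_or_one (k : Fin 2) : k = 0 ∨ k = 1 := by omega

theorem eq_one_or_zero (k : Fin 2) : k = 1 ∨ k = 0 := by omega

theorem enorm_neg_sgn (s : Side) : ‖-(s.sgn : ℂ)‖ₑ = 1 := by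
  rw [enorm_neg, s.enorm_sgn]

theorem normH11_ne_top {u : ℝ → ℂ} (h : MemH11 u) : normH11 u ≠ ⊤ := by
  obtain ⟨h1, g, h2, h3⟩ := h
  rw [normH11_eq, norm21_congr (weakDeriv_ae_eq h2)]
  exact ENNReal.add_ne_top.2 ⟨h1.2.ne, (MemLp.eLpNorm_lt_top h3).ne⟩

theorem normH2H11_ne_top {u : ℝ → ℂ} (h : MemH2H11 u) : normH2H11 u ≠ ⊤ := by
  refine ENNReal.add_ne_top.2 ⟨?_, normH11_ne_top h.2⟩
  obtain ⟨⟨h1, g, h2, h3, k, h4, h5⟩, -⟩ := h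
  have h6 := weakDeriv_ae_eq h2
  have h7 := weakDeriv_ae_eq (h4.congr h6.symm (Filter.EventuallyEq.refl _ _))
  simp only [sobolevNorm, Finset.sum_range_succ, Finset.range_zero, Finset.sum_empty, zero_add,
    weighted_zero, Function.iterate_succ, Function.comp_apply, Function.iterate_zero, id_eq]
  rw [eLpNorm_congr_ae h6, eLpNorm_congr_ae h7]
  rw [weighted_zero] at h1 h3
  have h8 : MemLp k 2 := by simpa only [MemSobolev, weighted_zero] using h5
  exact ENNReal.add_ne_top.2 ⟨ENNReal.add_ne_top.2 ⟨h1.2.ne, h3.2.ne⟩, h8.2.ne⟩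

variable {σ : ℝ} (hσ : σ = 1 ∨ σ = -1)
include hσ

theorem memLinftyH1_rem {u : ℝ → ℂ} (hu : MemH11 u) (s : Side) :
    MemLinftyH1 s.halfLine (muRem σ u s) ∧ MemLinftyH1 s.halfLine (nuRem σ u s) := by
  obtain ⟨γ, hγ⟩ : ∃ γ : ℝ≥0, normH11 u ≤ γ :=
    ⟨_, (ENNReal.coe_toNNReal (normH11_ne_top hu)).ge⟩
  have hP := mem11_ofFun hσ hu hγ
  obtain ⟨t, ht⟩ := exists_sgn_mul_neg s
  refine ⟨(hP.side s).memLinftyH1 s s eq_zero_or_one zero_ne_one (fun x z => ?_) fun x z => ?_,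
    (hP.swapNeg.side s).memLinftyH1 s t eq_one_or_zero one_ne_zero (fun x z => ?_) fun x z => ?_⟩
  · rw [muRem_eq hu hP]; rfl
  · rw [muRem_eq hu hP]; rfl
  · rw [nuRem_eq hu hP, ht]; rfl
  · rw [nuRem_eq hu hP, ht]; rfl

theorem exists_linftyH1Norm_rem_le (γ : ℝ≥0) : ∃ C : ℝ≥0, ∀ u w : ℝ → ℂ, MemH11 u → MemH11 w →
    normH11 u ≤ γ → normH11 w ≤ γ → ∀ s : Side,
    linftyH1Norm s.halfLine (fun x z => muRem σ u s x z - muRem σ w s x z) ≤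
      C * normH11 (u - w) ∧
    linftyH1Norm s.halfLine (fun x z => nuRem σ u s x z - nuRem σ w s x z) ≤
      C * normH11 (u - w) := by
  obtain ⟨C, hC⟩ := exists_linftyH1Norm_le γ
  refine ⟨2 * C, fun u w hu hw hγ hγ' s => ?_⟩
  have hP := mem11_ofFun hσ hu hγ
  have hW := mem11_ofFun hσ hw hγ'
  obtain ⟨t, ht⟩ := exists_sgn_mul_neg s
  have hle : C * dist11 (ofFun σ u) (ofFun σ w) ≤ (2 * C : ℝ≥0) * normH11 (u - w) := by
    refine (mul_le_mul_right (dist11_ofFun_le hσ hu hw) _).trans (le_of_eq ?_)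
    push_cast; ring
  constructor
  · refine (hC _ (hP.side s) _ (hW.side s) s s 0 1 eq_zero_or_one zero_ne_one _ _
      (fun x z => ?_) (fun x z => ?_) (fun x z => ?_) (fun x z => ?_)).trans ?_
    · rw [muRem_eq hu hP]; rfl
    · rw [muRem_eq hu hP]; rfl
    · rw [muRem_eq hw hW]; rfl
    · rw [muRem_eq hw hW]; rfl
    · rwa [dist11_side hP hW]
  · refine (hC _ (hP.swapNeg.side s) _ (hW.swapNeg.side s) s t 1 0 eq_one_or_zero one_ne_zero _ _
      (fun x z => ?_) (fun x z => ?_) (fun x z => ?_) (fun x z => ?_)).trans ?_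
    · rw [nuRem_eq hu hP, ht]; rfl
    · rw [nuRem_eq hu hP, ht]; rfl
    · rw [nuRem_eq hw hW, ht]; rfl
    · rw [nuRem_eq hw hW, ht]; rfl
    · rwa [dist11_side hP.swapNeg hW.swapNeg, dist11_swapNeg]

theorem memLinftyL2_rem' {u : ℝ → ℂ} (hu : MemH2H11 u) (s : Side) :
    MemLinftyL2 univ (muRem' σ u s) ∧ MemLinftyL2 univ (nuRem' σ u s) := by
  obtain ⟨γ, hγ⟩ : ∃ γ : ℝ≥0, normH2H11 u ≤ γ :=
    ⟨_, (ENNReal.coe_toNNReal (normH2H11_ne_top hu)).ge⟩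
  have hP := mem2_ofFun hσ hu hγ
  obtain ⟨t, ht⟩ := exists_sgn_mul_neg s
  refine ⟨(hP.side s).memLinftyL2 s s s.enorm_sgn eq_zero_or_one zero_ne_one
    ((muRem'_eq hu.2 hP.toMem11 s).mono fun x hx z => ?_),
    (hP.swapNeg.side s).memLinftyL2 s t (enorm_neg_sgn s) eq_one_or_zero one_ne_zero
    ((nuRem'_eq hu.2 hP.toMem11 s).mono fun x hx z => ?_)⟩
  · rw [hx z]; exact ⟨rfl, rfl⟩
  · rw [hx z, ht]; exact ⟨rfl, rfl⟩

theorem exists_linftyL2Norm_rem'_le (γ : ℝ≥0) : ∃ C : ℝ≥0, ∀ u w : ℝ → ℂ, MemH2H11 u →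
    MemH2H11 w → normH2H11 u ≤ γ → normH2H11 w ≤ γ → ∀ s : Side,
    linftyL2Norm univ (fun x z => muRem' σ u s x z - muRem' σ w s x z) ≤
      C * normH2H11 (u - w) ∧
    linftyL2Norm univ (fun x z => nuRem' σ u s x z - nuRem' σ w s x z) ≤
      C * normH2H11 (u - w) := by
  obtain ⟨C, hC⟩ := exists_linftyL2Norm_le γ
  refine ⟨2 * C, fun u w hu hw hγ hγ' s => ?_⟩
  have hP := mem2_ofFun hσ hu hγ
  have hW := mem2_ofFun hσ hw hγ'
  obtain ⟨t, ht⟩ := exists_sgn_mul_neg s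
  have hle : C * dist2 (ofFun σ u) (ofFun σ w) ≤ (2 * C : ℝ≥0) * normH2H11 (u - w) := by
    refine (mul_le_mul_right (dist2_ofFun_le hσ hu hw) _).trans (le_of_eq ?_)
    push_cast; ring
  constructor
  · refine (hC _ (hP.side s) _ (hW.side s) s s _ s.enorm_sgn 0 1 eq_zero_or_one _ _
      ((muRem'_eq hu.2 hP.toMem11 s).mono fun x hx z => ?_)
      ((muRem'_eq hw.2 hW.toMem11 s).mono fun x hx z => ?_)).trans ?_
    · rw [hx z]; exact ⟨rfl, rfl⟩
    · rw [hx z]; exact ⟨rfl, rfl⟩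
    · rwa [dist2_side hP hW]
  · refine (hC _ (hP.swapNeg.side s) _ (hW.swapNeg.side s) s t _ (enorm_neg_sgn s) 1 0
      eq_one_or_zero _ _
      ((nuRem'_eq hu.2 hP.toMem11 s).mono fun x hx z => ?_)
      ((nuRem'_eq hw.2 hW.toMem11 s).mono fun x hx z => ?_)).trans ?_
    · rw [hx z, ht]; exact ⟨rfl, rfl⟩
    · rw [hx z, ht]; exact ⟨rfl, rfl⟩
    · rwa [dist2_side hP.swapNeg hW.swapNeg, dist2_swapNeg]

end Pot

end

end NDNLS

end

theorem mainTheorem9 (σ : ℝ) (hσ : σ = 1 ∨ σ = -1) :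
    (∀ u : ℝ → ℂ, NDNLS.MemH11 u → ∀ s : NDNLS.Side,
      NDNLS.MemLinftyH1 s.halfLine (NDNLS.muRem σ u s) ∧
      NDNLS.MemLinftyH1 s.halfLine (NDNLS.nuRem σ u s)) ∧
    (∀ γ : ℝ≥0, ∃ C : ℝ≥0, ∀ u w : ℝ → ℂ, NDNLS.MemH11 u → NDNLS.MemH11 w →
      NDNLS.normH11 u ≤ γ → NDNLS.normH11 w ≤ γ → ∀ s : NDNLS.Side,
      NDNLS.linftyH1Norm s.halfLine (fun x z => NDNLS.muRem σ u s x z - NDNLS.muRem σ w s x z)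
        ≤ C * NDNLS.normH11 (u - w) ∧
      NDNLS.linftyH1Norm s.halfLine (fun x z => NDNLS.nuRem σ u s x z - NDNLS.nuRem σ w s x z)
        ≤ C * NDNLS.normH11 (u - w)) ∧
    (∀ u : ℝ → ℂ, NDNLS.MemH2H11 u → ∀ s : NDNLS.Side,
      NDNLS.MemLinftyL2 univ (NDNLS.muRem' σ u s) ∧
      NDNLS.MemLinftyL2 univ (NDNLS.nuRem' σ u s)) ∧
    (∀ γ : ℝ≥0, ∃ C : ℝ≥0, ∀ u w : ℝ → ℂ, NDNLS.MemH2H11 u → NDNLS.MemH2H11 w →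
      NDNLS.normH2H11 u ≤ γ → NDNLS.normH2H11 w ≤ γ → ∀ s : NDNLS.Side,
      NDNLS.linftyL2Norm univ (fun x z => NDNLS.muRem' σ u s x z - NDNLS.muRem' σ w s x z)
        ≤ C * NDNLS.normH2H11 (u - w) ∧
      NDNLS.linftyL2Norm univ (fun x z => NDNLS.nuRem' σ u s x z - NDNLS.nuRem' σ w s x z)
        ≤ C * NDNLS.normH2H11 (u - w)) := by
  exact ⟨fun u hu s => NDNLS.Pot.memLinftyH1_rem hσ hu s,
    NDNLS.Pot.exists_linftyH1Norm_rem_le hσ,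
    fun u hu s => NDNLS.Pot.memLinftyL2_rem' hσ hu s,
    NDNLS.Pot.exists_linftyL2Norm_rem'_le hσ⟩
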